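/- **Setting.** Let $X$ be either $L^\infty(\mathbb R)$ (represented by bounded Borel functions) or $C_b(\mathbb R)$. Let $\mathcal A$ be a (nonlinear, possibly unbounded) operator in $X$ whose domain $D\subset X$ is a translation invariant linear space containing all smooth functions with bounded derivatives. A sub- or supersolution of $$u_t=\mathcal A[u(\cdot,t)]\tag{1}$$ on $\mathbb R\times[0,T)$ is a bounded function $u$ with $u(\cdot,0)\in X$ and $u(\cdot,t)\in D$ for $0<t<T$, such that $t\mapsto u(\cdot,t)$ is continuous on $(0,T)$ for locally uniform convergence, $u(\cdot,t)\to u(\cdot,0)$ as $t\downarrow0$ (locally uniformly if $X=C_b$, weak-$*$ if $X=L^\infty$), and $u_t$ exists with $u_t\le\mathcal A[u]$, respectively $u_t\ge \mathcal A[u]$, pointwise for $0<t<T$. A solution is defined on $\mathbb R\times[0,\infty)$, has this regularity for every $T>0$ and satisfies $u_t=\mathcal A[u]$ for $t>0$. Assume throughout: * $\mathcal A$ generates a semigroup on $X$: there are maps $S_t:X\to X$ $(t\ge0)$ with $S_0=\mathrm{id}$, $S_{s+t}=S_sS_t$, such that $u(\cdot,t)=S_tu_0$ solves (1) for every $u_0\in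 X$; * $\mathcal A[u(\cdot+h)](x)=\mathcal A[u](x+h)$ for $u\in D$ and $x,h\in\mathbb R$; * $\mathcal A[\alpha 1]=f(\alpha)1$ for all $\alpha\in\mathbb R$, where $f\in C^1(\mathbb R)$, $f(0)=f(1)=0$, $f'(0)<0$, $f'(1)<0$; * comparison principle: for every $T>0$, if $u$ is a supersolution and $v$ a subsolution on $\mathbb R\times[0,T)$, $u(\cdot,0)\ge v(\cdot,0)$ everywhere and $u(\cdot,0)\not\equiv v(\cdot,0)$ (that is, not a.e. equal), then $u(\cdot,t)>v(\cdot,t)$ on $\mathbb R$ for $0<t<T$; * the limits $\mathcal A'[u](v)(x)=\lim_{\epsilon\to0}\epsilon^{-1}\big(\mathcal A[u+\epsilon v](x)-\mathcal A[u](x)\big)$ exist for $u,v\in D$, $x\in\mathbb R$. A *traveling wave* $(U,c)$ is a solution of the form $U(x-ct)$ with $U(-\infty)=0$, $U(+\infty)=1$. It is called *monotone* if $U\in C^1(\mathbb R)$, $U'>0$ on $\mathbb R$ and $U'(\xi)\to0$ as $|\xi|\to\infty$. Consider, for constants $K_1,\tilde K_2,K_2,K_3>0$ and a probability measure $\nu$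 on $\mathbb R$, the following estimates for all $x\in\mathbb R$ and all $u,v\in D$ with $-1\le u,v\le2$ (in (E2) also $v\in C^2_b(\mathbb R)$): $$|\mathcal A'[u+v](1)(x)-\mathcal A'[u](1)(x)|\le K_1\int_{\mathbb R}|v(x-y)|\,\nu(dy)+K_2\|v\|_{C^0([x-1,x+1])},\tag{E1}$$ $$|\mathcal A[u+v](x)-\mathcal A[u](x)|\le K_1\int_{\mathbb R}|v(x-y)|\,\nu(dy)+\tilde K_2\|v'\|_{C_b(\mathbb R)}+K_2\|v''\|_{C_b(\mathbb R)},\tag{E2}$$ $$|\mathcal A[u+v](x)-\mathcal A[u](x)-\mathcal A'[u](v)(x)|\le K_3\|v\|_{C^0(\mathbb R)}^2.\tag{E3}$$ **Theorem.** *Uniqueness.* Suppose (E1) holds for some $K_1,K_2>0$ and some probability measure $\nu$. If $(U,c)$ is a monotone traveling wave and $(\tilde U,\tilde c)$ is a traveling wave with $\tilde U\in C^0(\mathbb R)$, $0\le\tilde U\le1$, then $\tilde c=c$ and $\tilde U=U(\cdot+\xi_0)$ for some $\xi_0\in\mathbb R$. *Stability.* Suppose that (E1) and (E2) hold for some $K_1,\tilde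 K_2,K_2>0$ and some probability measure $\nu$; that $f>0$ on $(-1,0)\cup(a^+,1)$ and $f<0$ on $(0,a^-)\cup(1,2)$ for some $0<a^-\le a^+<1$; and that there is a positive non-increasing function $\eta$ on $[1,\infty)$ such that $$u(x,1)-v(x,1)\ge\eta(m)\int_0^1[u(y,0)-v(y,0)]\,dy\qquad(m\ge1,\ |x|\le m)$$ for all supersolutions $u$ and subsolutions $v$ on $\mathbb R\times[0,T)$, $T>1$, with $-1\le u,v\le2$ and $u(\cdot,0)\ge v(\cdot,0)$. If $(U,c)$ is a monotone traveling wave, then there is $\kappa>0$ such that for every $u_0\in X$ with $0\le u_0\le1$, $\liminf_{x\to\infty}u_0(x)>a^+$ and $\limsup_{x\to-\infty}u_0(x)<a^-$, the solution $u$ of (1) with $u(\cdot,0)=u_0$ satisfies $$|u(x,t)-U(x-ct+\xi)|\le Ke^{-\kappa t}\qquad(x\in\mathbb R,\ t\ge0)$$ with constants $\xi,K$ depending on $u_0$. *Existence.* Suppose that for some $a\in(0,1)$, $f>0$ on $(-1,0)\cup(a,1)$, $f<0$ on $(0,a)\cup(1,2)$ and $f'(a)>0$; that there is a positive continuous function $\eta$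 on $[0,\infty)\times(0,\infty)$ such that $$u(x,t)-v(x,t)\ge\eta(|x|,t)\int_0^1[u(y,0)-v(y,0)]\,dy\qquad(x\in\mathbb R,\ 0<t<T)$$ for all supersolutions $u$ and subsolutions $v$ on $\mathbb R\times[0,T)$, $T>0$, with $-1\le u,v\le2$ and $u(\cdot,0)\ge v(\cdot,0)$; that (E1), (E2), (E3) hold for some $K_1,\tilde K_2,K_2,K_3>0$ and some probability measure $\nu$; and that every solution of (1) whose initial value $u_0$ satisfies $0\le u_0\le1$ and $\|u_0\|_{C^3(\mathbb R)}<\infty$ has $\sup_{t\ge0}\|u(\cdot,t)\|_{C^2(\mathbb R)}<\infty$. Then there exists a monotone traveling wave. -/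

import Mathlib

open Set Filter Topology MeasureTheory

noncomputable section

namespace ChenWaves

/-- The two phase spaces: bounded Borel functions (everywhere defined representatives of the
elements of `L^∞(ℝ)`), and bounded continuous functions. -/
inductive Phase
  | Linfty
  | Cb

/-- The underlying set of functions of a phase space. -/
def Phase.space : Phase → Set (ℝ → ℝ)
  | .Linfty => {g | Measurable g ∧ ∃ M : ℝ, ∀ x, |g x| ≤ M}
  | .Cb => {g | Continuous g ∧ ∃ M : ℝ, ∀ x, |g x| ≤ M}

/-- `u(·,t)` (written `u t`) attains the initial value `u(·,0)` as `t ↓ 0`: in the weak-* topology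
of `L^∞(ℝ)`, respectively locally uniformly on `ℝ`. -/
def Phase.InitialTrace : Phase → (ℝ → ℝ → ℝ) → Prop
  | .Linfty, u => ∀ φ : ℝ → ℝ, Integrable φ →
      Tendsto (fun t => ∫ x, u t x * φ x) (𝓝[>] 0) (𝓝 (∫ x, u 0 x * φ x))
  | .Cb, u => TendstoLocallyUniformly u (u 0) (𝓝[>] 0)

/-- `g` is `C^n` and its derivatives of order `0, …, n` are bounded by `M`. -/
def BoundedCk (n : ℕ) (M : ℝ) (g : ℝ → ℝ) : Prop :=
  ContDiff ℝ n g ∧ ∀ k ≤ n, ∀ x, |iteratedDeriv k g x| ≤ M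

/-- `g ∈ C^n_b(ℝ)`. -/
def IsCkb (n : ℕ) (g : ℝ → ℝ) : Prop := ∃ M : ℝ, BoundedCk n M g

/-- The supremum norm on a set, for functions bounded on that set. -/
def supNormOn (s : Set ℝ) (g : ℝ → ℝ) : ℝ := sSup ((fun x => |g x|) '' s)

/-- The supremum norm on `ℝ`, for bounded functions. -/
def supNorm (g : ℝ → ℝ) : ℝ := supNormOn univ g

/-- A (nonlinear, in general unbounded) operator in the phase space `X`. Its domain is a
translation invariant linear space containing the smooth functions with bounded derivatives;
the values of `toFun` outside the domain are irrelevant. -/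
structure NonlinOp (X : Phase) where
  dom : Submodule ℝ (ℝ → ℝ)
  toFun : (ℝ → ℝ) → ℝ → ℝ
  dom_subset : ∀ g ∈ dom, g ∈ X.space
  smooth_mem : ∀ g : ℝ → ℝ, (∀ n : ℕ, IsCkb n g) → g ∈ dom
  translate_mem : ∀ g ∈ dom, ∀ h : ℝ, (fun x => g (x + h)) ∈ dom

variable {X : Phase}

namespace NonlinOp

/-- Regularity required of (sub-, super-) solutions on `ℝ × [0,T)`: boundedness, values in the
domain at positive times, continuity in time, attainment of the initial value. -/
def Regular (A : NonlinOp X) (T : ℝ) (u : ℝ → ℝ → ℝ) : Prop :=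
  (∃ M : ℝ, ∀ t ∈ Ico 0 T, ∀ x, |u t x| ≤ M) ∧
  u 0 ∈ X.space ∧
  (∀ t ∈ Ioo 0 T, u t ∈ A.dom) ∧
  (∀ t ∈ Ioo 0 T, TendstoLocallyUniformly u (u t) (𝓝 t)) ∧
  X.InitialTrace u

/-- `u_t ≥ A[u]` on `ℝ × (0,T)`. -/
def IsSupersolution (A : NonlinOp X) (T : ℝ) (u : ℝ → ℝ → ℝ) : Prop :=
  A.Regular T u ∧ ∀ t ∈ Ioo 0 T, ∀ x,
    ∃ d : ℝ, HasDerivAt (fun s => u s x) d t ∧ A.toFun (u t) x ≤ d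

/-- `u_t ≤ A[u]` on `ℝ × (0,T)`. -/
def IsSubsolution (A : NonlinOp X) (T : ℝ) (u : ℝ → ℝ → ℝ) : Prop :=
  A.Regular T u ∧ ∀ t ∈ Ioo 0 T, ∀ x,
    ∃ d : ℝ, HasDerivAt (fun s => u s x) d t ∧ d ≤ A.toFun (u t) x

/-- `u_t = A[u]` on `ℝ × (0,∞)`. -/
def IsSolution (A : NonlinOp X) (u : ℝ → ℝ → ℝ) : Prop :=
  (∀ T > 0, A.Regular T u) ∧
  ∀ t > 0, ∀ x, HasDerivAt (fun s => u s x) (A.toFun (u t) x) t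

/-- `A` generates a semigroup on the phase space. -/
def GeneratesSemigroup (A : NonlinOp X) : Prop :=
  ∃ S : ℝ → (ℝ → ℝ) → ℝ → ℝ,
    (∀ t ≥ 0, ∀ g ∈ X.space, S t g ∈ X.space) ∧
    (∀ g ∈ X.space, S 0 g = g) ∧
    (∀ s ≥ 0, ∀ t ≥ 0, ∀ g ∈ X.space, S (s + t) g = S s (S t g)) ∧
    ∀ g ∈ X.space, A.IsSolution (fun t => S t g)

def TranslationInvariant (A : NonlinOp X) : Prop :=
  ∀ g ∈ A.dom, ∀ h x : ℝ, A.toFun (fun y => g (y + h)) x = A.toFun g (x + h)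

/-- `A[α 1] = f(α) 1`. -/
def OnConstants (A : NonlinOp X) (f : ℝ → ℝ) : Prop :=
  ∀ α x : ℝ, A.toFun (fun _ => α) x = f α

/-- Comparison principle, on every time interval `[0,T)`. -/
def ComparisonPrinciple (A : NonlinOp X) : Prop :=
  ∀ T > 0, ∀ u v : ℝ → ℝ → ℝ, A.IsSupersolution T u → A.IsSubsolution T v →
    (∀ x, v 0 x ≤ u 0 x) → ¬ (u 0 =ᵐ[volume] v 0) →
    ∀ t ∈ Ioo 0 T, ∀ x, v t x < u t x

/-- `A'[u](v)(x) = lim_{ε → 0} (A[u + ε v](x) - A[u](x)) / ε`. -/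
def deriv (A : NonlinOp X) (u v : ℝ → ℝ) (x : ℝ) : ℝ :=
  _root_.deriv (fun ε : ℝ => A.toFun (u + ε • v) x) 0

/-- The limits defining `A'[u](v)` exist. -/
def HasDerivatives (A : NonlinOp X) : Prop :=
  ∀ u ∈ A.dom, ∀ v ∈ A.dom, ∀ x : ℝ,
    DifferentiableAt ℝ (fun ε : ℝ => A.toFun (u + ε • v) x) 0

/-- A traveling wave with profile `U` and speed `c`, connecting the states `0` and `1`. -/
def IsTravelingWave (A : NonlinOp X) (U : ℝ → ℝ) (c : ℝ) : Prop :=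
  A.IsSolution (fun t x => U (x - c * t)) ∧
  Tendsto U atBot (𝓝 0) ∧ Tendsto U atTop (𝓝 1)

/-- A `C^1` traveling wave with `U' > 0` on `ℝ` and `U'(ξ) → 0` as `|ξ| → ∞`. -/
def IsMonotoneWave (A : NonlinOp X) (U : ℝ → ℝ) (c : ℝ) : Prop :=
  A.IsTravelingWave U c ∧ ContDiff ℝ 1 U ∧
  Tendsto (_root_.deriv U) (cocompact ℝ) (𝓝 0) ∧ ∀ ξ, 0 < _root_.deriv U ξ

/-- Pairs of elements of the domain with values in `[-1,2]`. -/
def Admissible (A : NonlinOp X) (u v : ℝ → ℝ) : Prop :=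
  u ∈ A.dom ∧ v ∈ A.dom ∧ (∀ x, u x ∈ Icc (-1 : ℝ) 2) ∧ ∀ x, v x ∈ Icc (-1 : ℝ) 2

/-- Estimate of `A'[u+v](1) - A'[u](1)`. -/
def DerivBound (A : NonlinOp X) (K₁ K₂ : ℝ) (ν : Measure ℝ) : Prop :=
  ∀ u v : ℝ → ℝ, A.Admissible u v → ∀ x : ℝ,
    |A.deriv (u + v) (fun _ => 1) x - A.deriv u (fun _ => 1) x| ≤
      K₁ * ∫ y, |v (x - y)| ∂ν + K₂ * supNormOn (Icc (x - 1) (x + 1)) v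

/-- The global estimate of `A[u+v] - A[u]`, in terms of the norms of `v'` and `v''` on `ℝ`. -/
def GlobalBound (A : NonlinOp X) (K₁ Kt₂ K₂ : ℝ) (ν : Measure ℝ) : Prop :=
  ∀ u v : ℝ → ℝ, A.Admissible u v → IsCkb 2 v → ∀ x : ℝ,
    |A.toFun (u + v) x - A.toFun u x| ≤
      K₁ * ∫ y, |v (x - y)| ∂ν +
        (Kt₂ * supNorm (_root_.deriv v) + K₂ * supNorm (_root_.deriv (_root_.deriv v)))

/-- Quadratic error of the linearization. -/
def QuadraticBound (A : NonlinOp X) (K₃ : ℝ) : Prop :=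
  ∀ u v : ℝ → ℝ, A.Admissible u v → ∀ x : ℝ,
    |A.toFun (u + v) x - A.toFun u x - A.deriv u v x| ≤ K₃ * supNorm v ^ 2

/-- `u` is a super- and `v` a subsolution on `[0,T)`, both with values in `[-1,2]`, and
`u(·,0) ≥ v(·,0)`. -/
def OrderedPair (A : NonlinOp X) (T : ℝ) (u v : ℝ → ℝ → ℝ) : Prop :=
  A.IsSupersolution T u ∧ A.IsSubsolution T v ∧
  (∀ t ∈ Ico 0 T, ∀ x, u t x ∈ Icc (-1 : ℝ) 2 ∧ v t x ∈ Icc (-1 : ℝ) 2) ∧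
  ∀ x, v 0 x ≤ u 0 x

/-- Quantitative comparison at time `1`. -/
def ComparisonAtOne (A : NonlinOp X) : Prop :=
  ∃ η : ℝ → ℝ, (∀ m ≥ 1, 0 < η m) ∧ AntitoneOn η (Ici 1) ∧
    ∀ T > 1, ∀ u v : ℝ → ℝ → ℝ, A.OrderedPair T u v →
      ∀ m ≥ 1, ∀ x ∈ Icc (-m) m,
        η m * ∫ y in (0 : ℝ)..1, (u 0 y - v 0 y) ≤ u 1 x - v 1 x

/-- Quantitative comparison at all positive times. -/
def ComparisonAtAllTimes (A : NonlinOp X) : Prop :=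
  ∃ η : ℝ → ℝ → ℝ, (∀ r ≥ 0, ∀ t > 0, 0 < η r t) ∧
    ContinuousOn (fun p : ℝ × ℝ => η p.1 p.2) (Ici 0 ×ˢ Ioi 0) ∧
    ∀ T > 0, ∀ u v : ℝ → ℝ → ℝ, A.OrderedPair T u v →
      ∀ t ∈ Ioo 0 T, ∀ x,
        η |x| t * ∫ y in (0 : ℝ)..1, (u 0 y - v 0 y) ≤ u t x - v t x

/-- Solutions with `C^3_b` initial values in `[0,1]` are bounded in `C^2`, uniformly in time. -/
def UniformC2 (A : NonlinOp X) : Prop :=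
  ∀ u : ℝ → ℝ → ℝ, A.IsSolution u → (∀ x, u 0 x ∈ Icc (0 : ℝ) 1) → IsCkb 3 (u 0) →
    ∃ M : ℝ, ∀ t ≥ 0, BoundedCk 2 M (u t)

end NonlinOp

/-- Bistable nonlinearities. -/
def Bistable (f : ℝ → ℝ) : Prop :=
  ContDiff ℝ 1 f ∧ f 0 = 0 ∧ f 1 = 0 ∧ deriv f 0 < 0 ∧ deriv f 1 < 0

/-- `f > 0` in `(-1,0) ∪ (a⁺,1)` and `f < 0` in `(0,a⁻) ∪ (1,2)`. -/
def SignPattern (f : ℝ → ℝ) (aminus aplus : ℝ) : Prop :=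
  (∀ s ∈ Ioo (-1 : ℝ) 0 ∪ Ioo aplus 1, 0 < f s) ∧
  ∀ s ∈ Ioo (0 : ℝ) aminus ∪ Ioo 1 2, f s < 0

end ChenWaves

end

/-!
Throughout, the estimate `DerivBound` serves to control the effect of adding small constants: it
makes `A` Lipschitz continuous along constants (`ShiftLipschitz`), which turns the strict
comparison principle into a comparison with errors (`ComparisonPrinciple.le_add`), and it shows
that `A'[V](1)` is negative where `V` is close to a stable state.

**Uniqueness and stability.** Both are proved for fronts (`IsFront`): solutions `V` that connect
`0` to `1` around a moving position, uniformly in time, and are steep there. Monotone waves are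
fronts. If `V` is a front, then `V` with a decaying vertical error `δ e^{-β t}` and an
accompanying drift is a super- or subsolution (`IsFront.exists_perturbed`): far from the interface
the states `0` and `1` are stable, near it the drift compensates because `V` is steep. Uniqueness
follows by sliding one wave along the other (`IsMonotoneWave.unique`). For stability, a solution
lying between two shifts of the front is squeezed: over a unit interval at the interface it is far
from one of the two shifts, and the quantitative comparison converts this into a gain that is
proportional to the distance of the shifts (`IsFront.exists_squeeze`). Iteration gives exponential
convergence (`IsFront.exists_rate`). Initial values that are merely above `a⁺` and below `a⁻` near
infinity are brought between two shifts by means of `GlobalBound`: it makes the comparison local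
(`exists_localComparison`), so that on half-lines solutions follow the equation `p' = f(p)`
(`exists_raise`, `exists_sink`).

**Existence.** The solution starting from a smooth step is shown to be a front. The danger is that
its transition layer widens around the unstable state `a`. By `QuadraticBound` the difference of
two solutions close to `a` grows exponentially until it leaves a neighbourhood of `0`; applied to
two auxiliary solutions, this shows that a wide layer does not widen further (`exists_separation`,
`exists_layer_step`). So the layer is bounded for all times (`exists_localized`), and the
quantitative comparison of the solution with its own translates makes it steep (`mul_le_deriv`).
Since fronts are used in place of waves, the stability argument now applies to the solution
itself: it converges exponentially to its own shifts in time, up to a translation. Therefore it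
has a limit in a moving frame, and this limit is a traveling wave (`IsFront.exists_monotoneWave`).
-/
noncomputable section

namespace ChenWaves

section

variable {X : Phase}

/-! ### Phase spaces and initial values -/

theorem Phase.measurable_of_mem {g : ℝ → ℝ} (hg : g ∈ X.space) : Measurable g := by
  cases X
  · exact hg.1
  · exact hg.1.measurable

theorem Phase.bounded_of_mem {g : ℝ → ℝ} (hg : g ∈ X.space) : ∃ M, ∀ x, |g x| ≤ M := by
  cases X
  · exact hg.2
  · exact hg.2

theorem Phase.mem_of_continuous {g : ℝ → ℝ} (hg : Continuous g) (hb : ∃ M, ∀ x, |g x| ≤ M) :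
    g ∈ X.space := by
  cases X
  · exact ⟨hg.measurable, hb⟩
  · exact ⟨hg, hb⟩

theorem Phase.add_mem {g h : ℝ → ℝ} (hg : g ∈ X.space) (hh : h ∈ X.space) :
    (fun x => g x + h x) ∈ X.space := by
  obtain ⟨M, hM⟩ := Phase.bounded_of_mem hg
  obtain ⟨N, hN⟩ := Phase.bounded_of_mem hh
  have hb : ∃ K, ∀ x, |g x + h x| ≤ K :=
    ⟨M + N, fun x => (abs_add_le _ _).trans (add_le_add (hM x) (hN x))⟩
  cases X
  · exact ⟨hg.1.add hh.1, hb⟩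
  · exact ⟨hg.1.add hh.1, hb⟩

theorem Phase.smul_mem {g : ℝ → ℝ} (c : ℝ) (hg : g ∈ X.space) :
    (fun x => c * g x) ∈ X.space := by
  obtain ⟨M, hM⟩ := Phase.bounded_of_mem hg
  have hb : ∃ K, ∀ x, |c * g x| ≤ K :=
    ⟨|c| * M, fun x => by rw [abs_mul]; exact mul_le_mul_of_nonneg_left (hM x) (abs_nonneg _)⟩
  cases X
  · exact ⟨hg.1.const_mul c, hb⟩
  · exact ⟨continuous_const.mul hg.1, hb⟩

theorem Phase.translate_mem {g : ℝ → ℝ} (h : ℝ) (hg : g ∈ X.space) :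
    (fun x => g (x + h)) ∈ X.space := by
  obtain ⟨M, hM⟩ := Phase.bounded_of_mem hg
  cases X
  · exact ⟨hg.1.comp (measurable_id.add_const h), M, fun x => hM _⟩
  · exact ⟨hg.1.comp (continuous_id.add continuous_const), M, fun x => hM _⟩

theorem tendstoLocallyUniformly_of_continuousAt {u : ℝ → ℝ → ℝ} {t : ℝ}
    (h : ∀ x, ContinuousAt (fun p : ℝ × ℝ => u p.1 p.2) (t, x)) :
    TendstoLocallyUniformly u (u t) (𝓝 t) := by
  rw [Metric.tendstoLocallyUniformly_iff]
  intro ε hε x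
  have h1 := Metric.tendsto_nhds.1 (h x) (ε / 2) (half_pos hε)
  rw [nhds_prod_eq] at h1
  obtain ⟨pa, hpa, pb, hpb, hab⟩ := Filter.eventually_prod_iff.1 h1
  refine ⟨{y | pb y}, hpb, ?_⟩
  filter_upwards [hpa] with s hs y hy
  have e1 := hab hs hy
  have e2 := hab hpa.self_of_nhds hy
  rw [dist_comm] at e2
  have := dist_triangle (u t y) (u t x) (u s y)
  rw [dist_comm (u t x)] at this
  simp only at e1 e2
  rw [dist_comm] at e2
  linarith

theorem tendsto_of_tendstoLocallyUniformly {u : ℝ → ℝ → ℝ} {g : ℝ → ℝ} {l : Filter ℝ}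
    (h : TendstoLocallyUniformly u g l) (x : ℝ) : Tendsto (fun t => u t x) l (𝓝 (g x)) := by
  rw [Metric.tendstoLocallyUniformly_iff] at h
  rw [Metric.tendsto_nhds]
  intro ε hε
  obtain ⟨s, hs, hev⟩ := h ε hε x
  filter_upwards [hev] with t ht
  rw [dist_comm]
  exact ht x (mem_of_mem_nhds hs)

/-- Locally uniform convergence of uniformly bounded functions implies the convergence required
in either phase space; for `L^∞` this is dominated convergence. -/
theorem Phase.initialTrace_of_tendsto {u : ℝ → ℝ → ℝ} {M : ℝ}
    (hu : ∀ᶠ t in 𝓝[>] (0 : ℝ), Measurable (u t) ∧ ∀ x, |u t x| ≤ M)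
    (h : TendstoLocallyUniformly u (u 0) (𝓝[>] 0)) : X.InitialTrace u := by
  cases X
  · intro φ hφ
    refine tendsto_integral_filter_of_dominated_convergence (fun x => M * |φ x|) ?_ ?_ ?_ ?_
    · filter_upwards [hu] with t ht
      exact ht.1.aestronglyMeasurable.mul hφ.aestronglyMeasurable
    · filter_upwards [hu] with t ht
      refine Eventually.of_forall fun x => ?_
      rw [Real.norm_eq_abs, abs_mul]
      exact mul_le_mul_of_nonneg_right (ht.2 x) (abs_nonneg _)
    · exact hφ.abs.const_mul M
    · refine Eventually.of_forall fun x => ?_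
      exact (tendsto_of_tendstoLocallyUniformly h x).mul_const _
  · exact h

theorem integrable_mul_of_bounded {g φ : ℝ → ℝ} {M : ℝ} (hg : Measurable g)
    (hM : ∀ x, |g x| ≤ M) (hφ : Integrable φ) : Integrable (fun x => g x * φ x) :=
  hφ.bdd_mul hg.aestronglyMeasurable (c := M)
    (Eventually.of_forall fun x => by rw [Real.norm_eq_abs]; exact hM x)

namespace NonlinOp

theorem const_mem_dom (A : NonlinOp X) (c : ℝ) : (fun _ => c) ∈ A.dom := by
  refine A.smooth_mem _ fun n => ⟨|c|, contDiff_const, fun k _ x => ?_⟩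
  rw [iteratedDeriv_const]
  split_ifs <;> simp

theorem add_const_mem_dom (A : NonlinOp X) {g : ℝ → ℝ} (hg : g ∈ A.dom) (c : ℝ) :
    (fun x => g x + c) ∈ A.dom :=
  A.dom.add_mem hg (A.const_mem_dom c)

variable {A : NonlinOp X} {T : ℝ} {u v : ℝ → ℝ → ℝ}

/-! ### Operations on regular functions -/

theorem Regular.mem_space (hu : A.Regular T u) {t : ℝ} (ht : t ∈ Ico 0 T) : u t ∈ X.space := by
  rcases eq_or_lt_of_le ht.1 with h | h
  · rw [← h]; exact hu.2.1
  · exact A.dom_subset _ (hu.2.2.1 t ⟨h, ht.2⟩)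

theorem Regular.mono (hu : A.Regular T u) {T' : ℝ} (hT : T' ≤ T) : A.Regular T' u := by
  obtain ⟨⟨M, hM⟩, h0, hd, hc, hi⟩ := hu
  exact ⟨⟨M, fun t ht => hM t ⟨ht.1, ht.2.trans_le hT⟩⟩, h0,
    fun t ht => hd t ⟨ht.1, ht.2.trans_le hT⟩, fun t ht => hc t ⟨ht.1, ht.2.trans_le hT⟩, hi⟩

theorem eventually_mem_Ioo (hT : 0 < T) : ∀ᶠ t in 𝓝[>] (0 : ℝ), t ∈ Ioo 0 T :=
  Ioo_mem_nhdsGT hT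

theorem Regular.add (hT : 0 < T) (hu : A.Regular T u) (hv : A.Regular T v) :
    A.Regular T (fun t x => u t x + v t x) := by
  have hu' := hu
  have hv' := hv
  obtain ⟨⟨M, hM⟩, h0, hd, hc, hi⟩ := hu
  obtain ⟨⟨N, hN⟩, k0, kd, kc, ki⟩ := hv
  refine ⟨⟨M + N, fun t ht x => (abs_add_le _ _).trans (add_le_add (hM t ht x) (hN t ht x))⟩,
    Phase.add_mem h0 k0, fun t ht => A.dom.add_mem (hd t ht) (kd t ht),
    fun t ht => (hc t ht).add (kc t ht), ?_⟩
  cases X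
  · intro φ hφ
    have h1 : ∀ t ∈ Ico 0 T, ∫ x, (u t x + v t x) * φ x
        = (∫ x, u t x * φ x) + ∫ x, v t x * φ x := by
      intro t ht
      rw [← integral_add]
      · simp only [add_mul]
      · exact integrable_mul_of_bounded (Phase.measurable_of_mem (hu'.mem_space ht)) (hM t ht) hφ
      · exact integrable_mul_of_bounded (Phase.measurable_of_mem (hv'.mem_space ht)) (hN t ht) hφ
    simp only
    rw [h1 0 ⟨le_rfl, hT⟩]
    refine ((hi φ hφ).add (ki φ hφ)).congr' ?_
    filter_upwards [eventually_mem_Ioo hT] with t ht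
    exact (h1 t ⟨ht.1.le, ht.2⟩).symm
  · exact TendstoLocallyUniformly.add hi ki

theorem tendstoLocallyUniformly_const_mul {g : ℝ → ℝ} {l : Filter ℝ} (c : ℝ)
    (h : TendstoLocallyUniformly u g l) :
    TendstoLocallyUniformly (fun t x => c * u t x) (fun x => c * g x) l := by
  rw [Metric.tendstoLocallyUniformly_iff] at h ⊢
  intro ε hε x
  have hc : 0 < |c| + 1 := by positivity
  obtain ⟨s, hs, hev⟩ := h (ε / (|c| + 1)) (by positivity) x
  refine ⟨s, hs, ?_⟩
  filter_upwards [hev] with t ht y hy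
  have h1 := ht y hy
  rw [Real.dist_eq] at h1 ⊢
  rw [← mul_sub, abs_mul]
  rw [lt_div_iff₀ hc] at h1
  nlinarith [abs_nonneg (g y - u t y)]

theorem Regular.const_mul (hu : A.Regular T u) (c : ℝ) :
    A.Regular T (fun t x => c * u t x) := by
  obtain ⟨⟨M, hM⟩, h0, hd, hc, hi⟩ := hu
  refine ⟨⟨|c| * M, fun t ht x => ?_⟩, Phase.smul_mem c h0, fun t ht => ?_,
    fun t ht => tendstoLocallyUniformly_const_mul c (hc t ht), ?_⟩
  · rw [abs_mul]; exact mul_le_mul_of_nonneg_left (hM t ht x) (abs_nonneg _)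
  · exact A.dom.smul_mem c (hd t ht)
  · cases X
    · intro φ hφ
      have h1 : ∀ t, ∫ x, (c * u t x) * φ x = c * ∫ x, u t x * φ x := by
        intro t
        rw [← integral_const_mul]
        simp only [mul_assoc]
      simp only [h1]
      exact (hi φ hφ).const_mul c
    · exact tendstoLocallyUniformly_const_mul c hi

theorem tendstoLocallyUniformly_translate {g : ℝ → ℝ} {l : Filter ℝ} (h : ℝ)
    (hu : TendstoLocallyUniformly u g l) :
    TendstoLocallyUniformly (fun t x => u t (x + h)) (fun x => g (x + h)) l :=
  hu.comp (fun x => x + h) (by fun_prop)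

theorem Regular.translate (hu : A.Regular T u) (h : ℝ) :
    A.Regular T (fun t x => u t (x + h)) := by
  obtain ⟨⟨M, hM⟩, h0, hd, hc, hi⟩ := hu
  refine ⟨⟨M, fun t ht x => hM t ht _⟩, Phase.translate_mem h h0,
    fun t ht => A.translate_mem _ (hd t ht) h,
    fun t ht => tendstoLocallyUniformly_translate h (hc t ht), ?_⟩
  cases X
  · intro φ hφ
    have h1 : ∀ t, ∫ x, u t (x + h) * φ x = ∫ x, u t x * φ (x - h) := by
      intro t
      rw [← integral_add_right_eq_self (fun x => u t x * φ (x - h)) h]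
      simp
    simp only [h1]
    exact hi _ (hφ.comp_sub_right h)
  · exact tendstoLocallyUniformly_translate h hi

theorem tendstoLocallyUniformly_shift {s t : ℝ}
    (hu : TendstoLocallyUniformly u (u (s + t)) (𝓝 (s + t))) :
    TendstoLocallyUniformly (fun r => u (s + r)) (u (s + t)) (𝓝 t) := by
  rw [Metric.tendstoLocallyUniformly_iff] at hu ⊢
  intro ε hε x
  obtain ⟨w, hw, hev⟩ := hu ε hε x
  refine ⟨w, hw, ?_⟩
  have : Tendsto (fun r => s + r) (𝓝 t) (𝓝 (s + t)) := (continuous_const_add s).tendsto t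
  exact this.eventually hev

theorem tendstoLocallyUniformly_mono {g : ℝ → ℝ} {l l' : Filter ℝ} (hl : l' ≤ l)
    (hu : TendstoLocallyUniformly u g l) : TendstoLocallyUniformly u g l' := by
  rw [Metric.tendstoLocallyUniformly_iff] at hu ⊢
  intro ε hε x
  obtain ⟨w, hw, hev⟩ := hu ε hε x
  exact ⟨w, hw, hev.filter_mono hl⟩

/-- A function with the pointwise properties of a regular function that is continuous in time
for locally uniform convergence up to and including the initial time is regular. -/
theorem regular_of_tendsto (hT : 0 < T) {M : ℝ} (hM : ∀ t ∈ Ico 0 T, ∀ x, |u t x| ≤ M)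
    (h0 : u 0 ∈ X.space) (hd : ∀ t ∈ Ioo 0 T, u t ∈ A.dom)
    (hc : ∀ t ∈ Ico 0 T, TendstoLocallyUniformly u (u t) (𝓝 t)) : A.Regular T u := by
  refine ⟨⟨M, hM⟩, h0, hd, fun t ht => hc t ⟨ht.1.le, ht.2⟩, ?_⟩
  refine Phase.initialTrace_of_tendsto (M := M) ?_
    (tendstoLocallyUniformly_mono nhdsWithin_le_nhds (hc 0 ⟨le_rfl, hT⟩))
  filter_upwards [eventually_mem_Ioo hT] with t ht
  exact ⟨Phase.measurable_of_mem (A.dom_subset _ (hd t ht)), hM t ⟨ht.1.le, ht.2⟩⟩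

theorem Regular.shift {s T' : ℝ} (hu : A.Regular T u) (hs : 0 < s) (hT' : 0 < T')
    (hT : s + T' ≤ T) : A.Regular T' (fun t => u (s + t)) := by
  obtain ⟨⟨M, hM⟩, h0, hd, hc, hi⟩ := hu
  refine regular_of_tendsto hT' (M := M) (fun t ht => hM _ ⟨by linarith [ht.1], by linarith [ht.2]⟩)
    ?_ (fun t ht => hd _ ⟨by linarith [ht.1], by linarith [ht.2]⟩)
    (fun t ht => tendstoLocallyUniformly_shift (hc _ ⟨by linarith [ht.1], by linarith [ht.2]⟩))
  exact A.dom_subset _ (hd _ ⟨by linarith, by linarith⟩)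

/-- Products of a continuous function of time and a continuous element of the domain. -/
theorem regular_mul {p φ : ℝ → ℝ} (hT : 0 < T) (hp : Continuous p) (hφ : φ ∈ A.dom)
    (hφc : Continuous φ) : A.Regular T (fun t x => p t * φ x) := by
  obtain ⟨N, hN⟩ := Phase.bounded_of_mem (A.dom_subset _ hφ)
  obtain ⟨M, hM⟩ := (isCompact_Icc (a := (0 : ℝ)) (b := T)).exists_bound_of_continuousOn
    hp.continuousOn
  refine regular_of_tendsto hT (M := M * N) (fun t ht x => ?_)
    (Phase.smul_mem _ (A.dom_subset _ hφ)) (fun t ht => A.dom.smul_mem _ hφ)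
    (fun t ht => tendstoLocallyUniformly_of_continuousAt fun x => ?_)
  · rw [abs_mul]
    have := hM t ⟨ht.1, ht.2.le⟩
    rw [Real.norm_eq_abs] at this
    exact mul_le_mul this (hN x) (abs_nonneg _) ((abs_nonneg _).trans this)
  · exact (by fun_prop : Continuous fun q : ℝ × ℝ => p q.1 * φ q.2).continuousAt

theorem regular_time {p : ℝ → ℝ} (hT : 0 < T) (hp : Continuous p) :
    A.Regular T (fun t _ => p t) := by
  have := regular_mul (A := A) hT hp (A.const_mem_dom 1) continuous_const
  simpa using this

/-! ### Operations on sub- and supersolutions -/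

theorem IsSupersolution.mono (hu : A.IsSupersolution T u) {T' : ℝ} (hT : T' ≤ T) :
    A.IsSupersolution T' u :=
  ⟨hu.1.mono hT, fun t ht => hu.2 t ⟨ht.1, ht.2.trans_le hT⟩⟩

theorem IsSubsolution.mono (hu : A.IsSubsolution T u) {T' : ℝ} (hT : T' ≤ T) :
    A.IsSubsolution T' u :=
  ⟨hu.1.mono hT, fun t ht => hu.2 t ⟨ht.1, ht.2.trans_le hT⟩⟩

theorem IsSupersolution.shift (hu : A.IsSupersolution T u) {s T' : ℝ} (hs : 0 < s) (hT' : 0 < T')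
    (hT : s + T' ≤ T) : A.IsSupersolution T' (fun t => u (s + t)) := by
  refine ⟨hu.1.shift hs hT' hT, fun t ht x => ?_⟩
  obtain ⟨d, hd, hle⟩ := hu.2 (s + t) ⟨by linarith [ht.1], by linarith [ht.2]⟩ x
  exact ⟨d, HasDerivAt.comp_const_add s t hd, hle⟩

theorem IsSubsolution.shift (hu : A.IsSubsolution T u) {s T' : ℝ} (hs : 0 < s) (hT' : 0 < T')
    (hT : s + T' ≤ T) : A.IsSubsolution T' (fun t => u (s + t)) := by
  refine ⟨hu.1.shift hs hT' hT, fun t ht x => ?_⟩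
  obtain ⟨d, hd, hle⟩ := hu.2 (s + t) ⟨by linarith [ht.1], by linarith [ht.2]⟩ x
  exact ⟨d, HasDerivAt.comp_const_add s t hd, hle⟩

theorem IsSupersolution.translate (hA : A.TranslationInvariant) (hu : A.IsSupersolution T u)
    (h : ℝ) : A.IsSupersolution T (fun t x => u t (x + h)) := by
  refine ⟨hu.1.translate h, fun t ht x => ?_⟩
  obtain ⟨d, hd, hle⟩ := hu.2 t ht (x + h)
  exact ⟨d, hd, by rw [hA _ (hu.1.2.2.1 t ht)]; exact hle⟩

theorem IsSubsolution.translate (hA : A.TranslationInvariant) (hu : A.IsSubsolution T u)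
    (h : ℝ) : A.IsSubsolution T (fun t x => u t (x + h)) := by
  refine ⟨hu.1.translate h, fun t ht x => ?_⟩
  obtain ⟨d, hd, hle⟩ := hu.2 t ht (x + h)
  exact ⟨d, hd, by rw [hA _ (hu.1.2.2.1 t ht)]; exact hle⟩

theorem IsSolution.isSupersolution (hu : A.IsSolution u) (hT : 0 < T) : A.IsSupersolution T u :=
  ⟨hu.1 T hT, fun t ht x => ⟨_, hu.2 t ht.1 x, le_rfl⟩⟩

theorem IsSolution.isSubsolution (hu : A.IsSolution u) (hT : 0 < T) : A.IsSubsolution T u :=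
  ⟨hu.1 T hT, fun t ht x => ⟨_, hu.2 t ht.1 x, le_rfl⟩⟩

theorem IsSolution.mem_dom (hu : A.IsSolution u) {t : ℝ} (ht : 0 < t) : u t ∈ A.dom :=
  (hu.1 (t + 1) (by linarith)).2.2.1 t ⟨ht, by linarith⟩

theorem IsSolution.mem_space (hu : A.IsSolution u) {t : ℝ} (ht : 0 ≤ t) : u t ∈ X.space :=
  (hu.1 (t + 1) (by linarith)).mem_space ⟨ht, by linarith⟩

theorem IsSolution.translate (hA : A.TranslationInvariant) (hu : A.IsSolution u) (h : ℝ) :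
    A.IsSolution (fun t x => u t (x + h)) :=
  ⟨fun T hT => (hu.1 T hT).translate h, fun t ht x => by
    rw [hA _ (hu.mem_dom ht)]; exact hu.2 t ht (x + h)⟩

theorem IsSolution.shift (hu : A.IsSolution u) {s : ℝ} (hs : 0 ≤ s) :
    A.IsSolution (fun t => u (s + t)) := by
  rcases eq_or_lt_of_le hs with h | h
  · simpa [← h] using hu
  · exact ⟨fun T hT => (hu.1 (s + T) (by linarith)).shift h hT le_rfl, fun t ht x =>
      HasDerivAt.comp_const_add s t (hu.2 (s + t) (by linarith) x)⟩

/-- Being a solution only depends on the values at nonnegative times. -/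
theorem IsSolution.congr (hu : A.IsSolution u) (h : ∀ t ≥ 0, v t = u t) : A.IsSolution v := by
  have hev : ∀ t > 0, ∀ᶠ s in 𝓝 t, v s = u s := fun t ht => by
    filter_upwards [lt_mem_nhds ht] with s hs
    exact h s (le_of_lt hs)
  have hev0 : ∀ᶠ s in 𝓝[>] (0 : ℝ), v s = u s := by
    filter_upwards [self_mem_nhdsWithin] with s hs
    exact h s (le_of_lt hs)
  have hlu : ∀ (l : Filter ℝ) (g : ℝ → ℝ), (∀ᶠ s in l, v s = u s) →
      TendstoLocallyUniformly u g l → TendstoLocallyUniformly v g l := by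
    intro l g he hg
    rw [Metric.tendstoLocallyUniformly_iff] at hg ⊢
    intro ε hε x
    obtain ⟨w, hw, hev⟩ := hg ε hε x
    refine ⟨w, hw, ?_⟩
    filter_upwards [hev, he] with s h1 h2
    rw [h2]; exact h1
  refine ⟨fun T hT => ?_, fun t ht x => ?_⟩
  · obtain ⟨⟨M, hM⟩, h0, hd, hc, hi⟩ := hu.1 T hT
    refine ⟨⟨M, fun t ht => by rw [h t ht.1]; exact hM t ht⟩, by rw [h 0 le_rfl]; exact h0,
      fun t ht => by rw [h t ht.1.le]; exact hd t ht, fun t ht => ?_, ?_⟩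
    · rw [h t ht.1.le]
      exact hlu _ _ (hev t ht.1) (hc t ht)
    · cases X
      · intro φ hφ
        rw [h 0 le_rfl]
        refine (hi φ hφ).congr' ?_
        filter_upwards [hev0] with s hs
        rw [hs]
      · have := hlu _ _ hev0 hi
        rw [← h 0 le_rfl] at this
        exact this
  · rw [h t (le_of_lt ht)]
    refine (hu.2 t ht x).congr_of_eventuallyEq ?_
    filter_upwards [hev t ht] with s hs
    rw [hs]

end NonlinOp

end

section

variable {X : Phase}

/-! ### Shifts by constants and comparison without strictness -/

theorem supNormOn_le {s : Set ℝ} {g : ℝ → ℝ} {c : ℝ} (hs : s.Nonempty)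
    (h : ∀ x ∈ s, |g x| ≤ c) : supNormOn s g ≤ c := by
  refine csSup_le (hs.image _) ?_
  rintro _ ⟨x, hx, rfl⟩
  exact h x hx

theorem supNorm_le {g : ℝ → ℝ} {c : ℝ} (h : ∀ x, |g x| ≤ c) : supNorm g ≤ c :=
  supNormOn_le univ_nonempty fun x _ => h x

theorem supNorm_nonneg (g : ℝ → ℝ) : 0 ≤ supNorm g := by
  refine Real.sSup_nonneg ?_
  rintro _ ⟨x, _, rfl⟩
  exact abs_nonneg _

namespace NonlinOp

variable {A : NonlinOp X} {T : ℝ} {u v : ℝ → ℝ → ℝ} {f : ℝ → ℝ}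

theorem deriv_const_one (hconst : A.OnConstants f) (α x : ℝ) :
    A.deriv (fun _ => α) (fun _ => 1) x = _root_.deriv f α := by
  unfold NonlinOp.deriv
  have : (fun ε : ℝ => A.toFun ((fun _ => α) + ε • (fun _ => 1)) x) = fun ε => f (α + ε) := by
    funext ε
    rw [← hconst (α + ε) x]
    congr 1
    funext y
    simp
  rw [this, deriv_comp_const_add]
  simp

theorem hasDerivAt_add_const (hderiv : A.HasDerivatives) {w : ℝ → ℝ} (hw : w ∈ A.dom)
    (s x : ℝ) : HasDerivAt (fun s => A.toFun (fun y => w y + s) x)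
      (A.deriv (fun y => w y + s) (fun _ => 1) x) s := by
  have h := (hderiv _ (A.add_const_mem_dom hw s) _ (A.const_mem_dom 1) x).hasDerivAt
  have h2 : HasDerivAt (fun r => A.toFun (fun y => w y + (s + r)) x)
      (A.deriv (fun y => w y + s) (fun _ => 1) x) 0 := by
    have : (fun r => A.toFun (fun y => w y + (s + r)) x)
        = fun ε : ℝ => A.toFun ((fun y => w y + s) + ε • (fun _ => 1)) x := by
      funext ε
      congr 1
      funext y
      simp [add_assoc]
    rw [this]
    exact h
  rw [← sub_self s] at h2
  have h3 := HasDerivAt.comp_sub_const s s h2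
  simpa using h3

/-- `A` is Lipschitz continuous along shifts by constants, within the range `[-1,2]`. -/
def ShiftLipschitz (A : NonlinOp X) (Λ : ℝ) : Prop :=
  ∀ w ∈ A.dom, ∀ s : ℝ, (∀ y, w y ∈ Icc (-1 : ℝ) 2) → (∀ y, w y + s ∈ Icc (-1 : ℝ) 2) →
    ∀ x, |A.toFun (fun y => w y + s) x - A.toFun w x| ≤ Λ * |s|

/-- The linearization along constants is bounded, since at the state `0` it is `f'(0)` and all
admissible functions are at a bounded distance from `0`. -/
theorem DerivBound.abs_deriv_one_le {K₁ K₂ : ℝ} {ν : Measure ℝ} (hE : A.DerivBound K₁ K₂ ν)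
    (hconst : A.OnConstants f) (hK₁ : 0 < K₁) (hK₂ : 0 < K₂) [IsProbabilityMeasure ν]
    {w : ℝ → ℝ} (hw : w ∈ A.dom) (hr : ∀ y, w y ∈ Icc (-1 : ℝ) 2) (x : ℝ) :
    |A.deriv w (fun _ => 1) x| ≤ |_root_.deriv f 0| + 2 * K₁ + 2 * K₂ := by
  have habs : ∀ y, |w y| ≤ 2 := fun y => abs_le.2 ⟨by linarith [(hr y).1], (hr y).2⟩
  have h := hE (fun _ => 0) w ⟨A.const_mem_dom 0, hw, fun _ => by norm_num, hr⟩ x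
  have e : (fun _ => (0 : ℝ)) + w = w := by funext y; simp
  rw [e, deriv_const_one hconst] at h
  have h1 : ∫ y, |w (x - y)| ∂ν ≤ 2 := by
    have h0 : ∫ y, |w (x - y)| ∂ν ≤ ∫ _, (2 : ℝ) ∂ν := by
      apply integral_mono_of_nonneg (Eventually.of_forall fun y => abs_nonneg _)
        (integrable_const _) (Eventually.of_forall fun y => habs _)
    simpa using h0
  have h2 : supNormOn (Icc (x - 1) (x + 1)) w ≤ 2 :=
    supNormOn_le ⟨x, by constructor <;> linarith⟩ fun y _ => habs y
  have h3 : |A.deriv w (fun _ => 1) x| ≤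
      |A.deriv w (fun _ => 1) x - _root_.deriv f 0| + |_root_.deriv f 0| := by
    have := abs_add_le (A.deriv w (fun _ => 1) x - _root_.deriv f 0) (_root_.deriv f 0)
    simpa using this
  nlinarith

theorem DerivBound.shiftLipschitz {K₁ K₂ : ℝ} {ν : Measure ℝ} (hE : A.DerivBound K₁ K₂ ν)
    (hconst : A.OnConstants f) (hderiv : A.HasDerivatives) (hK₁ : 0 < K₁) (hK₂ : 0 < K₂)
    [IsProbabilityMeasure ν] :
    A.ShiftLipschitz (|_root_.deriv f 0| + 2 * K₁ + 2 * K₂) := by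
  intro w hw s h0 h1 x
  have key : ∀ r ∈ uIcc 0 s, ∀ y, w y + r ∈ Icc (-1 : ℝ) 2 := by
    intro r hr y
    have := h0 y; have := h1 y
    rcases le_total 0 s with hs | hs
    · rw [uIcc_of_le hs] at hr
      exact ⟨by linarith [(h0 y).1, hr.1], by linarith [(h1 y).2, hr.2]⟩
    · rw [uIcc_of_ge hs] at hr
      exact ⟨by linarith [(h1 y).1, hr.1], by linarith [(h0 y).2, hr.2]⟩
  have := Convex.norm_image_sub_le_of_norm_hasDerivWithin_le
    (f := fun s => A.toFun (fun y => w y + s) x)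
    (f' := fun s => A.deriv (fun y => w y + s) (fun _ => 1) x) (s := uIcc 0 s)
    (C := |_root_.deriv f 0| + 2 * K₁ + 2 * K₂) (x := 0) (y := s)
    (fun r _ => (hasDerivAt_add_const hderiv hw r x).hasDerivWithinAt)
    (fun r hr => by
      rw [Real.norm_eq_abs]
      exact hE.abs_deriv_one_le hconst hK₁ hK₂ (A.add_const_mem_dom hw r) (key r hr) x)
    (convex_uIcc 0 s) left_mem_uIcc right_mem_uIcc
  simpa [Real.norm_eq_abs] using this

/-- A supersolution up to an error `κ` becomes a supersolution after adding
`(ε + κ t) e^{Λ t}`, the growth of which makes up for the effect of the shift on `A`. -/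
theorem ShiftLipschitz.isSupersolution_add {Λ κ ε : ℝ} (hΛ : A.ShiftLipschitz Λ) (hΛ0 : 0 ≤ Λ)
    (hκ : 0 ≤ κ) (hε : 0 ≤ ε) (hT : 0 < T) (hu : A.Regular T u)
    (hd : ∀ t ∈ Ioo 0 T, ∀ x, ∃ d, HasDerivAt (fun s => u s x) d t ∧ A.toFun (u t) x - κ ≤ d)
    (hlow : ∀ t ∈ Ioo 0 T, ∀ x, -1 ≤ u t x)
    (hup : ∀ t ∈ Ioo 0 T, ∀ x, u t x + (ε + κ * t) * Real.exp (Λ * t) ≤ 2) :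
    A.IsSupersolution T (fun t x => u t x + (ε + κ * t) * Real.exp (Λ * t)) := by
  refine ⟨hu.add hT (regular_time hT (by fun_prop)), fun t ht x => ?_⟩
  obtain ⟨d, hd, hle⟩ := hd t ht x
  have hs : HasDerivAt (fun t => (ε + κ * t) * Real.exp (Λ * t))
      (κ * Real.exp (Λ * t) + (ε + κ * t) * (Real.exp (Λ * t) * Λ)) t := by
    have h1 : HasDerivAt (fun t => ε + κ * t) κ t := by
      simpa using ((hasDerivAt_id t).const_mul κ).const_add ε
    have h2 : HasDerivAt (fun t => Real.exp (Λ * t)) (Real.exp (Λ * t) * Λ) t := by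
      have := ((hasDerivAt_id t).const_mul Λ).exp
      simpa using this
    exact h1.mul h2
  refine ⟨_, hd.add hs, ?_⟩
  have hpos : 0 ≤ (ε + κ * t) * Real.exp (Λ * t) := by
    have := ht.1.le; positivity
  have hL := hΛ (u t) (hu.2.2.1 t ht) ((ε + κ * t) * Real.exp (Λ * t))
    (fun y => ⟨hlow t ht y, by linarith [hup t ht y]⟩)
    (fun y => ⟨by linarith [hlow t ht y], hup t ht y⟩) x
  rw [abs_of_nonneg hpos] at hL
  have hL := (abs_le.1 hL).2
  have hexp : 1 ≤ Real.exp (Λ * t) := Real.one_le_exp (mul_nonneg hΛ0 ht.1.le)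
  have : κ ≤ κ * Real.exp (Λ * t) := le_mul_of_one_le_right hκ hexp
  linarith

theorem ShiftLipschitz.isSubsolution_sub {Λ ε : ℝ} (hΛ : A.ShiftLipschitz Λ)
    (hε : 0 ≤ ε) (hT : 0 < T) (hu : A.IsSubsolution T u)
    (hup : ∀ t ∈ Ioo 0 T, ∀ x, u t x ≤ 2)
    (hlow : ∀ t ∈ Ioo 0 T, ∀ x, -1 ≤ u t x - ε * Real.exp (Λ * t)) :
    A.IsSubsolution T (fun t x => u t x - ε * Real.exp (Λ * t)) := by
  refine ⟨?_, fun t ht x => ?_⟩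
  · have := hu.1.add hT (regular_time (A := A) (p := fun t => -(ε * Real.exp (Λ * t))) hT
      (by fun_prop))
    simpa only [← sub_eq_add_neg] using this
  obtain ⟨d, hd, hle⟩ := hu.2 t ht x
  have hs : HasDerivAt (fun t => ε * Real.exp (Λ * t)) (ε * (Real.exp (Λ * t) * Λ)) t := by
    have := (((hasDerivAt_id t).const_mul Λ).exp).const_mul ε
    simpa using this
  refine ⟨_, hd.sub hs, ?_⟩
  have hpos : 0 ≤ ε * Real.exp (Λ * t) := by positivity
  have hL := hΛ (u t) (hu.1.2.2.1 t ht) (-(ε * Real.exp (Λ * t)))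
    (fun y => ⟨by linarith [hlow t ht y], hup t ht y⟩)
    (fun y => ⟨by linarith [hlow t ht y], by linarith [hup t ht y]⟩) x
  rw [abs_neg, abs_of_nonneg hpos] at hL
  have hL := (abs_le.1 hL).1
  have e : (fun y => u t y + -(ε * Real.exp (Λ * t))) = fun y => u t y - ε * Real.exp (Λ * t) := by
    funext y; ring
  rw [e] at hL
  linarith

theorem ComparisonPrinciple.lt_of_lt (hcomp : A.ComparisonPrinciple) (hT : 0 < T)
    (hu : A.IsSupersolution T u) (hv : A.IsSubsolution T v) (h0 : ∀ x, v 0 x < u 0 x) :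
    ∀ t ∈ Ico 0 T, ∀ x, v t x < u t x := by
  intro t ht x
  rcases eq_or_lt_of_le ht.1 with h | h
  · rw [← h]; exact h0 x
  · refine hcomp T hT u v hu hv (fun x => (h0 x).le) (fun hae => ?_) t ⟨h, ht.2⟩ x
    obtain ⟨y, hy⟩ := hae.exists
    exact (h0 y).ne' hy

/-- Comparison of a subsolution with a supersolution up to an error `κ` whose initial value is
larger up to an error `ε`. The strict comparison principle is applied after increasing `ε` a little.
Since estimates of `A` are available only within `[-1,2]`, the increased supersolution has to stay
below `2`, which is the reason for the bound `r`. -/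
theorem ComparisonPrinciple.le_add (hcomp : A.ComparisonPrinciple) {Λ κ ε : ℝ}
    (hΛ : A.ShiftLipschitz Λ) (hΛ0 : 0 ≤ Λ) (hκ : 0 ≤ κ) (hε : 0 ≤ ε) (hT : 0 < T)
    (hu : A.Regular T u)
    (hd : ∀ t ∈ Ioo 0 T, ∀ x, ∃ d, HasDerivAt (fun s => u s x) d t ∧ A.toFun (u t) x - κ ≤ d)
    (hlow : ∀ t ∈ Ioo 0 T, ∀ x, -1 ≤ u t x)
    {r : ℝ} (hr : (ε + κ * T) * Real.exp (Λ * T) < 2 - r) (hup : ∀ t ∈ Ioo 0 T, ∀ x, u t x ≤ r)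
    (hv : A.IsSubsolution T v) (h0 : ∀ x, v 0 x ≤ u 0 x + ε) :
    ∀ t ∈ Ico 0 T, ∀ x, v t x ≤ u t x + (ε + κ * t) * Real.exp (Λ * t) := by
  intro t ht x
  by_contra hcon
  push Not at hcon
  set g := v t x - (u t x + (ε + κ * t) * Real.exp (Λ * t)) with hg
  set m := min g (2 - r - (ε + κ * T) * Real.exp (Λ * T)) with hm
  have hm0 : 0 < m := lt_min (by rw [hg]; linarith) (by linarith)
  set e := m * Real.exp (-(Λ * T)) with he
  have he0 : 0 < e := by positivity
  have hexp : ∀ s ≤ T, e * Real.exp (Λ * s) ≤ m := by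
    intro s hs
    rw [he, mul_assoc, ← Real.exp_add]
    refine mul_le_of_le_one_right hm0.le (Real.exp_le_one_iff.2 ?_)
    nlinarith
  have hsup := hΛ.isSupersolution_add hΛ0 hκ (add_nonneg hε he0.le) hT hu hd hlow (by
    intro s hs y
    have h1 := hexp s hs.2.le
    have h2 : (ε + κ * s) * Real.exp (Λ * s) ≤ (ε + κ * T) * Real.exp (Λ * T) := by
      have := hs.1
      have := hs.2
      gcongr
    have h3 := min_le_right g (2 - r - (ε + κ * T) * Real.exp (Λ * T))
    have h4 := hup s hs y
    have : (ε + e + κ * s) * Real.exp (Λ * s)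
        = (ε + κ * s) * Real.exp (Λ * s) + e * Real.exp (Λ * s) := by ring
    rw [this]
    rw [← hm] at h3
    linarith)
  have hlt := hcomp.lt_of_lt hT hsup hv (fun y => by
    simp only [mul_zero, Real.exp_zero, add_zero, mul_one]
    linarith [h0 y]) t ht x
  have h1 := hexp t ht.2.le
  have h2 := min_le_left g (2 - r - (ε + κ * T) * Real.exp (Λ * T))
  rw [← hm] at h2
  have : (ε + e + κ * t) * Real.exp (Λ * t)
      = (ε + κ * t) * Real.exp (Λ * t) + e * Real.exp (Λ * t) := by ring
  rw [this] at hlt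
  linarith

/-- Comparison without strictness, when the range of the supersolution is known. -/
theorem ComparisonPrinciple.le_of_le (hcomp : A.ComparisonPrinciple) {Λ : ℝ}
    (hΛ : A.ShiftLipschitz Λ) (hΛ0 : 0 ≤ Λ) (hT : 0 < T) (hu : A.IsSupersolution T u)
    {r : ℝ} (hr : r < 2) (hrange : ∀ t ∈ Ioo 0 T, ∀ x, u t x ∈ Icc (-1 : ℝ) r)
    (hv : A.IsSubsolution T v) (h0 : ∀ x, v 0 x ≤ u 0 x) :
    ∀ t ∈ Ico 0 T, ∀ x, v t x ≤ u t x := by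
  have := hcomp.le_add (κ := 0) (ε := 0) (r := r) hΛ hΛ0 le_rfl le_rfl hT hu.1
    (by simpa using hu.2) (fun t ht x => (hrange t ht x).1) (by simp; exact hr)
    (fun t ht x => (hrange t ht x).2) hv (by simpa using h0)
  simpa using this

/-- Comparison without strictness, when the range of the subsolution is known: here the
subsolution is lowered a little. -/
theorem ComparisonPrinciple.le_of_le' (hcomp : A.ComparisonPrinciple) {Λ : ℝ}
    (hΛ : A.ShiftLipschitz Λ) (hΛ0 : 0 ≤ Λ) (hT : 0 < T) (hu : A.IsSupersolution T u)
    (hv : A.IsSubsolution T v)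
    {r : ℝ} (hr : -1 < r) (hrange : ∀ t ∈ Ioo 0 T, ∀ x, v t x ∈ Icc r (2 : ℝ))
    (h0 : ∀ x, v 0 x ≤ u 0 x) :
    ∀ t ∈ Ico 0 T, ∀ x, v t x ≤ u t x := by
  intro t ht x
  by_contra hcon
  push Not at hcon
  set m := min (v t x - u t x) (r + 1) with hm
  have hm0 : 0 < m := lt_min (by linarith) (by linarith)
  set e := m * Real.exp (-(Λ * T)) with he
  have he0 : 0 < e := by positivity
  have hexp : ∀ s ≤ T, e * Real.exp (Λ * s) ≤ m := by
    intro s hs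
    rw [he, mul_assoc, ← Real.exp_add]
    refine mul_le_of_le_one_right hm0.le (Real.exp_le_one_iff.2 ?_)
    nlinarith
  have hsub := hΛ.isSubsolution_sub he0.le hT hv (fun s hs y => (hrange s hs y).2) (by
    intro s hs y
    have h1 := hexp s hs.2.le
    have h3 := min_le_right (v t x - u t x) (r + 1)
    linarith [(hrange s hs y).1])
  have hlt := hcomp.lt_of_lt hT hu hsub (fun y => by
    simp only [mul_zero, Real.exp_zero, mul_one]
    linarith [h0 y]) t ht x
  have h1 := hexp t ht.2.le
  have h2 := min_le_left (v t x - u t x) (r + 1)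
  linarith

/-! ### Solutions that are constant in space, and solutions with values in `[0,1]` -/

theorem isSubsolution_time (hconst : A.OnConstants f) (hT : 0 < T) {p p' : ℝ → ℝ}
    (hp : Continuous p) (hd : ∀ t ∈ Ioo 0 T, HasDerivAt p (p' t) t)
    (hle : ∀ t ∈ Ioo 0 T, p' t ≤ f (p t)) : A.IsSubsolution T (fun t _ => p t) :=
  ⟨regular_time hT hp, fun t ht x => ⟨p' t, hd t ht, by rw [hconst]; exact hle t ht⟩⟩

theorem isSupersolution_time (hconst : A.OnConstants f) (hT : 0 < T) {p p' : ℝ → ℝ}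
    (hp : Continuous p) (hd : ∀ t ∈ Ioo 0 T, HasDerivAt p (p' t) t)
    (hle : ∀ t ∈ Ioo 0 T, f (p t) ≤ p' t) : A.IsSupersolution T (fun t _ => p t) :=
  ⟨regular_time hT hp, fun t ht x => ⟨p' t, hd t ht, by rw [hconst]; exact hle t ht⟩⟩

theorem isSolution_const (hconst : A.OnConstants f) {α : ℝ} (hα : f α = 0) :
    A.IsSolution (fun _ _ => α) :=
  ⟨fun T hT => regular_time hT continuous_const, fun t _ x => by
    rw [hconst, hα]; exact hasDerivAt_const t α⟩

theorem IsSolution.mem_Icc (hcomp : A.ComparisonPrinciple) {Λ : ℝ} (hΛ : A.ShiftLipschitz Λ)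
    (hΛ0 : 0 ≤ Λ) (hconst : A.OnConstants f) (hf0 : f 0 = 0) (hf1 : f 1 = 0)
    (hu : A.IsSolution u) (h0 : ∀ x, u 0 x ∈ Icc (0 : ℝ) 1) :
    ∀ t ≥ 0, ∀ x, u t x ∈ Icc (0 : ℝ) 1 := by
  intro t ht x
  have hT : 0 < t + 1 := by linarith
  constructor
  · exact hcomp.le_of_le' hΛ hΛ0 hT (hu.isSupersolution hT)
      ((isSolution_const hconst hf0).isSubsolution hT) (r := 0) (by norm_num)
      (fun _ _ _ => by norm_num) (fun x => (h0 x).1) t ⟨ht, by linarith⟩ x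
  · exact hcomp.le_of_le hΛ hΛ0 hT ((isSolution_const hconst hf1).isSupersolution hT)
      (r := 1) (by norm_num) (fun _ _ _ => by norm_num) (hu.isSubsolution hT)
      (fun x => (h0 x).2) t ⟨ht, by linarith⟩ x

/-- Solutions with values in `[0,1]` depend on the initial value in a Lipschitz continuous way,
in the supremum norm. -/
theorem IsSolution.le_add_of_le_add (hcomp : A.ComparisonPrinciple) {Λ : ℝ}
    (hΛ : A.ShiftLipschitz Λ) (hΛ0 : 0 ≤ Λ) (hu : A.IsSolution u) (hv : A.IsSolution v)
    (hur : ∀ t ≥ 0, ∀ x, u t x ∈ Icc (0 : ℝ) 1) {ε t : ℝ} (hε : 0 ≤ ε) (ht : 0 ≤ t)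
    (hεt : ε * Real.exp (Λ * (t + 1)) < 1) (h0 : ∀ x, v 0 x ≤ u 0 x + ε) (x : ℝ) :
    v t x ≤ u t x + ε * Real.exp (Λ * t) := by
  have hT : 0 < t + 1 := by linarith
  have := hcomp.le_add (κ := 0) (ε := ε) (r := 1) hΛ hΛ0 le_rfl hε hT (hu.1 _ hT)
    (by simpa using (hu.isSupersolution hT).2)
    (fun s hs x => by linarith [(hur s hs.1.le x).1])
    (by simp; linarith) (fun s hs x => (hur s hs.1.le x).2) (hv.isSubsolution hT) h0
    t ⟨ht, by linarith⟩ x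
  simpa using this

end NonlinOp

end

section

variable {X : Phase}

/-! ### Moving fronts -/

/-- Total derivative along a curve, when only the space derivative is jointly continuous. -/
theorem hasDerivAt_along {F : ℝ → ℝ → ℝ} {s : ℝ → ℝ} {t₁ d s' : ℝ}
    (hF : HasDerivAt (fun t => F t (s t₁)) d t₁) (hs : HasDerivAt s s' t₁)
    (hdiff : ∀ᶠ t in 𝓝 t₁, Differentiable ℝ (F t))
    (hcont : ContinuousAt (fun p : ℝ × ℝ => _root_.deriv (F p.1) p.2) (t₁, s t₁)) :
    HasDerivAt (fun t => F t (s t)) (d + _root_.deriv (F t₁) (s t₁) * s') t₁ := by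
  have hmean : ∀ t, ∃ ξ, |ξ - s t₁| ≤ |s t - s t₁| ∧ (Differentiable ℝ (F t) →
      F t (s t) - F t (s t₁) = _root_.deriv (F t) ξ * (s t - s t₁)) := by
    intro t
    by_cases hd : Differentiable ℝ (F t)
    · rcases lt_trichotomy (s t) (s t₁) with h | h | h
      · obtain ⟨c, hc, hc'⟩ := exists_deriv_eq_slope (F t) h hd.continuous.continuousOn
          hd.differentiableOn
        refine ⟨c, ?_, fun _ => ?_⟩
        · rw [abs_of_neg (by linarith [hc.2]), abs_of_neg (by linarith)]; linarith [hc.1]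
        · have : s t₁ - s t ≠ 0 := by linarith
          rw [hc']; field_simp; ring
      · exact ⟨s t₁, by simp, fun _ => by rw [h]; ring⟩
      · obtain ⟨c, hc, hc'⟩ := exists_deriv_eq_slope (F t) h hd.continuous.continuousOn
          hd.differentiableOn
        refine ⟨c, ?_, fun _ => ?_⟩
        · rw [abs_of_pos (by linarith [hc.1]), abs_of_pos (by linarith)]; linarith [hc.2]
        · have : s t - s t₁ ≠ 0 := by linarith
          rw [hc']; field_simp
    · exact ⟨s t₁, by simp, fun h => absurd h hd⟩
  choose ξ hξ1 hξ2 using hmean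
  have hξ : Tendsto (fun t => (t, ξ t)) (𝓝 t₁) (𝓝 (t₁, s t₁)) := by
    rw [nhds_prod_eq]
    refine Tendsto.prodMk tendsto_id ?_
    have h0 : Tendsto (fun t => |s t - s t₁|) (𝓝 t₁) (𝓝 0) := by
      have := (hs.continuousAt.sub_const (s t₁)).abs
      have h2 : Tendsto (fun t => |s t - s t₁|) (𝓝 t₁) (𝓝 (|s t₁ - s t₁|)) := this
      simpa using h2
    have h1 : Tendsto (fun t => ξ t - s t₁) (𝓝 t₁) (𝓝 0) :=
      squeeze_zero_norm (fun t => by rw [Real.norm_eq_abs]; exact hξ1 t) h0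
    simpa using h1.add_const (s t₁)
  have hG : Tendsto (fun t => _root_.deriv (F t) (ξ t)) (𝓝 t₁)
      (𝓝 (_root_.deriv (F t₁) (s t₁))) := hcont.tendsto.comp hξ
  have h2 : HasDerivAt (fun t => F t (s t) - F t (s t₁))
      (_root_.deriv (F t₁) (s t₁) * s') t₁ := by
    rw [hasDerivAt_iff_tendsto_slope] at hs ⊢
    refine ((hG.mono_left nhdsWithin_le_nhds).mul hs).congr' ?_
    filter_upwards [hdiff.filter_mono nhdsWithin_le_nhds] with t ht
    rw [slope_def_field, slope_def_field, hξ2 t ht]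
    simp [mul_div_assoc]
  have := hF.add h2
  refine this.congr_of_eventuallyEq (Eventually.of_forall fun t => ?_)
  simp

/-- For a probability measure `ν`, the convolution of `|g|` with `ν` at `x` is small if `g` is
small on a large interval around `x`. -/
theorem exists_radius_integral_le (ν : Measure ℝ) [IsProbabilityMeasure ν] {ρ : ℝ} (hρ : 0 < ρ) :
    ∃ R > 0, ∀ (g : ℝ → ℝ) (x : ℝ), (∀ y, |g y| ≤ 1) → (∀ y, |y - x| ≤ R → |g y| ≤ ρ) →
      ∫ y, |g (x - y)| ∂ν ≤ 2 * ρ := by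
  obtain ⟨K, hK, hKν⟩ := isTightMeasureSet_iff_exists_isCompact_measure_compl_le.1
    (isTightMeasureSet_singleton (μ := ν)) (ENNReal.ofReal ρ) (by simpa using hρ)
  have hKν := hKν ν rfl
  obtain ⟨R, hR⟩ := hK.isBounded.exists_norm_le
  refine ⟨max R 1, by positivity, fun g x h1 hg => ?_⟩
  have hm : MeasurableSet Kᶜ := hK.measurableSet.compl
  have hint : Integrable (fun y => ρ + Kᶜ.indicator (fun _ => (1 : ℝ)) y) ν :=
    (integrable_const ρ).add ((integrable_const (1 : ℝ)).indicator hm)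
  calc ∫ y, |g (x - y)| ∂ν ≤ ∫ y, (ρ + Kᶜ.indicator (fun _ => (1 : ℝ)) y) ∂ν := by
        refine integral_mono_of_nonneg (Eventually.of_forall fun y => abs_nonneg _) hint
          (Eventually.of_forall fun y => ?_)
        by_cases hy : y ∈ K
        · have : |g (x - y)| ≤ ρ := hg _ (by
            have := hR y hy
            rw [Real.norm_eq_abs] at this
            have e : x - y - x = -y := by ring
            rw [e, abs_neg]
            exact this.trans (le_max_left _ _))
          simpa [hy] using this
        · have := h1 (x - y)
          simp only [mem_compl_iff, hy, not_false_eq_true, indicator_of_mem]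
          linarith
    _ = ρ + ν.real Kᶜ := by
        rw [integral_add (integrable_const ρ) ((integrable_const (1 : ℝ)).indicator hm),
          integral_indicator_const _ hm]
        simp
    _ ≤ 2 * ρ := by
        have : ν.real Kᶜ ≤ ρ := ENNReal.toReal_le_of_le_ofReal hρ.le hKν
        linarith

namespace NonlinOp

/-- The standing assumptions on the operator. -/
structure Standing (A : NonlinOp X) (f : ℝ → ℝ) : Prop where
  trans : A.TranslationInvariant
  const : A.OnConstants f
  bistable : Bistable f
  comp : A.ComparisonPrinciple
  hasDeriv : A.HasDerivatives

/-- The estimate of `A'[u+v](1) - A'[u](1)` holds for some constants and some measure. -/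
def DerivBounded (A : NonlinOp X) : Prop :=
  ∃ (K₁ K₂ : ℝ) (ν : Measure ℝ), 0 < K₁ ∧ 0 < K₂ ∧ IsProbabilityMeasure ν ∧ A.DerivBound K₁ K₂ ν

/-- A solution `V` which at times `t ≥ 1` is a transition from `0` to `1` around the position
`z t`, of a width and a steepness that are bounded uniformly in time. Traveling waves with
`z t = c t` are the main example. -/
structure IsFront (A : NonlinOp X) (V : ℝ → ℝ → ℝ) (z : ℝ → ℝ) : Prop where
  sol : A.IsSolution V
  mem : ∀ t > 0, ∀ x, V t x ∈ Icc (0 : ℝ) 1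
  diff : ∀ t > 0, Differentiable ℝ (V t)
  cont : ∀ t > 0, ∀ x, ContinuousAt (fun p : ℝ × ℝ => V p.1 p.2) (t, x)
  contDeriv : ∀ t > 0, ∀ x, ContinuousAt (fun p : ℝ × ℝ => _root_.deriv (V p.1) p.2) (t, x)
  tails : ∀ ρ > 0, ∃ R, ∀ t ≥ 1, ∀ x, (z t + R ≤ x → 1 - ρ ≤ V t x) ∧ (x ≤ z t - R → V t x ≤ ρ)
  steep : ∀ R, ∃ m > 0, ∀ t ≥ 1, ∀ x, |x - z t| ≤ R → m ≤ _root_.deriv (V t) x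
  bdd : ∃ M, ∀ t ≥ 1, ∀ x, _root_.deriv (V t) x ≤ M
  flat : ∀ ρ > 0, ∃ R, ∀ t ≥ 1, ∀ x, R ≤ |x - z t| → _root_.deriv (V t) x ≤ ρ
  drift : ∃ C, ∀ t ≥ 1, |z (t + 1) - z t| ≤ C

variable {A : NonlinOp X} {T : ℝ} {u V : ℝ → ℝ → ℝ} {f z : ℝ → ℝ}

theorem Standing.exists_shiftLipschitz (hS : A.Standing f) (hE : A.DerivBounded) :
    ∃ Λ ≥ 0, A.ShiftLipschitz Λ := by
  obtain ⟨K₁, K₂, ν, h1, h2, hν, hE⟩ := hE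
  exact ⟨_, by positivity, hE.shiftLipschitz hS.const hS.hasDeriv h1 h2⟩

theorem IsFront.deriv_pos (hV : A.IsFront V z) {t : ℝ} (ht : 1 ≤ t) (x : ℝ) :
    0 < _root_.deriv (V t) x := by
  obtain ⟨m, hm, h⟩ := hV.steep |x - z t|
  exact hm.trans_le (h t ht x le_rfl)

theorem IsFront.strictMono (hV : A.IsFront V z) {t : ℝ} (ht : 1 ≤ t) : StrictMono (V t) :=
  strictMono_of_deriv_pos fun x => hV.deriv_pos ht x

/-- Away from the interface the linearization along constants is uniformly negative, because the
states `0` and `1` are stable. -/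
theorem IsFront.exists_deriv_one_le (hS : A.Standing f) (hE : A.DerivBounded)
    (hV : A.IsFront V z) : ∃ β > 0, ∃ δ₀ > 0, δ₀ ≤ 1 / 4 ∧ ∃ R, ∀ t ≥ 1, ∀ s x,
      |s| ≤ δ₀ → R ≤ |x - z t| → A.deriv (fun y => V t y + s) (fun _ => 1) x ≤ -β := by
  obtain ⟨K₁, K₂, ν, hK₁, hK₂, hν, hE⟩ := hE
  obtain ⟨hf, -, -, hf0, hf1⟩ := hS.bistable
  set β := min (-_root_.deriv f 0) (-_root_.deriv f 1) / 3 with hβ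
  have hβ0 : 0 < β := by
    have : 0 < min (-_root_.deriv f 0) (-_root_.deriv f 1) := lt_min (by linarith) (by linarith)
    positivity
  have hβa : _root_.deriv f 0 ≤ -(3 * β) := by
    have := min_le_left (-_root_.deriv f 0) (-_root_.deriv f 1); rw [hβ]; linarith
  have hβb : _root_.deriv f 1 ≤ -(3 * β) := by
    have := min_le_right (-_root_.deriv f 0) (-_root_.deriv f 1); rw [hβ]; linarith
  have hcf : Continuous (_root_.deriv f) := hf.continuous_deriv le_rfl
  have hnear : ∀ α : ℝ, _root_.deriv f α ≤ -(3 * β) →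
      ∃ δ > 0, ∀ s, |s| ≤ δ → _root_.deriv f (α + s) ≤ -(2 * β) := by
    intro α hα
    obtain ⟨δ, hδ, h⟩ := Metric.continuousAt_iff.1 (hcf.continuousAt (x := α)) β hβ0
    refine ⟨δ / 2, by positivity, fun s hs => ?_⟩
    have := h (x := α + s) (by rw [Real.dist_eq]; simp; linarith)
    rw [Real.dist_eq] at this
    linarith [(abs_lt.1 this).2]
  obtain ⟨δa, hδa, ha⟩ := hnear 0 hβa
  obtain ⟨δb, hδb, hb⟩ := hnear 1 hβb
  set ρ := β / (2 * K₁ + K₂) with hρ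
  have hρ0 : 0 < ρ := by positivity
  obtain ⟨R₁, hR₁, hint⟩ := exists_radius_integral_le ν hρ0
  obtain ⟨R₂, htail⟩ := hV.tails ρ hρ0
  have hsmall : ∀ (g : ℝ → ℝ) (x : ℝ), (∀ y, |g y| ≤ 1) →
      (∀ y, |y - x| ≤ max R₁ 1 → |g y| ≤ ρ) →
      K₁ * ∫ y, |g (x - y)| ∂ν + K₂ * supNormOn (Icc (x - 1) (x + 1)) g ≤ β := by
    intro g x h1 h2
    have e1 := hint g x h1 (fun y hy => h2 y (hy.trans (le_max_left _ _)))
    have e2 : supNormOn (Icc (x - 1) (x + 1)) g ≤ ρ := by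
      refine supNormOn_le ⟨x, by constructor <;> linarith⟩ fun y hy => h2 y ?_
      refine le_trans ?_ (le_max_right _ _)
      rw [abs_le]; constructor <;> linarith [hy.1, hy.2]
    have e3 : ρ * (2 * K₁ + K₂) = β := by rw [hρ]; field_simp
    nlinarith
  refine ⟨β, hβ0, min (1 / 4) (min δa δb), by positivity, min_le_left _ _,
    max 0 (R₂ + max R₁ 1), ?_⟩
  intro t ht s x hs hx
  have hs1 : |s| ≤ 1 / 4 := hs.trans (min_le_left _ _)
  have hsa : |s| ≤ δa := hs.trans ((min_le_right _ _).trans (min_le_left _ _))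
  have hsb : |s| ≤ δb := hs.trans ((min_le_right _ _).trans (min_le_right _ _))
  have hs2 := abs_le.1 hs1
  have hVd := hV.sol.mem_dom (lt_of_lt_of_le one_pos ht)
  have hVm := hV.mem t (lt_of_lt_of_le one_pos ht)
  have hx' := (le_max_right _ _).trans hx
  -- on the right of the interface compare with the constant `1 + s`, on the left with `s`
  rcases le_total (z t) x with hxz | hxz
  · rw [abs_of_nonneg (by linarith)] at hx'
    have h := hE (fun _ => 1 + s) (fun y => V t y + -1)
      ⟨A.const_mem_dom _, A.add_const_mem_dom hVd _,
        fun y => ⟨by linarith [hs2.1], by linarith [hs2.2]⟩,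
        fun y => ⟨by linarith [(hVm y).1], by linarith [(hVm y).2]⟩⟩ x
    rw [deriv_const_one hS.const] at h
    have e : ((fun _ => 1 + s) + fun y => V t y + -1) = fun y => V t y + s := by
      funext y; simp only [Pi.add_apply]; ring
    rw [e] at h
    have h2 := hsmall (fun y => V t y + -1) x
      (fun y => abs_le.2 ⟨by linarith [(hVm y).1], by linarith [(hVm y).2]⟩)
      (fun y hy => by
        have h3 := (htail t ht y).1 (by linarith [(abs_le.1 hy).1])
        exact abs_le.2 ⟨by linarith, by linarith [(hVm y).2]⟩)
    have h3 := hb s hsb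
    linarith [(abs_le.1 (h.trans h2)).2]
  · rw [abs_of_nonpos (by linarith)] at hx'
    have h := hE (fun _ => s) (V t)
      ⟨A.const_mem_dom _, hVd, fun y => ⟨by linarith [hs2.1], by linarith [hs2.2]⟩,
        fun y => ⟨by linarith [(hVm y).1], by linarith [(hVm y).2]⟩⟩ x
    rw [deriv_const_one hS.const] at h
    have e : ((fun _ => s) + V t) = fun y => V t y + s := by
      funext y; simp only [Pi.add_apply]; ring
    rw [e] at h
    have h2 := hsmall (V t) x
      (fun y => abs_le.2 ⟨by linarith [(hVm y).1], by linarith [(hVm y).2]⟩)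
      (fun y hy => by
        have h3 := (htail t ht y).2 (by linarith [(abs_le.1 hy).2])
        exact abs_le.2 ⟨by linarith [(hVm y).1], h3⟩)
    have h3 := ha s hsa
    rw [zero_add] at h3
    linarith [(abs_le.1 (h.trans h2)).2]

/-- The front `V`, started at time `t₀`, with an exponentially decaying vertical error `δ` and an
accompanying drift of total size `σ δ`. -/
def perturbed (V : ℝ → ℝ → ℝ) (β σ t₀ ξ δ : ℝ) (t x : ℝ) : ℝ :=
  V (t₀ + t) (x + (ξ + σ * δ * (1 - Real.exp (-(β * t))))) + δ * Real.exp (-(β * t))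

theorem perturbed_zero (V : ℝ → ℝ → ℝ) (β σ t₀ ξ δ x : ℝ) :
    perturbed V β σ t₀ ξ δ 0 x = V t₀ (x + ξ) + δ := by
  simp [perturbed]

theorem abs_mul_exp_le {β δ t : ℝ} (hβ : 0 ≤ β) (ht : 0 ≤ t) :
    |δ * Real.exp (-(β * t))| ≤ |δ| := by
  rw [abs_mul, abs_of_pos (Real.exp_pos _)]
  exact mul_le_of_le_one_right (abs_nonneg _) (Real.exp_le_one_iff.2 (by nlinarith))

theorem IsFront.perturbed_mem (hV : A.IsFront V z) {β σ t₀ ξ δ t x : ℝ} (hβ : 0 ≤ β)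
    (ht₀ : 1 ≤ t₀) (hδ : |δ| ≤ 1 / 4) (ht : 0 ≤ t) :
    perturbed V β σ t₀ ξ δ t x ∈ Icc (-(1 / 4) : ℝ) (5 / 4) := by
  have h1 := abs_le.1 ((abs_mul_exp_le (δ := δ) hβ ht).trans hδ)
  have h2 := hV.mem (t₀ + t) (by linarith) (x + (ξ + σ * δ * (1 - Real.exp (-(β * t)))))
  unfold perturbed
  exact ⟨by linarith [h1.1, h2.1], by linarith [h1.2, h2.2]⟩

theorem IsFront.regular_perturbed (hV : A.IsFront V z) {β σ t₀ ξ δ : ℝ} (hβ : 0 ≤ β)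
    (ht₀ : 1 ≤ t₀) (hδ : |δ| ≤ 1 / 4) (hT : 0 < T) :
    A.Regular T (perturbed V β σ t₀ ξ δ) := by
  have hmem : ∀ t ≥ 0, perturbed V β σ t₀ ξ δ t ∈ A.dom := fun t ht =>
    A.add_const_mem_dom (A.translate_mem _ (hV.sol.mem_dom (by linarith)) _) _
  refine regular_of_tendsto hT (M := 2) (fun t ht x => ?_) (A.dom_subset _ (hmem 0 le_rfl))
    (fun t ht => hmem t ht.1.le)
    (fun t ht => tendstoLocallyUniformly_of_continuousAt fun x => ?_)
  · have := hV.perturbed_mem (σ := σ) (ξ := ξ) (x := x) hβ ht₀ hδ ht.1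
    exact abs_le.2 ⟨by linarith [this.1], by linarith [this.2]⟩
  · unfold perturbed
    refine ContinuousAt.add ?_ (by fun_prop)
    exact ContinuousAt.comp (g := fun p : ℝ × ℝ => V p.1 p.2)
      (f := fun p : ℝ × ℝ => (t₀ + p.1, p.2 + (ξ + σ * δ * (1 - Real.exp (-(β * p.1))))))
      (x := (t, x)) (hV.cont _ (by linarith [ht.1]) _) (by fun_prop)

/-- Perturbed fronts are supersolutions for `δ ≥ 0` and subsolutions for `δ ≤ 0`. Far from the
interface the decay of the vertical error is due to the stability of the states `0` and `1`; near
the interface the drift compensates, because the front is steep there. -/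
theorem IsFront.exists_perturbed (hS : A.Standing f) (hE : A.DerivBounded)
    (hV : A.IsFront V z) : ∃ β > 0, ∃ σ > 0, ∃ δ₀ > 0, δ₀ ≤ 1 / 4 ∧
      ∀ t₀ ≥ 1, ∀ ξ δ T, 0 < T → |δ| ≤ δ₀ →
        (0 ≤ δ → A.IsSupersolution T (perturbed V β σ t₀ ξ δ)) ∧
        (δ ≤ 0 → A.IsSubsolution T (perturbed V β σ t₀ ξ δ)) := by
  obtain ⟨β, hβ, δ₀, hδ₀, hδ₀', R, hout⟩ := hV.exists_deriv_one_le hS hE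
  obtain ⟨m, hm, hsteep⟩ := hV.steep R
  obtain ⟨K₁, K₂, ν, hK₁, hK₂, hν, hE⟩ := hE
  set Λ := |_root_.deriv f 0| + 2 * K₁ + 2 * K₂ with hΛ
  have hΛ0 : 0 < Λ := by positivity
  -- near the interface the slope is at least `m`, and `σ β m` outweighs both the decay rate `β` and
  -- the bound `Λ` of the linearization
  set σ := (β + Λ) / (β * m) with hσ
  have hσ0 : 0 < σ := by positivity
  have hσm : σ * β * m = β + Λ := by rw [hσ]; field_simp
  have key : ∀ t ≥ 1, ∀ s x, |s| ≤ δ₀ →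
      0 ≤ σ * β * _root_.deriv (V t) x - β - A.deriv (fun y => V t y + s) (fun _ => 1) x := by
    intro t ht s x hs
    have hs1 := abs_le.1 (hs.trans hδ₀')
    rcases le_total R |x - z t| with hx | hx
    · have h1 := hout t ht s x hs hx
      have h2 := hV.deriv_pos ht x
      have : 0 < σ * β * _root_.deriv (V t) x := by positivity
      linarith
    · have h1 := hsteep t ht x hx
      have h2 := hE.abs_deriv_one_le hS.const hK₁ hK₂
        (A.add_const_mem_dom (hV.sol.mem_dom (lt_of_lt_of_le one_pos ht)) s)
        (fun y => by
          have := hV.mem t (lt_of_lt_of_le one_pos ht) y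
          exact ⟨by linarith [this.1, hs1.1], by linarith [this.2, hs1.2]⟩) x
      have h3 : σ * β * m ≤ σ * β * _root_.deriv (V t) x := by gcongr
      linarith [(abs_le.1 h2).2]
  refine ⟨β, hβ, σ, hσ0, δ₀, hδ₀, hδ₀', fun t₀ ht₀ ξ δ T hT hδ => ?_⟩
  have hreg := hV.regular_perturbed (σ := σ) (ξ := ξ) hβ.le ht₀ (hδ.trans hδ₀') hT
  have hmain : ∀ t ∈ Ioo 0 T, ∀ x, ∃ d e : ℝ,
      HasDerivAt (fun s => perturbed V β σ t₀ ξ δ s x) d t ∧ 0 ≤ e ∧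
      d - A.toFun (perturbed V β σ t₀ ξ δ t) x = δ * Real.exp (-(β * t)) * e := by
    intro t ht x
    set q := δ * Real.exp (-(β * t)) with hq
    set y := x + (ξ + σ * δ * (1 - Real.exp (-(β * t)))) with hy
    have htt : 1 ≤ t₀ + t := by linarith [ht.1]
    have hVd := hV.sol.mem_dom (lt_of_lt_of_le one_pos htt)
    have hA : A.toFun (perturbed V β σ t₀ ξ δ t) x
        = A.toFun (fun y => V (t₀ + t) y + q) y :=
      hS.trans _ (A.add_const_mem_dom hVd q) _ x
    have hexp : HasDerivAt (fun t => Real.exp (-(β * t))) (Real.exp (-(β * t)) * -β) t := by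
      have := (((hasDerivAt_id t).const_mul β).neg).exp
      simpa using this
    have hcurve : HasDerivAt (fun t => x + (ξ + σ * δ * (1 - Real.exp (-(β * t)))))
        (σ * q * β) t := by
      have := (((hexp.const_sub 1).const_mul (σ * δ)).const_add ξ).const_add x
      refine this.congr_deriv ?_
      rw [hq]; ring
    have hVt : HasDerivAt (fun s => V (t₀ + s) y) (A.toFun (V (t₀ + t)) y) t :=
      HasDerivAt.comp_const_add t₀ t (hV.sol.2 (t₀ + t) (by linarith) y)
    have htot := hasDerivAt_along (F := fun t => V (t₀ + t))
      (s := fun t => x + (ξ + σ * δ * (1 - Real.exp (-(β * t))))) hVt hcurve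
      (by
        filter_upwards [lt_mem_nhds ht.1] with s hs
        exact hV.diff _ (by linarith))
      (ContinuousAt.comp (g := fun p : ℝ × ℝ => _root_.deriv (V p.1) p.2)
        (f := fun p : ℝ × ℝ => (t₀ + p.1, p.2)) (x := (t, y))
        (hV.contDeriv _ (by linarith) _) (by fun_prop))
    -- mean value theorem along constants
    obtain ⟨θ, hθ, hmv⟩ : ∃ θ, |θ| ≤ δ₀ ∧ A.toFun (fun y => V (t₀ + t) y + q) y
        - A.toFun (V (t₀ + t)) y = q * A.deriv (fun y => V (t₀ + t) y + θ) (fun _ => 1) y := by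
      have hqδ : |q| ≤ δ₀ := (abs_mul_exp_le hβ.le ht.1.le).trans hδ
      have hqa := abs_le.1 hqδ
      have hd := fun s => hasDerivAt_add_const hS.hasDeriv hVd s y
      have hc : Continuous fun s => A.toFun (fun y => V (t₀ + t) y + s) y :=
        continuous_iff_continuousAt.2 fun s => (hd s).continuousAt
      rcases lt_trichotomy q 0 with h | h | h
      · obtain ⟨c, hc1, hc2⟩ := exists_hasDerivAt_eq_slope _ _ h hc.continuousOn
          (fun s _ => hd s)
        refine ⟨c, abs_le.2 ⟨by linarith [hc1.1], by linarith [hc1.2]⟩, ?_⟩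
        rw [hc2]
        simp only [add_zero]
        field_simp
        ring
      · exact ⟨0, by simpa using hδ₀.le, by simp [h]⟩
      · obtain ⟨c, hc1, hc2⟩ := exists_hasDerivAt_eq_slope _ _ h hc.continuousOn
          (fun s _ => hd s)
        refine ⟨c, abs_le.2 ⟨by linarith [hc1.1], by linarith [hc1.2]⟩, ?_⟩
        rw [hc2]
        simp only [add_zero]
        field_simp
        ring
    refine ⟨_, _, htot.add (hexp.const_mul δ), key (t₀ + t) htt θ y hθ, ?_⟩
    rw [hA]
    simp only [← hy] at *
    have e1 : A.toFun (fun y => V (t₀ + t) y + q) y = A.toFun (V (t₀ + t)) y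
        + q * A.deriv (fun y => V (t₀ + t) y + θ) (fun _ => 1) y := by linarith
    rw [e1]
    have e2 : δ * (Real.exp (-(β * t)) * -β) = -(β * q) := by rw [hq]; ring
    rw [e2]
    ring
  constructor
  · intro h
    refine ⟨hreg, fun t ht x => ?_⟩
    obtain ⟨d, e, hd, he, hde⟩ := hmain t ht x
    have : 0 ≤ δ * Real.exp (-(β * t)) * e := by positivity
    exact ⟨d, hd, by linarith⟩
  · intro h
    refine ⟨hreg, fun t ht x => ?_⟩
    obtain ⟨d, e, hd, he, hde⟩ := hmain t ht x
    have : δ * Real.exp (-(β * t)) * e ≤ 0 :=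
      mul_nonpos_of_nonpos_of_nonneg (mul_nonpos_of_nonpos_of_nonneg h (Real.exp_pos _).le) he
    exact ⟨d, hd, by linarith⟩

end NonlinOp

end

section

variable {X : Phase}

theorem sub_le_of_deriv_le {g : ℝ → ℝ} (hg : Differentiable ℝ g) {a b C : ℝ} (hab : a ≤ b)
    (h : ∀ x ∈ Icc a b, deriv g x ≤ C) : g b - g a ≤ C * (b - a) :=
  Convex.image_sub_le_mul_sub_of_deriv_le (convex_Icc a b) hg.continuous.continuousOn
    hg.differentiableOn (fun x hx => h x (interior_subset hx)) a (left_mem_Icc.2 hab) b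
    (right_mem_Icc.2 hab) hab

theorem le_sub_of_le_deriv {g : ℝ → ℝ} (hg : Differentiable ℝ g) {a b C : ℝ} (hab : a ≤ b)
    (h : ∀ x ∈ Icc a b, C ≤ deriv g x) : C * (b - a) ≤ g b - g a :=
  Convex.mul_sub_le_image_sub_of_le_deriv (convex_Icc a b) hg.continuous.continuousOn
    hg.differentiableOn (fun x hx => h x (interior_subset hx)) a (left_mem_Icc.2 hab) b
    (right_mem_Icc.2 hab) hab

theorem tendsto_mul_exp_neg {β : ℝ} (hβ : 0 < β) (δ : ℝ) :
    Tendsto (fun t => δ * Real.exp (-(β * t))) atTop (𝓝 0) := by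
  have h : Tendsto (fun t => Real.exp (-(β * t))) atTop (𝓝 0) :=
    Real.tendsto_exp_neg_atTop_nhds_zero.comp (tendsto_id.const_mul_atTop hβ)
  simpa using h.const_mul δ

namespace NonlinOp

variable {A : NonlinOp X} {T : ℝ} {u V : ℝ → ℝ → ℝ} {f z U : ℝ → ℝ} {c : ℝ}

/-! ### Fronts trap solutions -/

/-- `β`, `σ`, `δ₀` are admissible rate, drift and size for the perturbations of the front `V`. -/
structure PerturbationConstants (A : NonlinOp X) (V : ℝ → ℝ → ℝ) (β σ δ₀ : ℝ) : Prop where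
  rate_pos : 0 < β
  drift_pos : 0 < σ
  size_pos : 0 < δ₀
  size_le : δ₀ ≤ 1 / 4
  isSupersolution : ∀ t₀ ≥ 1, ∀ ξ δ T, 0 < T → 0 ≤ δ → δ ≤ δ₀ →
    A.IsSupersolution T (perturbed V β σ t₀ ξ δ)
  isSubsolution : ∀ t₀ ≥ 1, ∀ ξ δ T, 0 < T → 0 ≤ δ → δ ≤ δ₀ →
    A.IsSubsolution T (perturbed V β σ t₀ ξ (-δ))

theorem IsFront.exists_perturbationConstants (hS : A.Standing f) (hE : A.DerivBounded)
    (hV : A.IsFront V z) : ∃ β σ δ₀, A.PerturbationConstants V β σ δ₀ := by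
  obtain ⟨β, hβ, σ, hσ, δ₀, h0, h1, h⟩ := hV.exists_perturbed hS hE
  refine ⟨β, σ, δ₀, hβ, hσ, h0, h1, fun t₀ ht₀ ξ δ T hT hδ hδ' => ?_,
    fun t₀ ht₀ ξ δ T hT hδ hδ' => ?_⟩
  · exact (h t₀ ht₀ ξ δ T hT (by rwa [abs_of_nonneg hδ])).1 hδ
  · exact (h t₀ ht₀ ξ (-δ) T hT (by rwa [abs_neg, abs_of_nonneg hδ])).2 (by linarith)

variable {β σ δ₀ Λ : ℝ}

theorem PerturbationConstants.le_perturbed (hP : A.PerturbationConstants V β σ δ₀)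
    (hS : A.Standing f) (hΛ : A.ShiftLipschitz Λ) (hΛ0 : 0 ≤ Λ) (hV : A.IsFront V z)
    (hu : A.IsSolution u) {t₀ ξ δ : ℝ} (ht₀ : 1 ≤ t₀) (hδ : 0 ≤ δ) (hδ' : δ ≤ δ₀)
    (h : ∀ x, u t₀ x ≤ V t₀ (x + ξ) + δ) {t : ℝ} (ht : 0 ≤ t) (x : ℝ) :
    u (t₀ + t) x ≤ perturbed V β σ t₀ ξ δ t x := by
  have hT : 0 < t + 1 := by linarith
  refine hS.comp.le_of_le hΛ hΛ0 hT (hP.isSupersolution t₀ ht₀ ξ δ _ hT hδ hδ')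
    (r := 5 / 4) (by norm_num) (fun s hs y => ?_)
    ((hu.shift (by linarith : 0 ≤ t₀)).isSubsolution hT)
    (fun y => ?_) t ⟨ht, by linarith⟩ x
  · have := hV.perturbed_mem (σ := σ) (ξ := ξ) (x := y) hP.rate_pos.le ht₀
      (δ := δ) (by rw [abs_of_nonneg hδ]; exact hδ'.trans hP.size_le) hs.1.le
    exact ⟨by linarith [this.1], this.2⟩
  · rw [perturbed_zero]
    simpa using h y

theorem PerturbationConstants.perturbed_le (hP : A.PerturbationConstants V β σ δ₀)
    (hS : A.Standing f) (hΛ : A.ShiftLipschitz Λ) (hΛ0 : 0 ≤ Λ) (hV : A.IsFront V z)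
    (hu : A.IsSolution u) {t₀ ξ δ : ℝ} (ht₀ : 1 ≤ t₀) (hδ : 0 ≤ δ) (hδ' : δ ≤ δ₀)
    (h : ∀ x, V t₀ (x + ξ) - δ ≤ u t₀ x) {t : ℝ} (ht : 0 ≤ t) (x : ℝ) :
    perturbed V β σ t₀ ξ (-δ) t x ≤ u (t₀ + t) x := by
  have hT : 0 < t + 1 := by linarith
  refine hS.comp.le_of_le' hΛ hΛ0 hT ((hu.shift (by linarith : 0 ≤ t₀)).isSupersolution hT)
    (hP.isSubsolution t₀ ht₀ ξ δ _ hT hδ hδ')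
    (r := -(1 / 4)) (by norm_num) (fun s hs y => ?_)
    (fun y => ?_) t ⟨ht, by linarith⟩ x
  · have := hV.perturbed_mem (σ := σ) (ξ := ξ) (x := y) hP.rate_pos.le ht₀
      (δ := -δ) (by rw [abs_neg, abs_of_nonneg hδ]; exact hδ'.trans hP.size_le) hs.1.le
    exact ⟨this.1, by linarith [this.2]⟩
  · rw [perturbed_zero]
    simpa using h y

theorem exp_neg_mul_mem {β t : ℝ} (hβ : 0 < β) (ht : 0 ≤ t) :
    0 < Real.exp (-(β * t)) ∧ Real.exp (-(β * t)) ≤ 1 :=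
  ⟨Real.exp_pos _, Real.exp_le_one_iff.2 (by nlinarith)⟩

/-- A solution below a shifted front, up to `δ`, stays below the front with shift increased by
`σ δ`, up to an exponentially decaying error. -/
theorem PerturbationConstants.upper (hP : A.PerturbationConstants V β σ δ₀)
    (hS : A.Standing f) (hΛ : A.ShiftLipschitz Λ) (hΛ0 : 0 ≤ Λ) (hV : A.IsFront V z)
    (hu : A.IsSolution u) {t₀ ξ δ : ℝ} (ht₀ : 1 ≤ t₀) (hδ : 0 ≤ δ) (hδ' : δ ≤ δ₀)
    (h : ∀ x, u t₀ x ≤ V t₀ (x + ξ) + δ) {t : ℝ} (ht : 0 ≤ t) (x : ℝ) :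
    u (t₀ + t) x ≤ V (t₀ + t) (x + (ξ + σ * δ)) + δ * Real.exp (-(β * t)) := by
  have h1 := hP.le_perturbed hS hΛ hΛ0 hV hu ht₀ hδ hδ' h ht x
  unfold perturbed at h1
  obtain ⟨he, he'⟩ := exp_neg_mul_mem hP.rate_pos ht
  have h2 : V (t₀ + t) (x + (ξ + σ * δ * (1 - Real.exp (-(β * t)))))
      ≤ V (t₀ + t) (x + (ξ + σ * δ)) := by
    refine (hV.strictMono (by linarith)).monotone ?_
    have : 0 ≤ σ * δ := mul_nonneg hP.drift_pos.le hδ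
    nlinarith
  linarith

theorem PerturbationConstants.lower (hP : A.PerturbationConstants V β σ δ₀)
    (hS : A.Standing f) (hΛ : A.ShiftLipschitz Λ) (hΛ0 : 0 ≤ Λ) (hV : A.IsFront V z)
    (hu : A.IsSolution u) {t₀ ξ δ : ℝ} (ht₀ : 1 ≤ t₀) (hδ : 0 ≤ δ) (hδ' : δ ≤ δ₀)
    (h : ∀ x, V t₀ (x + ξ) - δ ≤ u t₀ x) {t : ℝ} (ht : 0 ≤ t) (x : ℝ) :
    V (t₀ + t) (x + (ξ - σ * δ)) - δ * Real.exp (-(β * t)) ≤ u (t₀ + t) x := by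
  have h1 := hP.perturbed_le hS hΛ hΛ0 hV hu ht₀ hδ hδ' h ht x
  unfold perturbed at h1
  obtain ⟨he, he'⟩ := exp_neg_mul_mem hP.rate_pos ht
  have h2 : V (t₀ + t) (x + (ξ - σ * δ))
      ≤ V (t₀ + t) (x + (ξ + σ * -δ * (1 - Real.exp (-(β * t))))) := by
    refine (hV.strictMono (by linarith)).monotone ?_
    have : 0 ≤ σ * δ := mul_nonneg hP.drift_pos.le hδ
    nlinarith
  linarith

/-! ### Monotone waves are fronts -/

theorem IsMonotoneWave.strictMono (hU : A.IsMonotoneWave U c) : StrictMono U :=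
  strictMono_of_deriv_pos hU.2.2.2

theorem IsMonotoneWave.mem_Icc (hU : A.IsMonotoneWave U c) (x : ℝ) : U x ∈ Icc (0 : ℝ) 1 :=
  ⟨hU.strictMono.monotone.le_of_tendsto hU.1.2.1 x,
    hU.strictMono.monotone.ge_of_tendsto hU.1.2.2 x⟩

theorem IsMonotoneWave.isFront (hU : A.IsMonotoneWave U c) :
    A.IsFront (fun t x => U (x - c * t)) (fun t => c * t) := by
  obtain ⟨⟨hsol, hbot, htop⟩, hC1, hco, hpos⟩ := id hU
  have hdU : Differentiable ℝ U := hC1.differentiable one_ne_zero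
  have hcU : Continuous U := hdU.continuous
  have hcU' : Continuous (_root_.deriv U) := hC1.continuous_deriv le_rfl
  have hder : ∀ t x, _root_.deriv (fun x => U (x - c * t)) x = _root_.deriv U (x - c * t) :=
    fun t x => deriv_comp_sub_const (f := U) (c * t) x
  have hflat : ∀ ρ > 0, ∃ R, ∀ x, R ≤ |x| → _root_.deriv U x ≤ ρ := by
    intro ρ hρ
    rw [cocompact_eq_atBot_atTop, tendsto_sup] at hco
    obtain ⟨a, ha⟩ := eventually_atBot.1 (hco.1.eventually (ge_mem_nhds hρ))
    obtain ⟨b, hb⟩ := eventually_atTop.1 (hco.2.eventually (ge_mem_nhds hρ))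
    refine ⟨max (-a) b, fun x hx => ?_⟩
    rcases le_total 0 x with h | h
    · rw [abs_of_nonneg h] at hx
      exact hb x ((le_max_right _ _).trans hx)
    · rw [abs_of_nonpos h] at hx
      exact ha x (by linarith [(le_max_left _ _).trans hx])
  refine ⟨hsol, fun t _ x => hU.mem_Icc _, fun t _ => ?_, fun t _ x => ?_, fun t _ x => ?_, ?_, ?_,
    ?_, ?_, ?_⟩
  · exact hdU.comp (differentiable_id.sub_const _)
  · exact (by fun_prop : Continuous fun p : ℝ × ℝ => U (p.2 - c * p.1)).continuousAt
  · simp only [hder]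
    exact (by fun_prop : Continuous fun p : ℝ × ℝ => _root_.deriv U (p.2 - c * p.1)).continuousAt
  · intro ρ hρ
    obtain ⟨a, ha⟩ := eventually_atBot.1 (hbot.eventually (ge_mem_nhds hρ))
    obtain ⟨b, hb⟩ := eventually_atTop.1 (htop.eventually (le_mem_nhds (by linarith : 1 - ρ < 1)))
    refine ⟨max (-a) b, fun t _ x => ⟨fun hx => hb _ ?_, fun hx => ha _ ?_⟩⟩
    · linarith [le_max_right (-a) b]
    · linarith [le_max_left (-a) b]
  · intro R
    obtain ⟨y, -, hy⟩ := (isCompact_Icc (a := -|R|) (b := |R|)).exists_isMinOn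
      ⟨0, by simp⟩ hcU'.continuousOn
    refine ⟨_root_.deriv U y, hpos y, fun t _ x hx => ?_⟩
    rw [hder]
    exact hy (abs_le.1 (hx.trans (le_abs_self R)))
  · obtain ⟨R, hR⟩ := hflat 1 one_pos
    obtain ⟨y, -, hy⟩ := (isCompact_Icc (a := -|R|) (b := |R|)).exists_isMaxOn
      ⟨0, by simp⟩ hcU'.continuousOn
    refine ⟨max 1 (_root_.deriv U y), fun t _ x => ?_⟩
    rw [hder]
    rcases le_total R |x - c * t| with h | h
    · exact (hR _ h).trans (le_max_left _ _)
    · refine le_trans ?_ (le_max_right _ _)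
      exact hy (abs_le.1 (h.trans (le_abs_self R)))
  · intro ρ hρ
    obtain ⟨R, hR⟩ := hflat ρ hρ
    exact ⟨R, fun t _ x hx => by rw [hder]; exact hR _ hx⟩
  · exact ⟨|c|, fun t _ => by simp [mul_add]⟩

/-! ### Uniqueness -/

theorem exists_shift_le {P Q : ℝ → ℝ} (hP1 : ∀ x, P x ≤ 1) (hP : Tendsto P atBot (𝓝 0))
    (hQ0 : ∀ x, 0 ≤ Q x) (hQ : Tendsto Q atTop (𝓝 1)) {δ : ℝ} (hδ : 0 < δ) :
    ∃ L, ∀ y, P y ≤ Q (y + L) + δ := by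
  obtain ⟨a, ha⟩ := eventually_atBot.1 (hP.eventually (ge_mem_nhds hδ))
  obtain ⟨b, hb⟩ := eventually_atTop.1 (hQ.eventually (le_mem_nhds (by linarith : 1 - δ < 1)))
  refine ⟨b - a, fun y => ?_⟩
  rcases le_total y a with h | h
  · linarith [ha y h, hQ0 (y + (b - a))]
  · linarith [hb (y + (b - a)) (by linarith), hP1 y]

/-- Uniqueness of waves by sliding. Up to the errors in `PerturbationConstants.upper` and
`PerturbationConstants.lower`, the wave `W` lies between two shifts of `U`; as these do not drift
apart, the speeds agree, and letting `t → ∞` removes the vertical errors. For the least shift of `U`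
above `W`, the strong comparison principle yields equality or a positive distance on compact sets;
in the latter case the shift could be decreased, since `U` is flat near infinity. -/
theorem IsMonotoneWave.unique (hS : A.Standing f) (hE : A.DerivBounded)
    (hU : A.IsMonotoneWave U c) {W : ℝ → ℝ} {d : ℝ} (hW : A.IsTravelingWave W d)
    (hWc : Continuous W) (hWr : ∀ ξ, W ξ ∈ Icc (0 : ℝ) 1) :
    c = d ∧ ∃ ξ₀, ∀ ξ, W ξ = U (ξ + ξ₀) := by
  obtain ⟨Λ, hΛ0, hΛ⟩ := hS.exists_shiftLipschitz hE
  have hV := hU.isFront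
  obtain ⟨β, σ, δ₀, hP⟩ := hV.exists_perturbationConstants hS hE
  obtain ⟨hWs, hWbot, hWtop⟩ := hW
  have hUbot := hU.1.2.1
  have hUtop := hU.1.2.2
  have hUc : Continuous U := hU.2.1.continuous
  have hσ := hP.drift_pos
  have hβ := hP.rate_pos
  have hδ₀ := hP.size_pos
  -- the trapping estimates, in the frame moving with `W`
  have up : ∀ ξ δ, 0 ≤ δ → δ ≤ δ₀ → (∀ y, W y ≤ U (y + ξ) + δ) → ∀ t ≥ 0, ∀ y,
      W y ≤ U (y + ((d - c) * t + (ξ + σ * δ))) + δ * Real.exp (-(β * t)) := by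
    intro ξ δ h0 h1 h t ht y
    have := hP.upper hS hΛ hΛ0 hV hWs (t₀ := 1) (ξ := ξ + c - d) le_rfl h0 h1
      (fun x => by
        have := h (x - d * 1)
        have e : x - d * 1 + ξ = x + (ξ + c - d) - c * 1 := by ring
        rwa [e] at this) ht (y + d * (1 + t))
    have e1 : y + d * (1 + t) - d * (1 + t) = y := by ring
    have e2 : y + d * (1 + t) + (ξ + c - d + σ * δ) - c * (1 + t)
      = y + ((d - c) * t + (ξ + σ * δ)) := by ring
    rwa [e1, e2] at this
  have low : ∀ ξ δ, 0 ≤ δ → δ ≤ δ₀ → (∀ y, U (y + ξ) - δ ≤ W y) → ∀ t ≥ 0, ∀ y,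
      U (y + ((d - c) * t + (ξ - σ * δ))) - δ * Real.exp (-(β * t)) ≤ W y := by
    intro ξ δ h0 h1 h t ht y
    have := hP.lower hS hΛ hΛ0 hV hWs (t₀ := 1) (ξ := ξ + c - d) le_rfl h0 h1
      (fun x => by
        have := h (x - d * 1)
        have e : x - d * 1 + ξ = x + (ξ + c - d) - c * 1 := by ring
        rwa [e] at this) ht (y + d * (1 + t))
    have e1 : y + d * (1 + t) - d * (1 + t) = y := by ring
    have e2 : y + d * (1 + t) + (ξ + c - d - σ * δ) - c * (1 + t)
      = y + ((d - c) * t + (ξ - σ * δ)) := by ring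
    rwa [e1, e2] at this
  obtain ⟨L, hL⟩ := exists_shift_le (fun x => (hWr x).2) hWbot (fun x => (hU.mem_Icc x).1) hUtop
    hδ₀
  obtain ⟨L', hL'⟩ := exists_shift_le (fun x => (hU.mem_Icc x).2) hUbot (fun x => (hWr x).1) hWtop
    hδ₀
  have hup := up L δ₀ hδ₀.le le_rfl hL
  have hlow := low (-L') δ₀ hδ₀.le le_rfl (fun y => by
    have := hL' (y + -L'); rw [neg_add_cancel_right] at this; linarith)
  -- for different speeds, `W` would be constant in the limit `t → ∞`
  have hcd : c = d := by
    rcases lt_trichotomy d c with h | h | h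
    · exfalso
      have h0 : ∀ y, W y ≤ 0 := by
        intro y
        have hlin : Tendsto (fun t => y + ((d - c) * t + (L + σ * δ₀))) atTop atBot :=
          tendsto_atBot_add_const_left _ _ (tendsto_atBot_add_const_right _ _
            (tendsto_id.const_mul_atTop_of_neg (by linarith)))
        have hlim := (hUbot.comp hlin).add (tendsto_mul_exp_neg hβ δ₀)
        rw [add_zero] at hlim
        exact ge_of_tendsto hlim (by
          filter_upwards [eventually_ge_atTop 0] with t ht using hup t ht y)
      have := le_of_tendsto hWtop (Eventually.of_forall h0)
      linarith
    · exact h.symm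
    · exfalso
      have h0 : ∀ y, 1 ≤ W y := by
        intro y
        have hlin : Tendsto (fun t => y + ((d - c) * t + (-L' - σ * δ₀))) atTop atTop :=
          tendsto_atTop_add_const_left _ _ (tendsto_atTop_add_const_right _ _
            (tendsto_id.const_mul_atTop (by linarith)))
        have hlim := (hUtop.comp hlin).sub (tendsto_mul_exp_neg hβ δ₀)
        rw [sub_zero] at hlim
        exact le_of_tendsto hlim (by
          filter_upwards [eventually_ge_atTop 0] with t ht using hlow t ht y)
      have := ge_of_tendsto hWbot (Eventually.of_forall h0)
      linarith
  refine ⟨hcd, ?_⟩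
  subst hcd
  -- letting `t → ∞` removes the vertical error
  have up' : ∀ ξ δ, 0 ≤ δ → δ ≤ δ₀ → (∀ y, W y ≤ U (y + ξ) + δ) → ∀ y,
      W y ≤ U (y + (ξ + σ * δ)) := by
    intro ξ δ h0 h1 h y
    have hlim := (tendsto_mul_exp_neg hβ δ).const_add (U (y + (ξ + σ * δ)))
    rw [add_zero] at hlim
    refine ge_of_tendsto hlim ?_
    filter_upwards [eventually_ge_atTop 0] with t ht
    simpa using up ξ δ h0 h1 h t ht y
  set S := {s | ∀ y, W y ≤ U (y + s)} with hSdef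
  have hSne : S.Nonempty := ⟨_, up' L δ₀ hδ₀.le le_rfl hL⟩
  have hSbdd : BddBelow S := by
    obtain ⟨y, hy⟩ := (hWtop.eventually (le_mem_nhds (by norm_num : (1 / 2 : ℝ) < 1))).exists
    obtain ⟨b, hb⟩ := eventually_atBot.1
      (hUbot.eventually (gt_mem_nhds (by norm_num : (0 : ℝ) < 1 / 2)))
    refine ⟨b - y, fun s hs => ?_⟩
    by_contra hcon
    push Not at hcon
    linarith [hb (y + s) (by linarith), hs y]
  set s₀ := sInf S with hs₀
  have hs₀S : ∀ y, W y ≤ U (y + s₀) := by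
    intro y
    have hcl : IsClosed S := by
      have : S = ⋂ y, {s | W y ≤ U (y + s)} := by ext s; simp [hSdef]
      rw [this]
      exact isClosed_iInter fun y => isClosed_le continuous_const (by fun_prop)
    exact hcl.csInf_mem hSne hSbdd y
  refine ⟨s₀, ?_⟩
  by_contra hne
  have hlt : ∀ y, W y < U (y + s₀) := by
    intro y
    have hsup : A.IsSupersolution 2 (fun t x => U (x - c * t + s₀)) := by
      have := (hU.1.1.translate hS.trans s₀).isSupersolution (T := 2) two_pos
      have e : (fun t x => U (x + s₀ - c * t)) = fun t x => U (x - c * t + s₀) := by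
        funext t x; congr 1; ring
      rwa [e] at this
    have := hS.comp 2 two_pos _ _ hsup (hWs.isSubsolution two_pos)
      (fun x => by simpa using hs₀S x) (fun hae => hne fun ξ => ?_) 1 ⟨one_pos, one_lt_two⟩
      (y + c * 1)
    · simpa using this
    · have h1 := Continuous.ae_eq_iff_eq volume (by fun_prop) (by fun_prop) |>.1 hae
      have := congrFun h1 ξ
      simpa using this.symm
  -- a slightly smaller shift still works up to a small vertical error
  obtain ⟨R, hR⟩ := hV.flat (1 / (2 * σ)) (by positivity)
  obtain ⟨M, hM⟩ := hV.bdd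
  have hderiv : ∀ x, _root_.deriv (fun x => U (x - c * 1)) x = _root_.deriv U (x - c * 1) :=
    fun x => deriv_comp_sub_const (f := U) (c * 1) x
  have hRU : ∀ x, R ≤ |x| → _root_.deriv U x ≤ 1 / (2 * σ) := by
    intro x hx
    have := hR 1 le_rfl (x + c * 1) (by simpa using hx)
    rw [hderiv] at this
    simpa using this
  have hMU : ∀ x, _root_.deriv U x ≤ M := by
    intro x
    have := hM 1 le_rfl (x + c * 1)
    rw [hderiv] at this
    simpa using this
  have hM0 : 0 < M := (hU.2.2.2 0).trans_le (hMU 0)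
  have hdU : Differentiable ℝ U := hU.2.1.differentiable one_ne_zero
  obtain ⟨y₀, -, hy₀⟩ := (isCompact_Icc (a := -s₀ - (|R| + 1))
    (b := -s₀ + (|R| + 1))).exists_isMinOn
    ⟨-s₀, by constructor <;> linarith [abs_nonneg R]⟩
    (f := fun y => U (y + s₀) - W y) (by fun_prop : Continuous _).continuousOn
  set g := U (y₀ + s₀) - W y₀ with hg
  have hg0 : 0 < g := by linarith [hlt y₀]
  set h := min δ₀ (min (1 / (2 * σ)) (g / (M * (2 * σ)))) with hh
  have hh0 : 0 < h := by positivity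
  have hh1 : h ≤ δ₀ := min_le_left _ _
  have hh2 : 2 * σ * h ≤ 1 := by
    have : h ≤ 1 / (2 * σ) := (min_le_right _ _).trans (min_le_left _ _)
    rw [le_div_iff₀ (by positivity)] at this
    linarith
  have hh3 : M * (2 * σ * h) ≤ g := by
    have : h ≤ g / (M * (2 * σ)) := (min_le_right _ _).trans (min_le_right _ _)
    rw [le_div_iff₀ (by positivity)] at this
    linarith
  have hpos2 : 0 < 2 * σ * h := by positivity
  have hnew : ∀ y, W y ≤ U (y + (s₀ - 2 * σ * h)) + h := by
    intro y
    rcases le_total |y + s₀| (|R| + 1) with hy | hy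
    · have h1 : g ≤ U (y + s₀) - W y := hy₀ (by
        have := abs_le.1 hy
        exact ⟨by linarith, by linarith⟩)
      have h2 := sub_le_of_deriv_le hdU (a := y + (s₀ - 2 * σ * h)) (b := y + s₀) (C := M)
        (by linarith) (fun x _ => hMU x)
      have e : y + s₀ - (y + (s₀ - 2 * σ * h)) = 2 * σ * h := by ring
      rw [e] at h2
      linarith
    · have h2 := sub_le_of_deriv_le hdU (a := y + (s₀ - 2 * σ * h)) (b := y + s₀)
        (C := 1 / (2 * σ)) (by linarith) (fun x hx => hRU x (by
          have h3 : |y + s₀ - x| ≤ 1 := abs_le.2 ⟨by linarith [hx.2], by linarith [hx.1]⟩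
          have h4 := abs_sub_abs_le_abs_sub (y + s₀) x
          linarith [le_abs_self R]))
      have e : 1 / (2 * σ) * (y + s₀ - (y + (s₀ - 2 * σ * h))) = h := by field_simp; ring
      rw [e] at h2
      linarith [hlt y]
  have hin : s₀ - 2 * σ * h + σ * h ∈ S := up' _ h hh0.le hh1 hnew
  have := csInf_le hSbdd hin
  have : 0 < σ * h := by positivity
  linarith

end NonlinOp

end

section

variable {X : Phase}

namespace NonlinOp

variable {A : NonlinOp X} {T : ℝ} {u V : ℝ → ℝ → ℝ} {f z U : ℝ → ℝ} {c : ℝ} {β σ δ₀ Λ : ℝ}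

/-! ### Squeezing between two shifts of a front -/

/-- At time `t`, the solution `u` lies between the shifts of the front by `ξ` and by `ξ + h`, up to
a vertical error `δ`. -/
def Sandwiched (u V : ℝ → ℝ → ℝ) (t ξ h δ : ℝ) : Prop :=
  ∀ x, V t (x + ξ) - δ ≤ u t x ∧ u t x ≤ V t (x + (ξ + h)) + δ

theorem Sandwiched.mono (hV : A.IsFront V z) {t ξ h δ h' δ' : ℝ} (ht : 1 ≤ t)
    (hs : Sandwiched u V t ξ h δ) (hh : h ≤ h') (hδ : δ ≤ δ') : Sandwiched u V t ξ h' δ' := by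
  intro x
  have h1 := (hV.strictMono ht).monotone (by linarith : x + (ξ + h) ≤ x + (ξ + h'))
  exact ⟨by linarith [(hs x).1], by linarith [(hs x).2]⟩

/-- If the average of `u` over a unit interval within distance `H` of the interface exceeds the
lower front by at least `m k`, then the quantitative comparison allows moving the lower front
forward by `2 σ ε k`, at the price of a vertical error `ε k`; similarly for the upper front. The
vertical error absorbs the shift far from the interface, where the front is flat. -/
theorem IsFront.exists_gain (hV : A.IsFront V z) (hS : A.Standing f) (hη : A.ComparisonAtOne)
    (hP : A.PerturbationConstants V β σ δ₀) {m H : ℝ} (hm : 0 < m)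
    (hH : 0 ≤ H) : ∃ ε > 0, ε ≤ δ₀ / 2 ∧ 2 * σ * ε ≤ 1 ∧ ∀ u, A.IsSolution u →
      (∀ t ≥ 0, ∀ x, u t x ∈ Icc (0 : ℝ) 1) →
      ∀ t₀ ≥ 1, ∀ Y ξ δ k, |Y + ξ - z t₀| ≤ H → 0 ≤ δ → δ ≤ δ₀ → 0 ≤ k → k ≤ 1 →
        ((∀ x, V t₀ (x + ξ) - δ ≤ u t₀ x) →
          (m * k ≤ ∫ y in (0 : ℝ)..1, (u t₀ (y + Y) - (V t₀ (y + (Y + ξ)) - δ))) →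
          ∀ x, V (t₀ + 1) (x + (ξ - σ * δ * (1 - Real.exp (-β)) + 2 * σ * (ε * k)))
            - (δ * Real.exp (-β) + ε * k) ≤ u (t₀ + 1) x) ∧
        ((∀ x, u t₀ x ≤ V t₀ (x + ξ) + δ) →
          (m * k ≤ ∫ y in (0 : ℝ)..1, (V t₀ (y + (Y + ξ)) + δ - u t₀ (y + Y))) →
          ∀ x, u (t₀ + 1) x ≤
            V (t₀ + 1) (x + (ξ + σ * δ * (1 - Real.exp (-β)) - 2 * σ * (ε * k)))
            + (δ * Real.exp (-β) + ε * k)) := by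
  obtain ⟨η, hη0, -, hη⟩ := hη
  have hσ := hP.drift_pos
  have hβ := hP.rate_pos
  have hδ₀ := hP.size_pos
  obtain ⟨R, hR⟩ := hV.flat (1 / (2 * σ)) (by positivity)
  obtain ⟨M, hM⟩ := hV.bdd
  obtain ⟨C, hC⟩ := hV.drift
  have hM0 : 0 < M := (hV.deriv_pos le_rfl 0).trans_le (hM 1 le_rfl 0)
  have hC0 : 0 ≤ C := (abs_nonneg _).trans (hC 1 le_rfl)
  -- beyond the distance `r`, all shifts of the front occurring below are flat
  set r := |R| + 1 + σ * δ₀ + C + 1 + H with hr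
  have hr1 : 1 ≤ r := by rw [hr]; have := abs_nonneg R; have : 0 < σ * δ₀ := by positivity
                         linarith
  set ε := min (δ₀ / 2) (min (1 / (2 * σ)) (η r * m / (M * (2 * σ)))) with hε
  have hηr := hη0 r hr1
  have hε0 : 0 < ε := by positivity
  have hε2 : 2 * σ * ε ≤ 1 := by
    have : ε ≤ 1 / (2 * σ) := (min_le_right _ _).trans (min_le_left _ _)
    rw [le_div_iff₀ (by positivity)] at this
    linarith
  have hε3 : M * (2 * σ * ε) ≤ η r * m := by
    have : ε ≤ η r * m / (M * (2 * σ)) := (min_le_right _ _).trans (min_le_right _ _)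
    rw [le_div_iff₀ (by positivity)] at this
    linarith
  have hexp := exp_neg_mul_mem hβ (zero_le_one' ℝ)
  rw [mul_one] at hexp
  -- the effect of a shift of the front by at most `2 σ ε k`
  have hshift : ∀ t₀ ≥ 1, ∀ k, 0 ≤ k → k ≤ 1 → ∀ p e, |p - z t₀| ≤ H →
      |e| ≤ σ * δ₀ + 1 → ∀ y g,
      (|y| ≤ r → η r * (m * k) ≤ g) → 0 ≤ g →
      V (t₀ + 1) (y + p + e + 2 * σ * (ε * k)) - V (t₀ + 1) (y + p + e) ≤ g + ε * k := by
    intro t₀ ht₀ k hk0 hk1 p e hp he y g hg hg0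
    have hlen : 0 ≤ 2 * σ * (ε * k) := by positivity
    have hlen1 : 2 * σ * (ε * k) ≤ 1 := by nlinarith
    have hd := hV.diff (t₀ + 1) (by linarith)
    have hεk : 0 ≤ ε * k := by positivity
    rcases le_total |y| r with hy | hy
    · have h1 := sub_le_of_deriv_le hd (a := y + p + e) (b := y + p + e + 2 * σ * (ε * k))
        (C := M) (by linarith) (fun x _ => hM _ (by linarith) x)
      rw [add_sub_cancel_left] at h1
      have h2 : M * (2 * σ * (ε * k)) ≤ η r * (m * k) := by nlinarith
      linarith [hg hy]
    · have h1 := sub_le_of_deriv_le hd (a := y + p + e) (b := y + p + e + 2 * σ * (ε * k))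
        (C := 1 / (2 * σ)) (by linarith) (fun x hx => hR _ (by linarith) x (by
          have h3 : |y - (x - z (t₀ + 1))| ≤ C + H + (σ * δ₀ + 1) + 1 := by
            have h4 := hC t₀ ht₀
            have h5 : |x - (y + p + e)| ≤ 1 :=
              abs_le.2 ⟨by linarith [hx.1], by linarith [hx.2]⟩
            have e1 : y - (x - z (t₀ + 1)) =
              (z (t₀ + 1) - z t₀) - (p - z t₀) - e - (x - (y + p + e)) := by ring
            rw [e1]
            refine (abs_sub _ _).trans ?_
            have := abs_sub (z (t₀ + 1) - z t₀ - (p - z t₀)) e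
            have := abs_sub (z (t₀ + 1) - z t₀) (p - z t₀)
            linarith
          have h4 := abs_sub_abs_le_abs_sub y (x - z (t₀ + 1))
          have h5 := le_abs_self R
          rw [hr] at hy
          linarith))
      rw [add_sub_cancel_left] at h1
      have e2 : 1 / (2 * σ) * (2 * σ * (ε * k)) = ε * k := by field_simp
      rw [e2] at h1
      linarith
  refine ⟨ε, hε0, min_le_left _ _, hε2, fun u hu hur t₀ ht₀ Y ξ δ k hY hδ0 hδ1 hk0 hk1 => ⟨?_, ?_⟩⟩
  · intro hle hint x
    have hsub := (hP.isSubsolution t₀ ht₀ ξ δ 2 two_pos hδ0 hδ1).translate hS.trans Y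
    have hsup := ((hu.shift (by linarith : 0 ≤ t₀)).translate hS.trans Y).isSupersolution
      (T := 2) two_pos
    have hpair : A.OrderedPair 2 (fun t x => u (t₀ + t) (x + Y))
        (fun t x => perturbed V β σ t₀ ξ (-δ) t (x + Y)) := by
      refine ⟨hsup, hsub, fun t ht x => ⟨?_, ?_⟩, fun x => ?_⟩
      · have := hur (t₀ + t) (by linarith [ht.1]) (x + Y)
        exact ⟨by linarith [this.1], by linarith [this.2]⟩
      · have := hV.perturbed_mem (σ := σ) (ξ := ξ) (x := x + Y) hβ.le ht₀ (δ := -δ)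
          (by rw [abs_neg, abs_of_nonneg hδ0]; exact hδ1.trans hP.size_le) ht.1
        exact ⟨by linarith [this.1], by linarith [this.2]⟩
      · have := hle (x + Y)
        simp only [perturbed_zero, add_zero]
        linarith
    have hgain := fun r (hr : 1 ≤ r) y hy => hη 2 one_lt_two _ _ hpair r hr y hy
    have hinteq : (fun y => u (t₀ + 0) (y + Y)
        - perturbed V β σ t₀ ξ (-δ) 0 (y + Y))
        = fun y => u t₀ (y + Y) - (V t₀ (y + (Y + ξ)) - δ) := by
      funext y
      rw [perturbed_zero, add_zero]
      have : y + Y + ξ = y + (Y + ξ) := by ring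
      rw [this]; ring
    rw [hinteq] at hgain
    have hnn : 0 ≤ ∫ y in (0 : ℝ)..1, (u t₀ (y + Y) - (V t₀ (y + (Y + ξ)) - δ)) :=
      le_trans (by positivity) hint
    set y := x - Y with hy
    have hxy : y + Y = x := by rw [hy]; ring
    have hbase : perturbed V β σ t₀ ξ (-δ) 1 x =
        V (t₀ + 1) (y + (Y + ξ) + (-(σ * δ * (1 - Real.exp (-β))))) - δ * Real.exp (-β) := by
      unfold perturbed
      rw [mul_one]
      have : x + (ξ + σ * -δ * (1 - Real.exp (-β)))
        = y + (Y + ξ) + (-(σ * δ * (1 - Real.exp (-β)))) := by rw [hy]; ring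
      rw [this]; ring
    have hcmp := hgain (max 1 |y|) (le_max_left _ _) y
      (abs_le.1 (le_max_right _ _))
    rw [hxy, hbase] at hcmp
    have hge0 : 0 ≤ η (max 1 |y|) * ∫ y in (0 : ℝ)..1,
        (u t₀ (y + Y) - (V t₀ (y + (Y + ξ)) - δ)) :=
      mul_nonneg (hη0 _ (le_max_left _ _)).le hnn
    have he : |-(σ * δ * (1 - Real.exp (-β)))| ≤ σ * δ₀ + 1 := by
      rw [abs_neg, abs_of_nonneg (mul_nonneg (by positivity) (by linarith))]
      have h1 : σ * δ ≤ σ * δ₀ := by gcongr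
      have h2 : 0 ≤ σ * δ := by positivity
      nlinarith
    have hfin := hshift t₀ ht₀ k hk0 hk1 (Y + ξ) _ hY he y
      (u (t₀ + 1) x - (V (t₀ + 1) (y + (Y + ξ) + (-(σ * δ * (1 - Real.exp (-β)))))
        - δ * Real.exp (-β)))
      (fun hyr => by
        have := hgain r hr1 y (abs_le.1 hyr)
        rw [hxy, hbase] at this
        refine le_trans ?_ this
        gcongr) (hge0.trans hcmp)
    have e3 : x + (ξ - σ * δ * (1 - Real.exp (-β)) + 2 * σ * (ε * k))
      = y + (Y + ξ) + (-(σ * δ * (1 - Real.exp (-β)))) + 2 * σ * (ε * k) := by rw [hy]; ring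
    rw [e3]
    linarith
  · intro hle hint x
    have hsup := (hP.isSupersolution t₀ ht₀ ξ δ 2 two_pos hδ0 hδ1).translate hS.trans Y
    have hsub := ((hu.shift (by linarith : 0 ≤ t₀)).translate hS.trans Y).isSubsolution
      (T := 2) two_pos
    have hpair : A.OrderedPair 2 (fun t x => perturbed V β σ t₀ ξ δ t (x + Y))
        (fun t x => u (t₀ + t) (x + Y)) := by
      refine ⟨hsup, hsub, fun t ht x => ⟨?_, ?_⟩, fun x => ?_⟩
      · have := hV.perturbed_mem (σ := σ) (ξ := ξ) (x := x + Y) hβ.le ht₀ (δ := δ)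
          (by rw [abs_of_nonneg hδ0]; exact hδ1.trans hP.size_le) ht.1
        exact ⟨by linarith [this.1], by linarith [this.2]⟩
      · have := hur (t₀ + t) (by linarith [ht.1]) (x + Y)
        exact ⟨by linarith [this.1], by linarith [this.2]⟩
      · have := hle (x + Y)
        simp only [perturbed_zero, add_zero]
        linarith
    have hgain := fun r (hr : 1 ≤ r) y hy => hη 2 one_lt_two _ _ hpair r hr y hy
    have hinteq : (fun y => perturbed V β σ t₀ ξ δ 0 (y + Y)
        - u (t₀ + 0) (y + Y))
        = fun y => V t₀ (y + (Y + ξ)) + δ - u t₀ (y + Y) := by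
      funext y
      rw [perturbed_zero, add_zero]
      have : y + Y + ξ = y + (Y + ξ) := by ring
      rw [this]
    rw [hinteq] at hgain
    have hnn : 0 ≤ ∫ y in (0 : ℝ)..1, (V t₀ (y + (Y + ξ)) + δ - u t₀ (y + Y)) :=
      le_trans (by positivity) hint
    set y := x - Y with hy
    have hxy : y + Y = x := by rw [hy]; ring
    have hbase : perturbed V β σ t₀ ξ δ 1 x =
        V (t₀ + 1) (y + (Y + ξ) + σ * δ * (1 - Real.exp (-β))) + δ * Real.exp (-β) := by
      unfold perturbed
      rw [mul_one]
      have : x + (ξ + σ * δ * (1 - Real.exp (-β)))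
        = y + (Y + ξ) + σ * δ * (1 - Real.exp (-β)) := by rw [hy]; ring
      rw [this]
    have hcmp := hgain (max 1 |y|) (le_max_left _ _) y
      (abs_le.1 (le_max_right _ _))
    rw [hxy, hbase] at hcmp
    have hge0 : 0 ≤ η (max 1 |y|) * ∫ y in (0 : ℝ)..1,
        (V t₀ (y + (Y + ξ)) + δ - u t₀ (y + Y)) :=
      mul_nonneg (hη0 _ (le_max_left _ _)).le hnn
    have hk2 : 2 * σ * (ε * k) ≤ 1 := by nlinarith
    have hk3 : 0 ≤ 2 * σ * (ε * k) := by positivity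
    have he : |σ * δ * (1 - Real.exp (-β)) - 2 * σ * (ε * k)| ≤ σ * δ₀ + 1 := by
      have h1 : σ * δ ≤ σ * δ₀ := by gcongr
      have h2 : 0 ≤ σ * δ := by positivity
      rw [abs_le]
      constructor <;> nlinarith
    have hfin := hshift t₀ ht₀ k hk0 hk1 (Y + ξ) _ hY he y
      (V (t₀ + 1) (y + (Y + ξ) + σ * δ * (1 - Real.exp (-β)))
        + δ * Real.exp (-β) - u (t₀ + 1) x)
      (fun hyr => by
        have := hgain r hr1 y (abs_le.1 hyr)
        rw [hxy, hbase] at this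
        refine le_trans ?_ this
        gcongr) (hge0.trans hcmp)
    have e3 : x + (ξ + σ * δ * (1 - Real.exp (-β)) - 2 * σ * (ε * k))
      = y + (Y + ξ) + (σ * δ * (1 - Real.exp (-β)) - 2 * σ * (ε * k)) := by rw [hy]; ring
    have e4 : y + (Y + ξ) + (σ * δ * (1 - Real.exp (-β)) - 2 * σ * (ε * k)) + 2 * σ * (ε * k)
      = y + (Y + ξ) + σ * δ * (1 - Real.exp (-β)) := by ring
    rw [e4] at hfin
    rw [e3]
    linarith

end NonlinOp

end

section

variable {X : Phase}

theorem intervalIntegrable_of_bounded {g : ℝ → ℝ} (hg : Measurable g) {M : ℝ}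
    (hM : ∀ x, |g x| ≤ M) (a b : ℝ) : IntervalIntegrable g volume a b :=
  (intervalIntegrable_const (c := M)).mono_fun' hg.aestronglyMeasurable
    (Eventually.of_forall fun x => by simpa [Real.norm_eq_abs] using hM x)

theorem le_intervalIntegral_of_le {g : ℝ → ℝ} {m : ℝ} (hg : IntervalIntegrable g volume 0 1)
    (h : ∀ y ∈ Icc (0 : ℝ) 1, m ≤ g y) : m ≤ ∫ y in (0 : ℝ)..1, g y := by
  have := intervalIntegral.integral_mono_on zero_le_one
    (intervalIntegrable_const (c := m)) hg h
  simpa using this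

namespace NonlinOp

variable {A : NonlinOp X} {T : ℝ} {u V : ℝ → ℝ → ℝ} {f z U : ℝ → ℝ} {c : ℝ} {β σ δ₀ Λ : ℝ}

/-- Waiting lets the vertical error decay exponentially, while the distance of the shifts increases
by at most `2 σ δ`. -/
theorem Sandwiched.wait (hP : A.PerturbationConstants V β σ δ₀) (hS : A.Standing f)
    (hΛ : A.ShiftLipschitz Λ) (hΛ0 : 0 ≤ Λ) (hV : A.IsFront V z) (hu : A.IsSolution u)
    {t₀ ξ h δ : ℝ} (ht₀ : 1 ≤ t₀) (hδ : 0 ≤ δ) (hδ' : δ ≤ δ₀) (hs : Sandwiched u V t₀ ξ h δ)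
    {t : ℝ} (ht : 0 ≤ t) :
    Sandwiched u V (t₀ + t) (ξ - σ * δ) (h + 2 * σ * δ) (δ * Real.exp (-(β * t))) := by
  intro x
  refine ⟨hP.lower hS hΛ hΛ0 hV hu ht₀ hδ hδ' (fun x => (hs x).1) ht x, ?_⟩
  have := hP.upper hS hΛ hΛ0 hV hu ht₀ hδ hδ' (fun x => (hs x).2) ht x
  have e : ξ - σ * δ + (h + 2 * σ * δ) = ξ + h + σ * δ := by ring
  rw [e]
  exact this

/-- One squeezing step. Either the lower or the upper front gains a shift proportional to
`min h 1`, according to which of the two is at a definite distance from the solution near the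
interface. -/
theorem IsFront.exists_squeeze (hV : A.IsFront V z) (hS : A.Standing f) (hη : A.ComparisonAtOne)
    (hΛ : A.ShiftLipschitz Λ) (hΛ0 : 0 ≤ Λ)
    (hP : A.PerturbationConstants V β σ δ₀) {H : ℝ} (hH : 0 ≤ H) :
    ∃ ε > 0, ε ≤ δ₀ / 2 ∧ 2 * σ * ε ≤ 1 ∧ ∀ u, A.IsSolution u →
      (∀ t ≥ 0, ∀ x, u t x ∈ Icc (0 : ℝ) 1) → ∀ t₀ ≥ 1, ∀ ξ h δ, 0 < h → h ≤ H → 0 ≤ δ →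
      δ ≤ δ₀ / 2 → Sandwiched u V t₀ ξ h δ → ∀ t ≥ 0, ∃ ξ',
        |ξ' - ξ| ≤ σ * δ + σ * (ε * min h 1) ∧
        Sandwiched u V (t₀ + 1 + t) ξ' (h + 2 * σ * δ - σ * (ε * min h 1))
          ((δ + ε * min h 1) * Real.exp (-(β * t))) := by
  obtain ⟨m, hm, hsteep⟩ := hV.steep 2
  obtain ⟨ε, hε, hε1, hε2, hgain⟩ := hV.exists_gain hS hη hP (half_pos hm) hH
  refine ⟨ε, hε, hε1, hε2, fun u hu hur t₀ ht₀ ξ h δ hh hhH hδ hδ' hs t ht => ?_⟩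
  set k := min h 1 with hk
  have hk0 : 0 < k := lt_min hh one_pos
  have hk1 : k ≤ 1 := min_le_right _ _
  have hkh : k ≤ h := min_le_left _ _
  have hδ₀ := hP.size_pos
  have hσ := hP.drift_pos
  have hδ0' : δ ≤ δ₀ := by linarith
  have ht₀' : (0 : ℝ) < t₀ := by linarith
  obtain ⟨hE0, hE1⟩ := exp_neg_mul_mem hP.rate_pos (zero_le_one' ℝ)
  rw [mul_one] at hE0 hE1
  obtain ⟨hF0, hF1⟩ := exp_neg_mul_mem hP.rate_pos ht
  have hEF : Real.exp (-(β * (1 + t))) ≤ Real.exp (-(β * t)) :=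
    Real.exp_le_exp.2 (by nlinarith [hP.rate_pos])
  have hεk : 0 < ε * k := by positivity
  set δ₁ := δ * Real.exp (-β) + ε * k with hδ₁
  have hδ₁0 : 0 ≤ δ₁ := by positivity
  have hδ₁1 : δ₁ ≤ δ + ε * k := by nlinarith
  have hδ₁2 : δ₁ ≤ δ₀ := by nlinarith
  -- the two fronts differ by at least `m k` near the interface
  have hdiff : ∀ y ∈ Icc (0 : ℝ) 1, m * k ≤ V t₀ (y + z t₀ + h) - V t₀ (y + z t₀) := by
    intro y hy
    have h1 := le_sub_of_le_deriv (hV.diff t₀ ht₀') (a := y + z t₀) (b := y + z t₀ + k) (C := m)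
      (by linarith) (fun x hx => hsteep t₀ ht₀ x
        (abs_le.2 ⟨by linarith [hx.1, hy.1], by linarith [hx.2, hy.2]⟩))
    rw [add_sub_cancel_left] at h1
    have h2 := (hV.strictMono ht₀).monotone (by linarith : y + z t₀ + k ≤ y + z t₀ + h)
    linarith
  have hVm : ∀ s, Measurable fun y => V t₀ (y + s) := fun s =>
    ((hV.diff t₀ ht₀').continuous.comp (continuous_add_const s)).measurable
  have hVi : ∀ s, IntervalIntegrable (fun y => V t₀ (y + s)) volume 0 1 := fun s =>
    intervalIntegrable_of_bounded (hVm s) (M := 1) (fun y => abs_le.2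
      ⟨by linarith [(hV.mem t₀ ht₀' (y + s)).1], (hV.mem t₀ ht₀' (y + s)).2⟩) 0 1
  have hui : IntervalIntegrable (fun y => u t₀ (y + (z t₀ - ξ))) volume 0 1 := by
    refine intervalIntegrable_of_bounded ?_ (M := 1) (fun y => abs_le.2
      ⟨by linarith [(hur t₀ ht₀'.le (y + (z t₀ - ξ))).1], (hur t₀ ht₀'.le _).2⟩) 0 1
    exact (Phase.measurable_of_mem (hu.mem_space ht₀'.le)).comp (measurable_add_const _)
  have hY1 : z t₀ - ξ + ξ = z t₀ := by ring
  have hY2 : z t₀ - ξ + (ξ + h) = z t₀ + h := by ring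
  -- hence one of the average distances to the solution is at least half of that
  have hcase : m / 2 * k ≤ ∫ y in (0 : ℝ)..1, (u t₀ (y + (z t₀ - ξ)) -
        (V t₀ (y + (z t₀ - ξ + ξ)) - δ)) ∨
      m / 2 * k ≤ ∫ y in (0 : ℝ)..1, (V t₀ (y + (z t₀ - ξ + (ξ + h))) + δ
        - u t₀ (y + (z t₀ - ξ))) := by
    by_contra hcon
    push Not at hcon
    have hsum := intervalIntegral.integral_add (a := 0) (b := 1) (μ := volume)
      (hui.sub ((hVi (z t₀ - ξ + ξ)).sub (intervalIntegrable_const (c := δ))))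
      (((hVi (z t₀ - ξ + (ξ + h))).add (intervalIntegrable_const (c := δ))).sub hui)
    have hge : m * k ≤ ∫ y in (0 : ℝ)..1, ((u t₀ (y + (z t₀ - ξ)) -
        (V t₀ (y + (z t₀ - ξ + ξ)) - δ)) + (V t₀ (y + (z t₀ - ξ + (ξ + h))) + δ
        - u t₀ (y + (z t₀ - ξ)))) := by
      refine le_intervalIntegral_of_le ?_ ?_
      · exact (hui.sub ((hVi (z t₀ - ξ + ξ)).sub (intervalIntegrable_const (c := δ)))).add
          (((hVi (z t₀ - ξ + (ξ + h))).add (intervalIntegrable_const (c := δ))).sub hui)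
      · intro y hy
        have := hdiff y hy
        rw [hY1, hY2, ← add_assoc]
        linarith
    linarith [hcon.1, hcon.2]
  rcases hcase with hc | hc
  · have hlow := (hgain u hu hur t₀ ht₀ (z t₀ - ξ) ξ δ k (by rw [hY1]; simpa using hH) hδ hδ0'
      hk0.le hk1).1 (fun x => (hs x).1) hc
    refine ⟨ξ - σ * δ + σ * (ε * k), ?_, fun x => ⟨?_, ?_⟩⟩
    · rw [abs_le]
      have : 0 ≤ σ * δ := by positivity
      have : 0 ≤ σ * (ε * k) := by positivity
      constructor <;> linarith
    · have h1 := hP.lower hS hΛ hΛ0 hV hu (t₀ := t₀ + 1) (by linarith) hδ₁0 hδ₁2 hlow ht x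
      have e : ξ - σ * δ * (1 - Real.exp (-β)) + 2 * σ * (ε * k) - σ * δ₁
          = ξ - σ * δ + σ * (ε * k) := by rw [hδ₁]; ring
      rw [e] at h1
      have : δ₁ * Real.exp (-(β * t)) ≤ (δ + ε * k) * Real.exp (-(β * t)) := by gcongr
      linarith
    · have h1 := hP.upper hS hΛ hΛ0 hV hu ht₀ hδ hδ0' (fun x => (hs x).2)
        (by linarith : 0 ≤ 1 + t) x
      have e : ξ - σ * δ + σ * (ε * k) + (h + 2 * σ * δ - σ * (ε * k)) = ξ + h + σ * δ := by ring
      rw [e]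
      rw [← add_assoc] at h1
      have : δ * Real.exp (-(β * (1 + t))) ≤ (δ + ε * k) * Real.exp (-(β * t)) := by
        gcongr; linarith
      linarith
  · have hupp := (hgain u hu hur t₀ ht₀ (z t₀ - ξ) (ξ + h) δ k (by
      rw [hY2, add_sub_cancel_left, abs_of_pos hh]; exact hhH) hδ hδ0' hk0.le hk1).2
      (fun x => (hs x).2) hc
    refine ⟨ξ - σ * δ, ?_, fun x => ⟨?_, ?_⟩⟩
    · rw [abs_le]
      have : 0 ≤ σ * δ := by positivity
      have : 0 ≤ σ * (ε * k) := by positivity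
      constructor <;> linarith
    · have h1 := hP.lower hS hΛ hΛ0 hV hu ht₀ hδ hδ0' (fun x => (hs x).1)
        (by linarith : 0 ≤ 1 + t) x
      rw [← add_assoc] at h1
      have : δ * Real.exp (-(β * (1 + t))) ≤ (δ + ε * k) * Real.exp (-(β * t)) := by
        gcongr; linarith
      linarith
    · have h1 := hP.upper hS hΛ hΛ0 hV hu (t₀ := t₀ + 1) (by linarith) hδ₁0 hδ₁2 hupp ht x
      have e : ξ + h + σ * δ * (1 - Real.exp (-β)) - 2 * σ * (ε * k) + σ * δ₁
          = ξ - σ * δ + (h + 2 * σ * δ - σ * (ε * k)) := by rw [hδ₁]; ring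
      rw [e] at h1
      have : δ₁ * Real.exp (-(β * t)) ≤ (δ + ε * k) * Real.exp (-(β * t)) := by gcongr
      linarith

/-- Waiting long enough between squeezing steps keeps the vertical error proportional to
`min h 1`, so that the steps can be iterated. -/
theorem IsFront.exists_contraction (hV : A.IsFront V z) (hS : A.Standing f)
    (hη : A.ComparisonAtOne) (hΛ : A.ShiftLipschitz Λ) (hΛ0 : 0 ≤ Λ)
    (hP : A.PerturbationConstants V β σ δ₀) {H : ℝ} (hH : 0 ≤ H) :
    ∃ ε > 0, ε ≤ δ₀ / 2 ∧ 2 * σ * ε ≤ 1 ∧ ∃ τ > 0, ∀ u, A.IsSolution u →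
      (∀ t ≥ 0, ∀ x, u t x ∈ Icc (0 : ℝ) 1) → ∀ t₀ ≥ 1, ∀ ξ h, 0 < h → h ≤ H →
      Sandwiched u V t₀ ξ h (ε / 4 * min h 1) → ∃ ξ', |ξ' - ξ| ≤ 2 * σ * ε * min h 1 ∧
        Sandwiched u V (t₀ + τ) ξ' (h - σ * ε / 2 * min h 1)
          (ε / 4 * min (h - σ * ε / 2 * min h 1) 1) := by
  obtain ⟨ε, hε, hε1, hε2, hsq⟩ := hV.exists_squeeze hS hη hΛ hΛ0 hP hH
  have hσ := hP.drift_pos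
  -- the vertical error `5 ε k / 4`, with `k = min h 1`, has to drop below `ε / 4` times the new
  -- value of `k`, which is at least `3 k / 4`
  obtain ⟨s, hs0, hs⟩ : ∃ s ≥ 0, Real.exp (-(β * s)) ≤ 1 / 10 := by
    have h1 := tendsto_mul_exp_neg hP.rate_pos 1
    obtain ⟨s, hs⟩ := ((h1.eventually (ge_mem_nhds (by norm_num : (0 : ℝ) < 1 / 10))).and
      (eventually_ge_atTop 0)).exists
    exact ⟨s, hs.2, by simpa using hs.1⟩
  refine ⟨ε, hε, hε1, hε2, 1 + s, by linarith, fun u hu hur t₀ ht₀ ξ h hh hhH hsw => ?_⟩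
  have hk0 : 0 < min h 1 := lt_min hh one_pos
  set k := min h 1 with hk
  have hk1 : k ≤ 1 := min_le_right _ _
  have hkh : k ≤ h := min_le_left _ _
  have hσε : 0 < σ * ε := by positivity
  have hεk : 0 < ε * k := by positivity
  obtain ⟨ξ', h1, h2⟩ := hsq u hu hur t₀ ht₀ ξ h (ε / 4 * k) hh hhH (by positivity)
    (by nlinarith) hsw s hs0
  refine ⟨ξ', h1.trans ?_, ?_⟩
  · nlinarith
  · rw [← add_assoc]
    refine h2.mono hV (by linarith) (le_of_eq (by ring)) ?_
    have h3 : 3 / 4 * k ≤ min (h - σ * ε / 2 * k) 1 := by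
      apply le_min <;> nlinarith
    have h4 : (ε / 4 * k + ε * k) * Real.exp (-(β * s)) ≤ (ε / 4 * k + ε * k) * (1 / 10) := by
      gcongr
    nlinarith

theorem IsFront.abs_sub_le (hV : A.IsFront V z) :
    ∃ M > 0, ∀ t ≥ 1, ∀ a b, |V t a - V t b| ≤ M * |a - b| := by
  obtain ⟨M, hM⟩ := hV.bdd
  have hM0 : 0 < M := (hV.deriv_pos le_rfl 0).trans_le (hM 1 le_rfl 0)
  refine ⟨M, hM0, fun t ht a b => ?_⟩
  wlog hab : b ≤ a generalizing a b
  · rw [abs_sub_comm, abs_sub_comm a]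
    exact this b a (le_of_not_ge hab)
  have h1 := sub_le_of_deriv_le (hV.diff t (by linarith)) hab (fun x _ => hM t ht x)
  have h2 := (hV.strictMono ht).monotone hab
  rw [abs_of_nonneg (by linarith), abs_of_nonneg (by linarith)]
  exact h1

/-- Squeezing until the two shifts differ by at most `1`. -/
theorem exists_sandwiched_one {ε τ H : ℝ} (hV : A.IsFront V z) (hε : 0 < ε) (hσ : 0 < σ)
    (hσε : 2 * σ * ε ≤ 1) (hτ : 0 < τ)
    (hstep : ∀ t₀ ≥ 1, ∀ ξ h, 0 < h → h ≤ H →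
      Sandwiched u V t₀ ξ h (ε / 4 * min h 1) → ∃ ξ', |ξ' - ξ| ≤ 2 * σ * ε * min h 1 ∧
        Sandwiched u V (t₀ + τ) ξ' (h - σ * ε / 2 * min h 1)
          (ε / 4 * min (h - σ * ε / 2 * min h 1) 1)) (n : ℕ) :
    ∀ t₀ ≥ 1, ∀ ξ h, 0 < h → h ≤ H → h ≤ 1 + n * (σ * ε / 2) →
      Sandwiched u V t₀ ξ h (ε / 4 * min h 1) → ∃ t₁ ≥ 1, ∃ ξ', Sandwiched u V t₁ ξ' 1 (ε / 4) := by
  have hσε0 : 0 < σ * ε := by positivity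
  have base : ∀ t₀ ≥ 1, ∀ ξ h, h ≤ 1 → Sandwiched u V t₀ ξ h (ε / 4 * min h 1) →
      ∃ t₁ ≥ 1, ∃ ξ', Sandwiched u V t₁ ξ' 1 (ε / 4) := by
    intro t₀ ht₀ ξ h hh hs
    refine ⟨t₀, ht₀, ξ, hs.mono hV ht₀ hh ?_⟩
    have := min_le_right h 1
    nlinarith
  induction n with
  | zero =>
    intro t₀ ht₀ ξ h hh _ hh1 hs
    exact base t₀ ht₀ ξ h (by simpa using hh1) hs
  | succ n ih =>
    intro t₀ ht₀ ξ h hh hhH hh1 hs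
    rcases le_total h 1 with h1 | h1
    · exact base t₀ ht₀ ξ h h1 hs
    · obtain ⟨ξ', -, hs'⟩ := hstep t₀ ht₀ ξ h hh hhH hs
      have e : min h 1 = 1 := min_eq_right h1
      rw [e, mul_one] at hs'
      push_cast at hh1
      exact ih (t₀ + τ) (by linarith) ξ' _ (by nlinarith) (by linarith) (by linarith) hs'

/-- Exponential convergence to a shift of the front, at a rate depending only on the front, of all
solutions that are at some time roughly between two shifts of the front. -/
theorem IsFront.exists_rate (hV : A.IsFront V z) (hS : A.Standing f) (hE : A.DerivBounded)
    (hη : A.ComparisonAtOne) : ∃ δ₁ > 0, ∃ κ > 0, ∀ u, A.IsSolution u →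
      (∀ t ≥ 0, ∀ x, u t x ∈ Icc (0 : ℝ) 1) →
      (∃ t₀ ≥ 1, ∃ ξ h, Sandwiched u V t₀ ξ h δ₁) →
      ∃ ξ K, ∀ t ≥ 1, ∀ x, |u t x - V t (x + ξ)| ≤ K * Real.exp (-κ * t) := by
  obtain ⟨Λ, hΛ0, hΛ⟩ := hS.exists_shiftLipschitz hE
  obtain ⟨β, σ, δ₀, hP⟩ := hV.exists_perturbationConstants hS hE
  have hσ := hP.drift_pos
  have hβ := hP.rate_pos
  have hδ₀ := hP.size_pos
  obtain ⟨ε, hε, hε1, hε2, τ, hτ, hstep⟩ := hV.exists_contraction hS hη hΛ hΛ0 hP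
    (zero_le_two (α := ℝ))
  obtain ⟨M, hM, hLip⟩ := hV.abs_sub_le
  have hσε : 0 < σ * ε := by positivity
  set r := 1 - σ * ε / 2 with hr
  have hr0 : 0 < r := by rw [hr]; linarith
  have hr1 : r < 1 := by rw [hr]; linarith
  set κ := -Real.log r / τ with hκ
  have hκ0 : 0 < κ := div_pos (by linarith [Real.log_neg hr0 hr1]) hτ
  refine ⟨δ₀, hδ₀, κ, hκ0, fun u hu hur ⟨t₀, ht₀, ξ₀, h₀, hs₀⟩ => ?_⟩
  -- the vertical error can be made arbitrarily small by waiting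
  have shrink : ∀ t₀ ≥ 1, ∀ ξ h δ, 0 ≤ δ → δ ≤ δ₀ → Sandwiched u V t₀ ξ h δ → ∀ ρ > 0,
      ∃ t₁ ≥ 1, ∃ ξ', Sandwiched u V t₁ ξ' (h + 2 * σ * δ) ρ := by
    intro t₀ ht₀ ξ h δ hδ hδ' hs ρ hρ
    obtain ⟨t, ht⟩ := (((tendsto_mul_exp_neg hβ δ).eventually (ge_mem_nhds hρ)).and
      (eventually_ge_atTop 0)).exists
    exact ⟨t₀ + t, by linarith [ht.2], _,
      (hs.wait hP hS hΛ hΛ0 hV hu ht₀ hδ hδ' ht.2).mono hV (by linarith [ht.2]) le_rfl ht.1⟩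
  -- The squeezing constants depend on an upper bound of the distance `h` of the two shifts. They
  -- are first used for the initial distance, which depends on `u`, and then for distances up to
  -- `2`, so that the rate does not depend on `u`.
  obtain ⟨t₂, ht₂, ξ₂, hs₂⟩ : ∃ t ≥ 1, ∃ ξ, Sandwiched u V t ξ 1 (ε / 4) := by
    set H := max 1 (h₀ + 2 * σ * δ₀) with hH
    have hH1 : 1 ≤ H := le_max_left _ _
    obtain ⟨ε', hε', hε'1, hε'2, τ', hτ', hstep'⟩ := hV.exists_contraction hS hη hΛ hΛ0 hP
      (by linarith : 0 ≤ H)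
    obtain ⟨t₁, ht₁, ξ₁, hs₁⟩ := shrink t₀ ht₀ ξ₀ h₀ δ₀ hδ₀.le le_rfl hs₀ (ε' / 4) (by positivity)
    have hs₁' := hs₁.mono hV ht₁ (le_max_right 1 _ : _ ≤ H) (le_of_eq (by
      rw [min_eq_right hH1, mul_one]) : ε' / 4 ≤ ε' / 4 * min H 1)
    have hσε' : 0 < σ * ε' / 2 := by positivity
    obtain ⟨n, hn⟩ := exists_nat_ge ((H - 1) / (σ * ε' / 2))
    rw [div_le_iff₀ hσε'] at hn
    obtain ⟨t₂, ht₂, ξ₂, hs₂⟩ := exists_sandwiched_one hV hε' hσ hε'2 hτ' (hstep' u hu hur) n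
      t₁ ht₁ ξ₁ H (by linarith) le_rfl (by linarith) hs₁'
    obtain ⟨t₃, ht₃, ξ₃, hs₃⟩ := shrink t₂ ht₂ ξ₂ 1 (ε' / 4) (by positivity) (by linarith) hs₂
      (ε / 4) (by positivity)
    have hs₃' := hs₃.mono hV ht₃ (by linarith : 1 + 2 * σ * (ε' / 4) ≤ 2) (le_of_eq (by
      rw [min_eq_right one_le_two, mul_one]) : ε / 4 ≤ ε / 4 * min 2 1)
    have hσε2 : 0 < σ * ε / 2 := by positivity
    obtain ⟨n, hn⟩ := exists_nat_ge (1 / (σ * ε / 2))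
    rw [div_le_iff₀ hσε2] at hn
    exact exists_sandwiched_one hV hε hσ hε2 hτ (hstep u hu hur) n
      t₃ ht₃ ξ₃ 2 two_pos le_rfl (by linarith) hs₃'
  -- geometric decay of both errors
  have hrn : ∀ n : ℕ, 0 < r ^ n ∧ r ^ n ≤ 1 := fun n =>
    ⟨pow_pos hr0 n, pow_le_one₀ hr0.le hr1.le⟩
  have hnext : ∀ (n : ℕ) (ξ : ℝ), Sandwiched u V (t₂ + n * τ) ξ (r ^ n) (ε / 4 * r ^ n) →
      ∃ ξ', Sandwiched u V (t₂ + (n + 1 : ℕ) * τ) ξ' (r ^ (n + 1)) (ε / 4 * r ^ (n + 1)) ∧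
        |ξ' - ξ| ≤ 2 * σ * ε * r ^ n := by
    intro n ξ hs
    have hmin : min (r ^ n) 1 = r ^ n := min_eq_left (hrn n).2
    have hmin' : min (r ^ (n + 1)) 1 = r ^ (n + 1) := min_eq_left (hrn (n + 1)).2
    have e : r ^ n - σ * ε / 2 * r ^ n = r ^ (n + 1) := by rw [pow_succ, hr]; ring
    obtain ⟨ξ', h1, h2⟩ := hstep u hu hur (t₂ + n * τ)
      (by have : 0 ≤ n * τ := by positivity
          linarith) ξ (r ^ n) (hrn n).1
      ((hrn n).2.trans one_le_two) (by rw [hmin]; exact hs)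
    rw [hmin, e, hmin'] at h2
    rw [hmin] at h1
    refine ⟨ξ', ?_, h1⟩
    have e2 : t₂ + ((n + 1 : ℕ) : ℝ) * τ = t₂ + n * τ + τ := by push_cast; ring
    rw [e2]
    exact h2
  choose! g hg1 hg2 using hnext
  let ξs : ℕ → ℝ := fun n => Nat.rec ξ₂ (fun n ξ => g n ξ) n
  have hξs : ∀ n : ℕ, Sandwiched u V (t₂ + n * τ) (ξs n) (r ^ n) (ε / 4 * r ^ n) := by
    intro n
    induction n with
    | zero => simpa [ξs] using hs₂
    | succ n ih => exact hg1 n _ ih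
  have hdist : ∀ n, dist (ξs n) (ξs (n + 1)) ≤ 2 * σ * ε * r ^ n := by
    intro n
    rw [dist_comm, Real.dist_eq]
    exact hg2 n _ (hξs n)
  obtain ⟨ξ, hξ⟩ := cauchySeq_tendsto_of_complete (cauchySeq_of_le_geometric r _ hr1 hdist)
  have hξn : ∀ n, |ξs n - ξ| ≤ 4 * r ^ n := by
    intro n
    have := dist_le_of_le_geometric_of_tendsto r _ hr1 hdist hξ n
    rw [Real.dist_eq] at this
    refine this.trans (le_of_eq ?_)
    have e : 1 - r = σ * ε / 2 := by rw [hr]; ring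
    rw [e]
    field_simp
    ring
  set K := max 1 (ε + M * (4 + 1 + σ * ε)) with hK
  have hK1 : 1 ≤ K := le_max_left _ _
  refine ⟨ξ, K * Real.exp (κ * (t₂ + τ)), fun t ht x => ?_⟩
  rw [mul_assoc, ← Real.exp_add]
  rcases lt_or_ge t t₂ with htt | htt
  · have h1 : |u t x - V t (x + ξ)| ≤ 1 := by
      have h2 := hur t (by linarith) x
      have h3 := hV.mem t (by linarith) (x + ξ)
      exact abs_le.2 ⟨by linarith [h2.1, h3.2], by linarith [h2.2, h3.1]⟩
    have h4 : 1 ≤ Real.exp (κ * (t₂ + τ) + -κ * t) := Real.one_le_exp (by nlinarith)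
    nlinarith
  · set n := ⌊(t - t₂) / τ⌋₊ with hn
    have hn1 : n * τ ≤ t - t₂ := by
      have := Nat.floor_le (div_nonneg (by linarith : 0 ≤ t - t₂) hτ.le)
      rwa [le_div_iff₀ hτ] at this
    have hn2 : t - t₂ < (n + 1) * τ := by
      have := Nat.lt_floor_add_one ((t - t₂) / τ)
      rwa [div_lt_iff₀ hτ] at this
    have hnτ : 0 ≤ n * τ := by positivity
    obtain ⟨hrn0, hrn1⟩ := hrn n
    have hpow : r ^ n ≤ Real.exp (κ * (t₂ + τ) + -κ * t) := by
      have e1 : r ^ n = Real.exp (-(κ * (n * τ))) := by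
        have : -(κ * (n * τ)) = n * Real.log r := by rw [hκ]; field_simp
        rw [this, Real.exp_nat_mul, Real.exp_log hr0]
      rw [e1]
      exact Real.exp_le_exp.2 (by nlinarith)
    have hw := (hξs n).wait hP hS hΛ hΛ0 hV hu (by linarith) (by positivity) (by nlinarith)
      (t := t - (t₂ + n * τ)) (by linarith)
    rw [add_sub_cancel] at hw
    obtain ⟨he0, he1⟩ := exp_neg_mul_mem hβ (by linarith : 0 ≤ t - (t₂ + n * τ))
    set δn := ε / 4 * r ^ n with hδn
    have hδn0 : 0 ≤ δn := by positivity
    have hδe : δn * Real.exp (-(β * (t - (t₂ + n * τ)))) ≤ δn := mul_le_of_le_one_right hδn0 he1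
    obtain ⟨hw1, hw2⟩ := hw x
    have hξ' := abs_le.1 (hξn n)
    have hσδ : 0 ≤ σ * δn := by positivity
    have hσδ' : 2 * (σ * δn) ≤ σ * ε * r ^ n := by
      rw [hδn]
      have : 0 ≤ σ * ε * r ^ n := by positivity
      linarith
    have hL1 := hLip t ht (x + (ξs n - σ * δn)) (x + ξ)
    have hL2 := hLip t ht (x + (ξs n - σ * δn + (r ^ n + 2 * σ * δn))) (x + ξ)
    have hb : (4 + 1 + σ * ε) * r ^ n = 4 * r ^ n + r ^ n + σ * ε * r ^ n := by ring
    have ha1 : |x + (ξs n - σ * δn) - (x + ξ)| ≤ (4 + 1 + σ * ε) * r ^ n := by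
      rw [hb]
      have e : x + (ξs n - σ * δn) - (x + ξ) = (ξs n - ξ) - σ * δn := by ring
      rw [e, abs_le]
      constructor <;> linarith
    have ha2 : |x + (ξs n - σ * δn + (r ^ n + 2 * σ * δn)) - (x + ξ)|
        ≤ (4 + 1 + σ * ε) * r ^ n := by
      rw [hb]
      have e : x + (ξs n - σ * δn + (r ^ n + 2 * σ * δn)) - (x + ξ)
        = (ξs n - ξ) + r ^ n + σ * δn := by ring
      rw [e, abs_le]
      constructor <;> linarith
    have hL1' := abs_le.1 (hL1.trans (mul_le_mul_of_nonneg_left ha1 hM.le))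
    have hL2' := abs_le.1 (hL2.trans (mul_le_mul_of_nonneg_left ha2 hM.le))
    have hδnr : δn ≤ ε * r ^ n := by
      rw [hδn]
      have : 0 ≤ ε * r ^ n := by positivity
      linarith
    have hfin : |u t x - V t (x + ξ)| ≤ (ε + M * (4 + 1 + σ * ε)) * r ^ n := by
      have e : (ε + M * (4 + 1 + σ * ε)) * r ^ n
        = ε * r ^ n + M * ((4 + 1 + σ * ε) * r ^ n) := by ring
      rw [e, abs_le]
      constructor <;> linarith [hL1'.1, hL2'.2]
    refine hfin.trans ?_
    exact mul_le_mul (le_max_right _ _) hpow hrn0.le (by linarith)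

end NonlinOp

end

section

variable {X : Phase}

/-! ### Smooth functions that are constant near infinity -/

theorem isCkb_of_eventually_const {g : ℝ → ℝ} (hg : ContDiff ℝ (⊤ : ℕ∞) g) {R a b : ℝ}
    (ha : ∀ x, R < x → g x = a) (hb : ∀ x, x < -R → g x = b) (n : ℕ) : IsCkb n g := by
  have hd : ∀ x, R < |x| → deriv g x = 0 := by
    intro x hx
    rcases lt_abs.1 hx with h | h
    · have : g =ᶠ[𝓝 x] fun _ => a := by
        filter_upwards [lt_mem_nhds h] with y hy using ha y hy
      rw [this.deriv_eq]; simp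
    · have : g =ᶠ[𝓝 x] fun _ => b := by
        filter_upwards [gt_mem_nhds (by linarith : x < -R)] with y hy using hb y hy
      rw [this.deriv_eq]; simp
  have hc : HasCompactSupport (deriv g) := by
    refine HasCompactSupport.of_support_subset_isCompact (isCompact_Icc (a := -R) (b := R))
      fun x hx => ?_
    rw [mem_Icc, ← abs_le]
    by_contra hcon
    exact hx (hd x (not_le.1 hcon))
  have hbd : ∀ k : ℕ, ∃ M, ∀ x, |iteratedDeriv k g x| ≤ M := by
    intro k
    cases k with
    | zero =>
      obtain ⟨M, hM⟩ := (isCompact_Icc (a := -R) (b := R)).exists_bound_of_continuousOn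
        hg.continuous.continuousOn
      refine ⟨max M (max |a| |b|), fun x => ?_⟩
      rw [iteratedDeriv_zero]
      rcases lt_or_ge R x with h | h
      · rw [ha x h]; exact (le_max_left _ _).trans (le_max_right _ _)
      · rcases lt_or_ge x (-R) with h' | h'
        · rw [hb x h']; exact (le_max_right _ _).trans (le_max_right _ _)
        · exact (hM x ⟨h', h⟩).trans (le_max_left _ _)
    | succ k =>
      have hk : Continuous (iteratedDeriv k (deriv g)) := by
        rw [← iteratedDeriv_succ']
        exact hg.continuous_iteratedDeriv (k + 1) (by exact_mod_cast le_top)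
      have hs : HasCompactSupport (iteratedDeriv k (deriv g)) := by
        rw [iteratedDeriv_eq_equiv_comp]
        exact (hc.iteratedFDeriv k).comp_left (by simp)
      obtain ⟨M, hM⟩ := hs.exists_bound_of_continuous hk
      exact ⟨M, fun x => by rw [iteratedDeriv_succ']; exact hM x⟩
  choose M hM using hbd
  refine ⟨∑ k ∈ Finset.range (n + 1), |M k|, hg.of_le (by exact_mod_cast le_top), fun k hk x => ?_⟩
  calc |iteratedDeriv k g x| ≤ M k := hM k x
    _ ≤ |M k| := le_abs_self _
    _ ≤ _ := Finset.single_le_sum (f := fun k => |M k|) (fun i _ => abs_nonneg _)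
      (Finset.mem_range.2 (by omega))

/-- A slowly varying barrier: it vanishes at the origin, equals `1` far away, and is almost
invariant under averaging against `ν`. -/
theorem exists_barrier (ν : Measure ℝ) [IsProbabilityMeasure ν] {a : ℝ} (ha : 0 < a) :
    ∃ R > 0, ∃ φ : ℝ → ℝ, (∀ n, IsCkb n φ) ∧ (∀ x, φ x ∈ Icc (0 : ℝ) 1) ∧ φ 0 = 0 ∧
      (∀ x, R ≤ |x| → φ x = 1) ∧ (∀ x, |deriv φ x| ≤ a) ∧ (∀ x, |deriv (deriv φ) x| ≤ a) ∧
      ∀ x, ∫ y, φ (x - y) ∂ν ≤ φ x + a := by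
  obtain ⟨K, hK, hKν⟩ := isTightMeasureSet_iff_exists_isCompact_measure_compl_le.1
    (isTightMeasureSet_singleton (μ := ν)) (ENNReal.ofReal (a / 2)) (by simpa using ha)
  have hKν := hKν ν rfl
  obtain ⟨R₁, hR₁⟩ := hK.isBounded.exists_norm_le
  set B : ℝ → ℝ := fun x => Real.smoothTransition (x ^ 2) with hB
  have hBs : ContDiff ℝ (⊤ : ℕ∞) B := Real.smoothTransition.contDiff.comp (contDiff_id.pow 2)
  have hB1 : ∀ x, 1 ≤ |x| → B x = 1 := fun x hx => Real.smoothTransition.one_of_one_le (by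
    rw [← sq_abs]; nlinarith)
  obtain ⟨C, -, hC⟩ := isCkb_of_eventually_const hBs (R := 1) (a := 1) (b := 1)
    (fun x hx => hB1 x (hx.le.trans (le_abs_self x)))
    (fun x hx => hB1 x (by have := neg_abs_le x; linarith)) 2
  have hC1 : ∀ x, |deriv B x| ≤ C := fun x => by
    simpa [iteratedDeriv_one] using hC 1 (by norm_num) x
  have hC2 : ∀ x, |deriv (deriv B) x| ≤ C := fun x => by
    have := hC 2 le_rfl x
    rwa [iteratedDeriv_succ, iteratedDeriv_one] at this
  have hC0 : 0 ≤ C := (abs_nonneg _).trans (hC1 0)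
  set b := min a (a / (2 * (|R₁| + 1))) with hb
  have hb0 : 0 < b := by positivity
  have hbR : b * |R₁| ≤ a / 2 := by
    have : b ≤ a / (2 * (|R₁| + 1)) := min_le_right _ _
    rw [le_div_iff₀ (by positivity)] at this
    nlinarith [abs_nonneg R₁]
  set ε := min 1 (b / (C + 1)) with hε
  have hε0 : 0 < ε := by positivity
  have hε1 : ε ≤ 1 := min_le_left _ _
  have hεC : ε * C ≤ b := by
    have : ε ≤ b / (C + 1) := min_le_right _ _
    rw [le_div_iff₀ (by positivity)] at this
    nlinarith
  set φ : ℝ → ℝ := fun x => B (ε * x) with hφ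
  have hdB : Differentiable ℝ B := hBs.differentiable (by simp)
  have hddB : Differentiable ℝ (deriv B) := by
    have h2 : ContDiff ℝ 2 B := by exact_mod_cast contDiff_infty.1 hBs 2
    exact h2.differentiable_deriv_two
  have hd1 : deriv φ = fun x => ε * deriv B (ε * x) := by
    funext x
    have := (hdB (ε * x)).hasDerivAt.comp x ((hasDerivAt_id x).const_mul ε)
    have := this.deriv
    simp only [mul_one] at this
    rw [mul_comm]
    exact this
  have hd2 : deriv (deriv φ) = fun x => ε * (ε * deriv (deriv B) (ε * x)) := by
    funext x
    rw [hd1]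
    have := ((hddB (ε * x)).hasDerivAt.comp x ((hasDerivAt_id x).const_mul ε)).const_mul ε
    have := this.deriv
    simp only [mul_one] at this
    rw [mul_comm ε (deriv (deriv B) _)]
    exact this
  have hφs : ContDiff ℝ (⊤ : ℕ∞) φ := hBs.comp (contDiff_const.mul contDiff_id)
  have hφd : Differentiable ℝ φ := hφs.differentiable (by simp)
  have hφr : ∀ x, φ x ∈ Icc (0 : ℝ) 1 := fun x =>
    ⟨Real.smoothTransition.nonneg _, Real.smoothTransition.le_one _⟩
  have hφ1 : ∀ x, 1 / ε ≤ |x| → φ x = 1 := by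
    intro x hx
    refine hB1 _ ?_
    rw [abs_mul, abs_of_pos hε0]
    rwa [div_le_iff₀ hε0, mul_comm] at hx
  have hφb : ∀ x, |deriv φ x| ≤ b := by
    intro x
    rw [hd1]
    simp only
    rw [abs_mul, abs_of_pos hε0]
    exact (mul_le_mul_of_nonneg_left (hC1 _) hε0.le).trans hεC
  refine ⟨1 / ε, by positivity, φ, isCkb_of_eventually_const hφs (R := 1 / ε) (a := 1) (b := 1)
    (fun x hx => hφ1 x (hx.le.trans (le_abs_self x)))
    (fun x hx => hφ1 x (by have := neg_abs_le x; linarith)), hφr, ?_, hφ1,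
    fun x => (hφb x).trans (min_le_left _ _), fun x => ?_, fun x => ?_⟩
  · simp [hφ, hB]
  · rw [hd2]
    simp only
    rw [abs_mul, abs_mul, abs_of_pos hε0]
    have h1 : ε * |deriv (deriv B) (ε * x)| ≤ b :=
      (mul_le_mul_of_nonneg_left (hC2 _) hε0.le).trans hεC
    have h2 : b ≤ a := min_le_left _ _
    nlinarith
  · have hm : MeasurableSet Kᶜ := hK.measurableSet.compl
    have hint : Integrable (fun y => (φ x + a / 2) + Kᶜ.indicator (fun _ => (1 : ℝ)) y) ν :=
      (integrable_const _).add ((integrable_const (1 : ℝ)).indicator hm)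
    calc ∫ y, φ (x - y) ∂ν ≤ ∫ y, ((φ x + a / 2) + Kᶜ.indicator (fun _ => (1 : ℝ)) y) ∂ν := by
          refine integral_mono_of_nonneg (Eventually.of_forall fun y => (hφr _).1) hint
            (Eventually.of_forall fun y => ?_)
          by_cases hy : y ∈ K
          · have h1 : |φ (x - y) - φ x| ≤ b * |x - y - x| := by
              have := Convex.norm_image_sub_le_of_norm_deriv_le (f := φ) (s := univ) (C := b)
                (x := x) (y := x - y) (fun x _ => hφd x) (fun x _ => by
                  rw [Real.norm_eq_abs]; exact hφb x) convex_univ (mem_univ _) (mem_univ _)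
              simpa only [Real.norm_eq_abs] using this
            have h2 : |x - y - x| ≤ |R₁| := by
              have e : x - y - x = -y := by ring
              rw [e, abs_neg]
              exact (hR₁ y hy).trans (le_abs_self _)
            have h3 := (abs_le.1 h1).2
            have h4 : b * |x - y - x| ≤ b * |R₁| := by gcongr
            simp only [mem_compl_iff, hy, not_true_eq_false, not_false_eq_true,
              indicator_of_notMem]
            linarith
          · simp only [mem_compl_iff, hy, not_false_eq_true, indicator_of_mem]
            linarith [(hφr (x - y)).2, (hφr x).1]
      _ = (φ x + a / 2) + ν.real Kᶜ := by
          rw [integral_add (integrable_const _) ((integrable_const (1 : ℝ)).indicator hm),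
            integral_indicator_const _ hm]
          simp
      _ ≤ φ x + a := by
          have : ν.real Kᶜ ≤ a / 2 := ENNReal.toReal_le_of_le_ofReal (by linarith) hKν
          linarith

namespace NonlinOp

variable {A : NonlinOp X} {T : ℝ} {u v V : ℝ → ℝ → ℝ} {f z U : ℝ → ℝ} {c : ℝ}

/-! ### Local dependence on the initial values -/

/-- The global estimate of `A[u+v] - A[u]` holds for some constants and some measure. -/
def GloballyBounded (A : NonlinOp X) : Prop :=
  ∃ (K₁ Kt₂ K₂ : ℝ) (ν : Measure ℝ), 0 < K₁ ∧ 0 < Kt₂ ∧ 0 < K₂ ∧ IsProbabilityMeasure ν ∧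
    A.GlobalBound K₁ Kt₂ K₂ ν

/-- If, up to `ρ'`, a subsolution is below a supersolution on the interval of radius `R` around
`x₀`, then up to `ρ` it is below it at `x₀` until the time `S`. Both have values in `[0,1]`. -/
def LocalComparison (A : NonlinOp X) (S ρ R ρ' : ℝ) : Prop :=
  ∀ T > 0, ∀ u v : ℝ → ℝ → ℝ, A.IsSupersolution T u → A.IsSubsolution T v →
    (∀ t ∈ Ico 0 T, ∀ x, u t x ∈ Icc (0 : ℝ) 1) → (∀ t ∈ Ico 0 T, ∀ x, v t x ∈ Icc (0 : ℝ) 1) →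
    ∀ x₀, (∀ y, |y - x₀| ≤ R → v 0 y ≤ u 0 y + ρ') →
    ∀ t ∈ Ico 0 T, t ≤ S → v t x₀ ≤ u t x₀ + ρ

/-- Over a short time, the supersolution `u + e^{K t} (φ + κ)` with a slowly varying barrier `φ`
yields the local comparison. The time has to be short, because the added term must not exceed
`2`. -/
theorem exists_localComparison_short (hS : A.Standing f) (hG : A.GloballyBounded) :
    ∃ S > 0, ∀ ρ > 0, ∃ R > 0, ∃ ρ' > 0, A.LocalComparison S ρ R ρ' := by
  obtain ⟨K₁, Kt₂, K₂, ν, hK₁, hKt₂, hK₂, hν, hG⟩ := hG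
  set K := K₁ + 1 with hK
  have hK0 : 0 < K := by linarith
  refine ⟨1 / (8 * K), by positivity, fun ρ hρ => ?_⟩
  set κ := min (ρ / 2) (1 / 2) with hκ
  have hκ0 : 0 < κ := by positivity
  have hκ1 : κ ≤ 1 / 2 := min_le_right _ _
  have hκ2 : κ ≤ ρ / 2 := min_le_left _ _
  set a := κ / (K₁ + Kt₂ + K₂) with ha
  have ha0 : 0 < a := by positivity
  have haκ : a * (K₁ + Kt₂ + K₂) = κ := by rw [ha]; field_simp
  obtain ⟨R, hR, φ, hφs, hφr, hφ0, hφ1, hd1, hd2, hint⟩ := exists_barrier ν ha0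
  refine ⟨R, hR, κ / 2, by positivity, ?_⟩
  intro T hT u v hu hv hur hvr x₀ h0 t ht htS
  set T' := min T (1 / (4 * K)) with hT'
  have hT'0 : 0 < T' := by positivity
  have hT'T : T' ≤ T := min_le_left _ _
  have htT' : t ∈ Ico 0 T' := ⟨ht.1, lt_min ht.2 (htS.trans_lt (by
    apply div_lt_div_of_pos_left <;> linarith))⟩
  have hexp : ∀ s ∈ Ico 0 T', Real.exp (K * s) ≤ 4 / 3 := by
    intro s hs
    have h1 : s ≤ 1 / (4 * K) := hs.2.le.trans (min_le_right _ _)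
    have h2 : K * s ≤ 1 / 4 := by
      rw [le_div_iff₀ (by positivity)] at h1
      linarith
    calc Real.exp (K * s) ≤ Real.exp (1 / 4) := Real.exp_le_exp.2 h2
      _ ≤ 1 / (1 - 1 / 4) := Real.exp_bound_div_one_sub_of_interval (by norm_num) (by norm_num)
      _ = 4 / 3 := by norm_num
  have hφdom : φ ∈ A.dom := A.smooth_mem φ hφs
  obtain ⟨M₂, hφ2, -⟩ := hφs 2
  have hφd : Differentiable ℝ φ := hφ2.differentiable two_ne_zero
  have hφdd : Differentiable ℝ (_root_.deriv φ) := hφ2.differentiable_deriv_two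
  set ψ : ℝ → ℝ := fun x => φ x + κ with hψ
  have hψdom : ψ ∈ A.dom := A.add_const_mem_dom hφdom κ
  have hψc : Continuous ψ := hφd.continuous.add continuous_const
  have hsup : A.IsSupersolution T'
      (fun t x => u t (x + x₀) + Real.exp (K * t) * ψ x) := by
    have hu' := (hu.mono hT'T).translate hS.trans x₀
    refine ⟨hu'.1.add hT'0 (regular_mul hT'0 (by fun_prop) hψdom hψc), fun s hs x => ?_⟩
    obtain ⟨d, hd, hle⟩ := hu'.2 s hs x
    have hs' : s ∈ Ico 0 T' := ⟨hs.1.le, hs.2⟩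
    have he : HasDerivAt (fun s => Real.exp (K * s) * ψ x) (Real.exp (K * s) * K * ψ x) s := by
      have := ((hasDerivAt_id s).const_mul K).exp.mul_const (ψ x)
      simpa using this
    refine ⟨_, hd.add he, ?_⟩
    have hepos := Real.exp_pos (K * s)
    have he4 := hexp s hs'
    set e := Real.exp (K * s) with hedef
    set Φ : ℝ → ℝ := fun x => e * ψ x with hΦ
    have hΦd1 : _root_.deriv Φ = fun x => e * _root_.deriv φ x := by
      funext y
      exact (((hφd y).hasDerivAt.add_const κ).const_mul e).deriv
    have hΦd2 : _root_.deriv (_root_.deriv Φ) = fun x => e * _root_.deriv (_root_.deriv φ) x := by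
      rw [hΦd1]
      funext y
      exact ((hφdd y).hasDerivAt.const_mul e).deriv
    have hΦr : ∀ y, Φ y ∈ Icc (0 : ℝ) 2 := by
      intro y
      have h1 := hφr y
      have h2 : 0 ≤ ψ y := add_nonneg h1.1 hκ0.le
      have h3 : ψ y ≤ 3 / 2 := by simp only [hψ]; linarith [h1.2]
      exact ⟨by positivity, by simp only [hΦ]; nlinarith⟩
    have hur' := hur s ⟨hs.1.le, hs.2.trans_le hT'T⟩
    have hsmooth : IsCkb 2 Φ := by
      obtain ⟨M, hM, hMb⟩ := hφs 2
      have hb0 : ∀ y, |φ y| ≤ M := fun y => by simpa using hMb 0 (by norm_num) y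
      refine ⟨max 2 (e * a), contDiff_const.mul (hM.add contDiff_const), fun k hk y => ?_⟩
      interval_cases k
      · rw [iteratedDeriv_zero, abs_of_nonneg (hΦr y).1]
        exact (hΦr y).2.trans (le_max_left _ _)
      · rw [iteratedDeriv_one, hΦd1]
        simp only
        rw [abs_mul, abs_of_pos hepos]
        exact (mul_le_mul_of_nonneg_left (hd1 y) hepos.le).trans (le_max_right _ _)
      · rw [iteratedDeriv_succ, iteratedDeriv_one, hΦd2]
        simp only
        rw [abs_mul, abs_of_pos hepos]
        exact (mul_le_mul_of_nonneg_left (hd2 y) hepos.le).trans (le_max_right _ _)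
    have hbound := hG (fun x => u s (x + x₀)) Φ ⟨hu'.1.2.2.1 s hs, A.dom.smul_mem e hψdom,
      fun y => ⟨by linarith [(hur' (y + x₀)).1], by linarith [(hur' (y + x₀)).2]⟩,
      fun y => ⟨by linarith [(hΦr y).1], (hΦr y).2⟩⟩ hsmooth x
    have hI : ∫ y, |Φ (x - y)| ∂ν ≤ e * (φ x + a + κ) := by
      have h1 : (fun y => |Φ (x - y)|) = fun y => e * (φ (x - y) + κ) := by
        funext y; exact abs_of_nonneg (hΦr _).1
      have hφi : Integrable (fun y => φ (x - y)) ν :=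
        (integrable_const (1 : ℝ)).mono'
          (hφd.continuous.comp (continuous_const.sub continuous_id)).aestronglyMeasurable
          (Eventually.of_forall fun y => by
            rw [Real.norm_eq_abs, abs_of_nonneg (hφr _).1]; exact (hφr _).2)
      rw [h1, integral_const_mul, integral_add hφi (integrable_const _)]
      simp only [integral_const, probReal_univ, smul_eq_mul, one_mul]
      have := hint x
      gcongr
    have hs1 : supNorm (_root_.deriv Φ) ≤ e * a := supNorm_le fun y => by
      rw [hΦd1]; simp only
      rw [abs_mul, abs_of_pos hepos]
      exact mul_le_mul_of_nonneg_left (hd1 y) hepos.le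
    have hs2 : supNorm (_root_.deriv (_root_.deriv Φ)) ≤ e * a := supNorm_le fun y => by
      rw [hΦd2]; simp only
      rw [abs_mul, abs_of_pos hepos]
      exact mul_le_mul_of_nonneg_left (hd2 y) hepos.le
    have htot : A.toFun ((fun x => u s (x + x₀)) + Φ) x - A.toFun (fun x => u s (x + x₀)) x
        ≤ e * K * ψ x := by
      refine (le_abs_self _).trans (hbound.trans ?_)
      have e1 : K₁ * ∫ y, |Φ (x - y)| ∂ν ≤ K₁ * (e * (φ x + a + κ)) := by gcongr
      have e2 : Kt₂ * supNorm (_root_.deriv Φ) ≤ Kt₂ * (e * a) := by gcongr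
      have e3 : K₂ * supNorm (_root_.deriv (_root_.deriv Φ)) ≤ K₂ * (e * a) := by gcongr
      have e4 : K₁ * (e * (φ x + a + κ)) + (Kt₂ * (e * a) + K₂ * (e * a))
          = e * K₁ * ψ x + e * κ := by rw [← haκ]; simp only [hψ]; rw [← haκ]; ring
      have e5 : e * K * ψ x = e * K₁ * ψ x + e * κ + e * φ x := by simp only [hK, hψ]; ring
      have e6 : 0 ≤ e * φ x := mul_nonneg hepos.le (hφr x).1
      linarith
    have hle' : A.toFun (fun x => u s (x + x₀)) x ≤ d := hle
    change A.toFun ((fun x => u s (x + x₀)) + Φ) x ≤ _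
    linarith
  have hlt := hS.comp.lt_of_lt hT'0 hsup ((hv.mono hT'T).translate hS.trans x₀) (fun x => by
    simp only [mul_zero, Real.exp_zero, one_mul, hψ]
    have h1 := hur 0 ⟨le_rfl, hT⟩ (x + x₀)
    have h2 := hvr 0 ⟨le_rfl, hT⟩ (x + x₀)
    rcases le_total |x| R with h | h
    · have := h0 (x + x₀) (by simpa using h)
      linarith [(hφr x).1]
    · rw [hφ1 x h]
      linarith [h1.1, h2.2]) t htT' 0
  simp only [zero_add, hψ, hφ0] at hlt
  have := hexp t htT'
  nlinarith

theorem LocalComparison.add {S₁ S₂ ρ R₁ R₂ ρ₁ ρ₂ : ℝ} (hS₁ : 0 < S₁)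
    (h₁ : A.LocalComparison S₁ ρ₂ R₁ ρ₁) (h₂ : A.LocalComparison S₂ ρ R₂ ρ₂)
    (h₃ : A.LocalComparison S₁ ρ R₁ ρ₁) (hR₂ : 0 ≤ R₂) :
    A.LocalComparison (S₁ + S₂) ρ (R₁ + R₂) ρ₁ := by
  intro T hT u v hu hv hur hvr x₀ h0 t ht htS
  rcases le_or_gt t S₁ with h | h
  · exact h₃ T hT u v hu hv hur hvr x₀ (fun y hy => h0 y (by linarith)) t ht h
  · have hT' : 0 < T - S₁ := by linarith [ht.2]
    have := h₂ (T - S₁) hT' _ _ (hu.shift hS₁ hT' (by linarith)) (hv.shift hS₁ hT' (by linarith))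
      (fun s hs => hur _ ⟨by linarith [hs.1], by linarith [hs.2]⟩)
      (fun s hs => hvr _ ⟨by linarith [hs.1], by linarith [hs.2]⟩) x₀
      (fun y hy => by
        rw [add_zero]
        refine h₁ T hT u v hu hv hur hvr y (fun w hw => h0 w ?_) S₁ ⟨hS₁.le, by linarith [ht.2]⟩
          le_rfl
        have := abs_sub_le w y x₀
        linarith) (t - S₁) ⟨by linarith, by linarith [ht.2]⟩ (by linarith)
    rwa [add_sub_cancel] at this

theorem LocalComparison.mono {S ρ R ρ' S₁ ρ₁ R₁ ρ₁' : ℝ} (h : A.LocalComparison S ρ R ρ')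
    (hS : S₁ ≤ S) (hρ : ρ ≤ ρ₁) (hR : R ≤ R₁) (hρ' : ρ₁' ≤ ρ') :
    A.LocalComparison S₁ ρ₁ R₁ ρ₁' := by
  intro T hT u v hu hv hur hvr x₀ h0 t ht htS
  have := h T hT u v hu hv hur hvr x₀ (fun y hy => by linarith [h0 y (hy.trans hR)]) t ht
    (htS.trans hS)
  linarith

/-- Up to any given time and any given error, the comparison is local. -/
theorem exists_localComparison (hS : A.Standing f) (hG : A.GloballyBounded) (S : ℝ) {ρ : ℝ}
    (hρ : 0 < ρ) : ∃ R > 0, A.LocalComparison S ρ R 0 := by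
  obtain ⟨s, hs, hshort⟩ := exists_localComparison_short hS hG
  have key : ∀ n : ℕ, ∀ ρ > 0, ∃ R > 0, ∃ ρ' > 0, A.LocalComparison ((n + 1) * s) ρ R ρ' := by
    intro n
    induction n with
    | zero => simpa using hshort
    | succ n ih =>
      intro ρ hρ
      obtain ⟨R₂, hR₂, ρ₂, hρ₂, h₂⟩ := ih ρ hρ
      obtain ⟨R₁, hR₁, ρ₁, hρ₁, h₁⟩ := hshort (min ρ₂ ρ) (lt_min hρ₂ hρ)
      refine ⟨R₁ + R₂, by positivity, ρ₁, hρ₁, ?_⟩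
      have := LocalComparison.add hs (h₁.mono le_rfl (min_le_left _ _) le_rfl le_rfl) h₂
        (h₁.mono le_rfl (min_le_right _ _) le_rfl le_rfl) hR₂.le
      refine this.mono (le_of_eq ?_) le_rfl le_rfl le_rfl
      push_cast
      ring
  obtain ⟨n, hn⟩ := exists_nat_ge (S / s)
  rw [div_le_iff₀ hs] at hn
  obtain ⟨R, hR, ρ', hρ', h⟩ := key n ρ hρ
  exact ⟨R, hR, h.mono (by linarith) le_rfl le_rfl hρ'.le⟩

end NonlinOp

end

section

variable {X : Phase}

namespace NonlinOp

variable {A : NonlinOp X} {T : ℝ} {u v V : ℝ → ℝ → ℝ} {f z U p : ℝ → ℝ} {c : ℝ}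

/-! ### Convergence to the stable states far from the interface -/

theorem LocalComparison.lower_right {S ρ R x₀ : ℝ} (h : A.LocalComparison S ρ R 0)
    (hT : 0 < T) (hp : A.IsSubsolution T (fun t _ => p t))
    (hpr : ∀ t ∈ Ico 0 T, p t ∈ Icc (0 : ℝ) 1)
    (hu : A.IsSolution u) (hur : ∀ t ≥ 0, ∀ x, u t x ∈ Icc (0 : ℝ) 1) (h0 : ∀ x ≥ x₀, p 0 ≤ u 0 x) :
    ∀ t ∈ Ico 0 T, t ≤ S → ∀ x ≥ x₀ + R, p t ≤ u t x + ρ := by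
  intro t ht htS x hx
  exact h T hT u _ (hu.isSupersolution hT) hp (fun t ht => hur t ht.1) (fun t ht _ => hpr t ht) x
    (fun y hy => by linarith [h0 y (by linarith [(abs_le.1 hy).1])]) t ht htS

theorem LocalComparison.upper_left {S ρ R x₀ : ℝ} (h : A.LocalComparison S ρ R 0)
    (hT : 0 < T) (hp : A.IsSupersolution T (fun t _ => p t))
    (hpr : ∀ t ∈ Ico 0 T, p t ∈ Icc (0 : ℝ) 1)
    (hu : A.IsSolution u) (hur : ∀ t ≥ 0, ∀ x, u t x ∈ Icc (0 : ℝ) 1) (h0 : ∀ x ≤ x₀, u 0 x ≤ p 0) :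
    ∀ t ∈ Ico 0 T, t ≤ S → ∀ x ≤ x₀ - R, u t x ≤ p t + ρ := by
  intro t ht htS x hx
  exact h T hT _ u hp (hu.isSubsolution hT) (fun t ht _ => hpr t ht) (fun t ht => hur t ht.1) x
    (fun y hy => by linarith [h0 y (by linarith [(abs_le.1 hy).2])]) t ht htS

theorem isSubsolution_of_const (hconst : A.OnConstants f) (hT : 0 < T) {b : ℝ} (hb : 0 ≤ f b) :
    A.IsSubsolution T (fun _ _ => b) :=
  isSubsolution_time hconst hT continuous_const (fun t _ => hasDerivAt_const t b) fun _ _ => hb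

theorem isSupersolution_of_const (hconst : A.OnConstants f) (hT : 0 < T) {b : ℝ} (hb : f b ≤ 0) :
    A.IsSupersolution T (fun _ _ => b) :=
  isSupersolution_time hconst hT continuous_const (fun t _ => hasDerivAt_const t b) fun _ _ => hb

/-- Where a solution is initially at least `b > a` on a half-line, it gets close to `1` and stays
there. -/
theorem exists_raise (hS : A.Standing f) (hG : A.GloballyBounded) {a b ρ : ℝ} (ha : 0 ≤ a)
    (hf : ∀ s ∈ Ioo a 1, 0 < f s) (hb : b ∈ Ioo a 1) (hρ : 0 < ρ) :
    ∃ S ≥ 0, ∀ S' ≥ 0, ∃ R, ∀ u, A.IsSolution u → (∀ t ≥ 0, ∀ x, u t x ∈ Icc (0 : ℝ) 1) →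
      ∀ x₀, (∀ x ≥ x₀, b ≤ u 0 x) → ∀ t ∈ Icc S (S + S'), ∀ x ≥ x₀ + R, 1 - ρ ≤ u t x := by
  have hfc : Continuous f := hS.bistable.1.continuous
  set top := max ((b + 1) / 2) (1 - ρ / 4) with htop
  have htop1 : top < 1 := max_lt (by linarith [hb.2]) (by linarith)
  have hbtop : b < top := lt_of_lt_of_le (by linarith [hb.2]) (le_max_left _ _)
  have htopρ : 1 - ρ / 4 ≤ top := le_max_right _ _
  set top' := (top + 1) / 2 with htop'
  have h1 : top < top' := by rw [htop']; linarith
  have h2 : top' < 1 := by rw [htop']; linarith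
  obtain ⟨y, hy, hym⟩ := (isCompact_Icc (a := b) (b := top')).exists_isMinOn
    ⟨b, by constructor <;> linarith⟩ hfc.continuousOn
  set m := f y with hm
  have hm0 : 0 < m := hf y ⟨by linarith [hb.1, hy.1], by linarith [hy.2]⟩
  set T := (top' - b) / m with hT
  have hT0 : 0 < T := div_pos (by linarith) hm0
  set S := (top - b) / m with hSd
  have hS0 : 0 < S := div_pos (by linarith) hm0
  have hST : S < T := by rw [hSd, hT]; gcongr
  have hmT : m * T = top' - b := by rw [hT]; field_simp
  have hmS : m * S = top - b := by rw [hSd]; field_simp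
  have hrange : ∀ t ∈ Ico 0 T, b + m * t ∈ Icc b top' := by
    intro t ht
    have : m * t ≤ m * T := by have := ht.2.le; gcongr
    have : 0 ≤ m * t := mul_nonneg hm0.le ht.1
    exact ⟨by linarith, by linarith⟩
  have hp : A.IsSubsolution T (fun t _ => b + m * t) :=
    isSubsolution_time hS.const hT0 (p := fun t => b + m * t) (p' := fun _ => m) (by fun_prop)
      (fun t _ => by simpa using ((hasDerivAt_id t).const_mul m).const_add b)
      (fun t ht => hym (hrange t ⟨ht.1.le, ht.2⟩))
  -- the level reached at time `S` has to lie above `a` after subtracting the local error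
  obtain ⟨R₁, -, hR₁⟩ := exists_localComparison hS hG S (ρ := min (ρ / 4) ((top - b) / 2))
    (lt_min (by linarith) (by linarith))
  set b' := top - min (ρ / 4) ((top - b) / 2) with hb'
  have hb'1 : 1 - ρ / 2 ≤ b' := by
    have := min_le_left (ρ / 4) ((top - b) / 2)
    rw [hb']; linarith
  have hb'2 : b < b' := by
    have := min_le_right (ρ / 4) ((top - b) / 2)
    rw [hb']; linarith
  have hb'3 : b' < 1 := by
    have : 0 < min (ρ / 4) ((top - b) / 2) := lt_min (by linarith) (by linarith)
    rw [hb']; linarith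
  refine ⟨S, hS0.le, fun S' hS' => ?_⟩
  obtain ⟨R₂, -, hR₂⟩ := exists_localComparison hS hG S' (ρ := ρ / 2) (by linarith)
  refine ⟨R₁ + R₂, fun u hu hur x₀ h0 t ht x hx => ?_⟩
  have hat : ∀ x ≥ x₀ + R₁, b' ≤ u S x := by
    intro x hx
    have := hR₁.lower_right hT0 hp (fun t ht => by
      have := hrange t ht
      exact ⟨by linarith [this.1, hb.1], by linarith [this.2]⟩) hu hur (x₀ := x₀)
      (by simpa using h0) S ⟨hS0.le, hST⟩ le_rfl x hx
    rw [hmS] at this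
    rw [hb']; linarith
  have hT' : 0 < S' + 1 := by linarith
  have := hR₂.lower_right hT' (p := fun _ => b') (isSubsolution_of_const hS.const hT'
      (hf b' ⟨by linarith [hb.1], hb'3⟩).le) (fun _ _ => ⟨by linarith [hb.1], hb'3.le⟩)
    (hu.shift hS0.le) (fun t ht => hur _ (by linarith)) (x₀ := x₀ + R₁)
    (by simpa using hat) (t - S) ⟨by linarith [ht.1], by linarith [ht.2]⟩ (by linarith [ht.2]) x
    (by linarith)
  rw [add_sub_cancel] at this
  linarith

/-- Where a solution is initially at most `b < a` on a half-line, it gets close to `0` and stays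
there. -/
theorem exists_sink (hS : A.Standing f) (hG : A.GloballyBounded) {a b ρ : ℝ} (ha : a ≤ 1)
    (hf : ∀ s ∈ Ioo 0 a, f s < 0) (hb : b ∈ Ioo 0 a) (hρ : 0 < ρ) :
    ∃ S ≥ 0, ∀ S' ≥ 0, ∃ R, ∀ u, A.IsSolution u → (∀ t ≥ 0, ∀ x, u t x ∈ Icc (0 : ℝ) 1) →
      ∀ x₀, (∀ x ≤ x₀, u 0 x ≤ b) → ∀ t ∈ Icc S (S + S'), ∀ x ≤ x₀ - R, u t x ≤ ρ := by
  have hfc : Continuous f := hS.bistable.1.continuous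
  set bot := min (b / 2) (ρ / 4) with hbot
  have hbot0 : 0 < bot := lt_min (by linarith [hb.1]) (by linarith)
  have hbbot : bot < b := lt_of_le_of_lt (min_le_left _ _) (by linarith [hb.1])
  have hbotρ : bot ≤ ρ / 4 := min_le_right _ _
  set bot' := bot / 2 with hbot'
  have h1 : bot' < bot := by rw [hbot']; linarith
  have h2 : 0 < bot' := by rw [hbot']; linarith
  obtain ⟨y, hy, hym⟩ := (isCompact_Icc (a := bot') (b := b)).exists_isMaxOn
    ⟨b, by constructor <;> linarith⟩ hfc.continuousOn
  set m := -f y with hm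
  have hm0 : 0 < m := by linarith [hf y ⟨by linarith [hy.1], by linarith [hy.2, hb.2]⟩]
  set T := (b - bot') / m with hT
  have hT0 : 0 < T := div_pos (by linarith) hm0
  set S := (b - bot) / m with hSd
  have hS0 : 0 < S := div_pos (by linarith) hm0
  have hST : S < T := by rw [hSd, hT]; gcongr
  have hmT : m * T = b - bot' := by rw [hT]; field_simp
  have hmS : m * S = b - bot := by rw [hSd]; field_simp
  have hrange : ∀ t ∈ Ico 0 T, b - m * t ∈ Icc bot' b := by
    intro t ht
    have : m * t ≤ m * T := by have := ht.2.le; gcongr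
    have : 0 ≤ m * t := mul_nonneg hm0.le ht.1
    exact ⟨by linarith, by linarith⟩
  have hp : A.IsSupersolution T (fun t _ => b - m * t) :=
    isSupersolution_time hS.const hT0 (p := fun t => b - m * t) (p' := fun _ => -m) (by fun_prop)
      (fun t _ => by simpa using ((hasDerivAt_id t).const_mul m).const_sub b)
      (fun t ht => by
        have : f (b - m * t) ≤ f y := hym (hrange t ⟨ht.1.le, ht.2⟩)
        linarith)
  obtain ⟨R₁, -, hR₁⟩ := exists_localComparison hS hG S (ρ := min (ρ / 4) ((b - bot) / 2))
    (lt_min (by linarith) (by linarith))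
  set b' := bot + min (ρ / 4) ((b - bot) / 2) with hb'
  have hb'1 : b' ≤ ρ / 2 := by
    have := min_le_left (ρ / 4) ((b - bot) / 2)
    rw [hb']; linarith
  have hb'2 : b' < b := by
    have := min_le_right (ρ / 4) ((b - bot) / 2)
    rw [hb']; linarith
  have hb'3 : 0 < b' := by
    have : 0 < min (ρ / 4) ((b - bot) / 2) := lt_min (by linarith) (by linarith)
    rw [hb']; linarith
  refine ⟨S, hS0.le, fun S' hS' => ?_⟩
  obtain ⟨R₂, -, hR₂⟩ := exists_localComparison hS hG S' (ρ := ρ / 2) (by linarith)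
  refine ⟨R₁ + R₂, fun u hu hur x₀ h0 t ht x hx => ?_⟩
  have hat : ∀ x ≤ x₀ - R₁, u S x ≤ b' := by
    intro x hx
    have := hR₁.upper_left hT0 hp (fun t ht => by
      have := hrange t ht
      exact ⟨by linarith [this.1], by linarith [this.2, hb.2]⟩) hu hur (x₀ := x₀)
      (by simpa using h0) S ⟨hS0.le, hST⟩ le_rfl x hx
    rw [hmS] at this
    rw [hb']; linarith
  have hT' : 0 < S' + 1 := by linarith
  have := hR₂.upper_left hT' (p := fun _ => b') (isSupersolution_of_const hS.const hT'
      (hf b' ⟨hb'3, by linarith [hb.2]⟩).le) (fun _ _ => ⟨hb'3.le, by linarith [hb.2]⟩)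
    (hu.shift hS0.le) (fun t ht => hur _ (by linarith)) (x₀ := x₀ - R₁)
    (by simpa using hat) (t - S) ⟨by linarith [ht.1], by linarith [ht.2]⟩ (by linarith [ht.2]) x
    (by linarith)
  rw [add_sub_cancel] at this
  linarith

/-! ### Stability -/

theorem IsFront.exists_sandwiched (hV : A.IsFront V z) {t δ Y : ℝ} (ht : 1 ≤ t) (hδ : 0 < δ)
    (hur : ∀ x, u t x ∈ Icc (0 : ℝ) 1) (hr : ∀ x ≥ Y, 1 - δ ≤ u t x)
    (hl : ∀ x ≤ -Y, u t x ≤ δ) : ∃ ξ h, Sandwiched u V t ξ h δ := by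
  obtain ⟨R, hR⟩ := hV.tails δ hδ
  have hVm := hV.mem t (by linarith)
  refine ⟨z t - R - Y, 2 * (R + Y), fun x => ⟨?_, ?_⟩⟩
  · rcases le_total x Y with h | h
    · linarith [(hR t ht (x + (z t - R - Y))).2 (by linarith), (hur x).1]
    · linarith [hr x h, (hVm (x + (z t - R - Y))).2]
  · rcases le_total x (-Y) with h | h
    · linarith [hl x h, (hVm (x + (z t - R - Y + 2 * (R + Y)))).1]
    · linarith [(hR t ht (x + (z t - R - Y + 2 * (R + Y)))).1 (by linarith), (hur x).2]

theorem IsMonotoneWave.stable (hS : A.Standing f) (hE : A.DerivBounded) (hG : A.GloballyBounded)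
    {am ap : ℝ} (ham : 0 < am) (hap : ap < 1) (hle : am ≤ ap) (hsign : SignPattern f am ap)
    (hη : A.ComparisonAtOne) (hU : A.IsMonotoneWave U c) :
    ∃ κ > 0, ∀ u, A.IsSolution u → (∀ x, u 0 x ∈ Icc (0 : ℝ) 1) →
      ap < liminf (u 0) atTop → limsup (u 0) atBot < am →
      ∃ ξ K, ∀ t ≥ 0, ∀ x, |u t x - U (x - c * t + ξ)| ≤ K * Real.exp (-κ * t) := by
  have hV := hU.isFront
  obtain ⟨Λ, hΛ0, hΛ⟩ := hS.exists_shiftLipschitz hE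
  obtain ⟨δ₁, hδ₁, κ, hκ, hrate⟩ := hV.exists_rate hS hE hη
  refine ⟨κ, hκ, fun u hu h01 hinf hsup => ?_⟩
  have hur := hu.mem_Icc hS.comp hΛ hΛ0 hS.const hS.bistable.2.1 hS.bistable.2.2.1 h01
  -- bounds of the initial value on two half-lines
  obtain ⟨b, hb, Y, hY⟩ : ∃ b ∈ Ioo ap 1, ∃ Y, ∀ x ≥ Y, b ≤ u 0 x := by
    obtain ⟨b, hb1, hb2⟩ := exists_between (lt_min hinf hap)
    obtain ⟨Y, hY⟩ := eventually_atTop.1 (eventually_lt_of_lt_liminf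
      (hb2.trans_le (min_le_left _ _)) (isBoundedUnder_of ⟨0, fun x => (h01 x).1⟩))
    exact ⟨b, ⟨hb1, hb2.trans_le (min_le_right _ _)⟩, Y, fun x hx => (hY x hx).le⟩
  obtain ⟨b', hb', Y', hY'⟩ : ∃ b ∈ Ioo 0 am, ∃ Y, ∀ x ≤ Y, u 0 x ≤ b := by
    obtain ⟨b, hb1, hb2⟩ := exists_between (max_lt hsup ham)
    obtain ⟨Y, hY⟩ := eventually_atBot.1 (eventually_lt_of_limsup_lt
      ((le_max_left _ _).trans_lt hb1) (isBoundedUnder_of ⟨1, fun x => (h01 x).2⟩))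
    exact ⟨b, ⟨(le_max_right _ _).trans_lt hb1, hb2⟩, Y, fun x hx => (hY x hx).le⟩
  obtain ⟨S₁, hS₁, h₁⟩ := exists_raise hS hG (by linarith : 0 ≤ ap)
    (fun s hs => hsign.1 s (Or.inr hs)) hb hδ₁
  obtain ⟨S₂, hS₂, h₂⟩ := exists_sink hS hG (by linarith : am ≤ 1)
    (fun s hs => hsign.2 s (Or.inl hs)) hb' hδ₁
  obtain ⟨R₁, h₁⟩ := h₁ (S₂ + 1) (by linarith)
  obtain ⟨R₂, h₂⟩ := h₂ (S₁ + 1) (by linarith)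
  have ht₀ : 1 ≤ S₁ + S₂ + 1 := by linarith
  obtain ⟨ξ₀, h₀, hsw⟩ := hV.exists_sandwiched (u := u) (t := S₁ + S₂ + 1) (δ := δ₁)
    (Y := max (Y + R₁) (-(Y' - R₂))) ht₀ hδ₁ (hur _ (by linarith))
    (fun x hx => h₁ u hu hur Y hY _ ⟨by linarith, by linarith⟩ x ((le_max_left _ _).trans hx))
    (fun x hx => h₂ u hu hur Y' hY' _ ⟨by linarith, by linarith⟩ x (by
      have := le_max_right (Y + R₁) (-(Y' - R₂))
      linarith))
  obtain ⟨ξ, K, hK⟩ := hrate u hu hur ⟨_, ht₀, ξ₀, h₀, hsw⟩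
  refine ⟨ξ, max K (Real.exp κ), fun t ht x => ?_⟩
  rcases le_total 1 t with h | h
  · have := hK t h x
    have e : x + ξ - c * t = x - c * t + ξ := by ring
    rw [e] at this
    refine this.trans ?_
    gcongr
    exact le_max_left _ _
  · have h1 : |u t x - U (x - c * t + ξ)| ≤ 1 := by
      have h2 := hur t ht x
      have h3 := hU.mem_Icc (x - c * t + ξ)
      exact abs_le.2 ⟨by linarith [h2.1, h3.2], by linarith [h2.2, h3.1]⟩
    have h4 : 1 ≤ Real.exp κ * Real.exp (-κ * t) := by
      rw [← Real.exp_add]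
      exact Real.one_le_exp (by nlinarith)
    have h5 : Real.exp κ * Real.exp (-κ * t) ≤ max K (Real.exp κ) * Real.exp (-κ * t) := by
      gcongr
      exact le_max_right _ _
    linarith

end NonlinOp

end

section

variable {X : Phase}

/-! ### Smooth steps and growth away from a zero of `f` -/

theorem isCkb_smoothStep (p q : ℝ) {l : ℝ} (hl : 0 < l) (n : ℕ) :
    IsCkb n (fun x => p + q * Real.smoothTransition (x / l)) := by
  refine isCkb_of_eventually_const (R := l) (a := p + q) (b := p) ?_ (fun x hx => ?_)
    (fun x hx => ?_) n
  · exact contDiff_const.add (contDiff_const.mul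
      (Real.smoothTransition.contDiff.comp (contDiff_id.div_const l)))
  · rw [Real.smoothTransition.one_of_one_le, mul_one]
    rw [le_div_iff₀ hl]; linarith
  · rw [Real.smoothTransition.zero_of_nonpos, mul_zero, add_zero]
    exact div_nonpos_of_nonpos_of_nonneg (by linarith) hl.le

theorem IsCkb.mem_space {n : ℕ} {g : ℝ → ℝ} (hg : IsCkb n g) : g ∈ X.space := by
  obtain ⟨M, hM, hb⟩ := hg
  exact Phase.mem_of_continuous hM.continuous ⟨M, fun x => by simpa using hb 0 (by simp) x⟩

/-- Linear growth near a zero of `f` with positive derivative. -/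
theorem exists_linear_growth {f : ℝ → ℝ} {a : ℝ} (hf : DifferentiableAt ℝ f a) (ha : f a = 0)
    (hd : 0 < deriv f a) : ∃ s₁ > 0, ∀ s, 0 ≤ s → s ≤ s₁ →
      deriv f a / 2 * s ≤ f (a + s) ∧ f (a - s) ≤ -(deriv f a / 2 * s) := by
  have h := hf.hasDerivAt.isLittleO
  have h2 := h.bound (half_pos hd)
  obtain ⟨s₁, hs₁, hb⟩ := Metric.eventually_nhds_iff.1 h2
  refine ⟨s₁ / 2, by positivity, fun s hs0 hs => ?_⟩
  have h3 := hb (y := a + s) (by rw [Real.dist_eq]; simp; rw [abs_of_nonneg hs0]; linarith)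
  have h4 := hb (y := a - s) (by rw [Real.dist_eq]; simp; rw [abs_of_nonneg hs0]; linarith)
  simp only [ha, sub_zero, smul_eq_mul, Real.norm_eq_abs, add_sub_cancel_left,
    sub_sub_cancel_left, abs_neg, abs_of_nonneg hs0] at h3 h4
  constructor
  · linarith [(abs_le.1 h3).1]
  · linarith [(abs_le.1 h4).2]

namespace NonlinOp

variable {A : NonlinOp X} {T : ℝ} {u v w V : ℝ → ℝ → ℝ} {f z U p : ℝ → ℝ} {a c Λ : ℝ}

theorem GeneratesSemigroup.exists_solution (h : A.GeneratesSemigroup) {g : ℝ → ℝ}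
    (hg : g ∈ X.space) : ∃ u, A.IsSolution u ∧ u 0 = g := by
  obtain ⟨S, -, h0, -, hs⟩ := h
  exact ⟨_, hs g hg, h0 g hg⟩

theorem IsSolution.monotone (hS : A.Standing f) (hΛ : A.ShiftLipschitz Λ) (hΛ0 : 0 ≤ Λ)
    (hu : A.IsSolution u) (hur : ∀ t ≥ 0, ∀ x, u t x ∈ Icc (0 : ℝ) 1) (h0 : Monotone (u 0)) {t : ℝ}
    (ht : 0 ≤ t) : Monotone (u t) := by
  intro x y hxy
  have hT : 0 < t + 1 := by linarith
  have := hS.comp.le_of_le hΛ hΛ0 hT ((hu.translate hS.trans (y - x)).isSupersolution hT)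
    (r := 1) (by norm_num)
    (fun s hs w => ⟨by linarith [(hur s hs.1.le (w + (y - x))).1], (hur s hs.1.le _).2⟩)
    (hu.isSubsolution hT) (fun w => h0 (by linarith)) t ⟨ht, by linarith⟩ x
  simpa using this

/-! ### Almost linear behaviour near the unstable state -/

/-- Second differences are quadratically small, because the linearization is odd in its direction
as a limit of difference quotients. -/
theorem QuadraticBound.second_difference {K₃ : ℝ} (hQ : A.QuadraticBound K₃) (hK₃ : 0 ≤ K₃)
    {g h : ℝ → ℝ} (hg : g ∈ A.dom) (hh : h ∈ A.dom) (hgr : ∀ x, g x ∈ Icc (-1 : ℝ) 2) {s : ℝ}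
    (hs1 : s ≤ 1) (hhr : ∀ x, |h x| ≤ s) (x : ℝ) :
    |A.toFun (fun y => g y + h y) x + A.toFun (fun y => g y - h y) x - 2 * A.toFun g x|
      ≤ 2 * K₃ * s ^ 2 := by
  have hs0 : 0 ≤ s := (abs_nonneg _).trans (hhr 0)
  have h1 := hQ g h ⟨hg, hh, hgr, fun y => ⟨by linarith [(abs_le.1 (hhr y)).1],
    by linarith [(abs_le.1 (hhr y)).2]⟩⟩ x
  have h2 := hQ g (-h) ⟨hg, A.dom.neg_mem hh, hgr, fun y => ⟨by
    simp only [Pi.neg_apply]; linarith [(abs_le.1 (hhr y)).2],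
    by simp only [Pi.neg_apply]; linarith [(abs_le.1 (hhr y)).1]⟩⟩ x
  have hodd : A.deriv g (-h) x = -A.deriv g h x := by
    unfold NonlinOp.deriv
    have : (fun ε : ℝ => A.toFun (g + ε • -h) x)
        = fun ε : ℝ => (fun r : ℝ => A.toFun (g + r • h) x) (-ε) := by
      funext ε; simp
    rw [this]
    exact (deriv_comp_neg (f := fun r : ℝ => A.toFun (g + r • h) x) (x := 0)).trans
      (by rw [neg_zero])
  rw [hodd] at h2
  have n1 : supNorm h ≤ s := supNorm_le hhr
  have n2 : supNorm (-h) ≤ s := supNorm_le fun y => by simpa using hhr y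
  have m1 : K₃ * supNorm h ^ 2 ≤ K₃ * s ^ 2 := by
    have := supNorm_nonneg h; gcongr
  have m2 : K₃ * supNorm (-h) ^ 2 ≤ K₃ * s ^ 2 := by
    have := supNorm_nonneg (-h); gcongr
  have e1 : g + -h = fun y => g y - h y := by funext y; simp [sub_eq_add_neg]
  have e2 : g + h = fun y => g y + h y := rfl
  rw [e1] at h2
  rw [e2] at h1
  have h1 := abs_le.1 (h1.trans m1)
  have h2 := abs_le.1 (h2.trans m2)
  rw [abs_le]
  constructor <;> linarith [h1.1, h1.2, h2.1, h2.2]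

/-- Additivity up to a quadratic error near the state `a`. No linearity of `A'[a]` is needed: the
two pairs of functions have the same midpoint, so that it suffices to compare both sums of values
with twice the value at the midpoint. -/
theorem QuadraticBound.parallelogram {K₃ : ℝ} (hQ : A.QuadraticBound K₃) (hK₃ : 0 ≤ K₃)
    (ha : a ∈ Ioo (0 : ℝ) 1) {g h : ℝ → ℝ} (hg : g ∈ A.dom) (hh : h ∈ A.dom) {s : ℝ}
    (hs1 : s ≤ 1 / 2) (hgr : ∀ x, |g x - a| ≤ s) (hhr : ∀ x, |h x - a| ≤ s) (x : ℝ) :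
    A.toFun (fun y => g y - h y + a) x + A.toFun h x - A.toFun (fun _ => a) x - A.toFun g x
      ≤ 5 * K₃ * s ^ 2 := by
  have hs0 : 0 ≤ s := (abs_nonneg _).trans (hgr 0)
  have hm : (fun y => 1 / 2 * (g y + a)) ∈ A.dom :=
    A.dom.smul_mem (1 / 2) (A.add_const_mem_dom hg a)
  have hd1 : (fun y => 1 / 2 * (g y - a)) ∈ A.dom := by
    have e : (fun y => 1 / 2 * (g y - a)) = (1 / 2 : ℝ) • fun y => g y + -a := by
      funext y; simp [sub_eq_add_neg]
    rw [e]
    exact A.dom.smul_mem _ (A.add_const_mem_dom hg (-a))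
  have hd2 : (fun y => 1 / 2 * (g y + a) - h y) ∈ A.dom := A.dom.sub_mem hm hh
  have hr : ∀ y, 1 / 2 * (g y + a) ∈ Icc (-1 : ℝ) 2 := fun y => by
    have := abs_le.1 (hgr y)
    exact ⟨by linarith [ha.1], by linarith [ha.2]⟩
  have h1 := hQ.second_difference hK₃ hm hd1 hr (s := s / 2) (by linarith) (fun y => by
    rw [abs_mul, abs_of_pos (by norm_num : (0 : ℝ) < 1 / 2)]
    linarith [hgr y]) x
  have h2 := hQ.second_difference hK₃ hm hd2 hr (s := 3 / 2 * s) (by linarith) (fun y => by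
    have e1 := abs_le.1 (hgr y)
    have e2 := abs_le.1 (hhr y)
    exact abs_le.2 ⟨by linarith, by linarith⟩) x
  have e1 : (fun y => 1 / 2 * (g y + a) + 1 / 2 * (g y - a)) = g := by funext y; ring
  have e2 : (fun y => 1 / 2 * (g y + a) - 1 / 2 * (g y - a)) = fun _ => a := by funext y; ring
  have e3 : (fun y => 1 / 2 * (g y + a) + (1 / 2 * (g y + a) - h y))
    = fun y => g y - h y + a := by funext y; ring
  have e4 : (fun y => 1 / 2 * (g y + a) - (1 / 2 * (g y + a) - h y)) = h := by funext y; ring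
  rw [e1, e2] at h1
  rw [e3, e4] at h2
  have h1 := (abs_le.1 h1).1
  have h2 := (abs_le.1 h2).2
  nlinarith

/-- The separation of two solutions near the unstable state grows: within the time `T` an initial
separation of `3 δ / 8` becomes `4 δ`, for all small `δ`. Indeed, `u - w + a` is a supersolution up
to an error of order `δ ^ 2`, and `a + (3 δ / 8) e^{γ t}` is a subsolution, which grows to
`a + 6 δ`. -/
theorem exists_separation (hS : A.Standing f) (hΛ : A.ShiftLipschitz Λ) (hΛ0 : 0 ≤ Λ) {K₃ : ℝ}
    (hQ : A.QuadraticBound K₃) (hK₃ : 0 ≤ K₃) (ha : a ∈ Ioo (0 : ℝ) 1) (hfa : f a = 0)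
    {γ s₁ : ℝ} (hγ : 0 < γ) (hs₁ : 0 < s₁)
    (hgrow : ∀ s, 0 ≤ s → s ≤ s₁ → γ * s ≤ f (a + s)) (hT : 0 < T)
    (hγT : Real.exp (γ * T) = 16) :
    ∃ δ₁ > 0, ∀ δ, 0 < δ → δ ≤ δ₁ → ∀ u w, A.IsSolution u → A.IsSolution w →
      (∀ x, |u 0 x - a| ≤ δ) → (∀ x, |w 0 x - a| ≤ δ) → (∀ x, 3 / 8 * δ ≤ u 0 x - w 0 x) →
      ∀ x, 4 * δ ≤ u T x - w T x := by
  set D := Real.exp (Λ * (T + 2)) with hD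
  have hD1 : 1 ≤ D := Real.one_le_exp (by positivity)
  have hD0 : 0 < D := by linarith
  have hT1 : 0 < T + 1 := by linarith
  set δ₁ := min (1 / (8 * D)) (min (s₁ / Real.exp (γ * (T + 1)))
    (min (1 / 4) (1 / (5 * K₃ * D ^ 3 * (T + 1) + 1)))) with hδ₁
  refine ⟨δ₁, by positivity, fun δ hδ hδ' u w hu hw hu0 hw0 huw x => ?_⟩
  have hb1 : δ * D ≤ 1 / 8 := by
    have : δ ≤ 1 / (8 * D) := hδ'.trans (min_le_left _ _)
    rw [le_div_iff₀ (by positivity)] at this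
    linarith
  have hb2 : δ * Real.exp (γ * (T + 1)) ≤ s₁ := by
    have : δ ≤ s₁ / Real.exp (γ * (T + 1)) :=
      hδ'.trans ((min_le_right _ _).trans (min_le_left _ _))
    rwa [le_div_iff₀ (by positivity)] at this
  have hb3 : δ ≤ 1 / 4 :=
    hδ'.trans ((min_le_right _ _).trans ((min_le_right _ _).trans (min_le_left _ _)))
  have hb4 : 5 * K₃ * D ^ 3 * (T + 1) * δ ≤ 1 := by
    have : δ ≤ 1 / (5 * K₃ * D ^ 3 * (T + 1) + 1) :=
      hδ'.trans ((min_le_right _ _).trans ((min_le_right _ _).trans (min_le_right _ _)))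
    rw [le_div_iff₀ (by positivity)] at this
    linarith
  have hsola : A.IsSolution (fun _ _ => a) := isSolution_const hS.const hfa
  have har : ∀ t ≥ (0 : ℝ), ∀ x : ℝ, a ∈ Icc (0 : ℝ) 1 := fun _ _ _ => ⟨ha.1.le, ha.2.le⟩
  have hexpD : ∀ t ≤ T + 1, Real.exp (Λ * (t + 1)) ≤ D := fun t ht =>
    Real.exp_le_exp.2 (mul_le_mul_of_nonneg_left (by linarith) hΛ0)
  have hexpD' : ∀ t ≤ T + 1, Real.exp (Λ * t) ≤ D := fun t ht =>
    Real.exp_le_exp.2 (mul_le_mul_of_nonneg_left (by linarith) hΛ0)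
  -- solutions starting near `a` are trapped by sub- and supersolutions `a ± δ e^{Λ t}`
  have hnear : ∀ w, A.IsSolution w → (∀ x, |w 0 x - a| ≤ δ) → ∀ t ∈ Icc 0 (T + 1), ∀ x,
      |w t x - a| ≤ δ * D := by
    intro w hw hw0 t ht x
    have hlt : δ * Real.exp (Λ * (t + 1)) < 1 := by
      have := mul_le_mul_of_nonneg_left (hexpD t ht.2) hδ.le
      linarith
    have hu1 := hsola.le_add_of_le_add hS.comp hΛ hΛ0 hw har hδ.le ht.1 hlt
      (fun x => by linarith [(abs_le.1 (hw0 x)).2]) x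
    have hl1 : a ≤ w t x + δ * Real.exp (Λ * t) := by
      have hsub := hΛ.isSubsolution_sub (ε := δ) hδ.le (T := t + 1) (by linarith [ht.1])
        (hsola.isSubsolution (by linarith [ht.1])) (fun _ _ _ => by linarith [ha.2])
        (fun s hs _ => by
          have : δ * Real.exp (Λ * s) ≤ δ * D := by
            refine mul_le_mul_of_nonneg_left (Real.exp_le_exp.2 ?_) hδ.le
            exact mul_le_mul_of_nonneg_left (by linarith [hs.2, ht.2]) hΛ0
          linarith [ha.1])
      have := hS.comp.le_of_le' hΛ hΛ0 (by linarith [ht.1] : 0 < t + 1)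
        (hw.isSupersolution (by linarith [ht.1])) hsub (r := -(1 / 2)) (by norm_num)
        (fun s hs y => by
          have h3 : 0 < δ * Real.exp (Λ * s) := by positivity
          have h4 : δ * Real.exp (Λ * s) ≤ δ * D := by
            refine mul_le_mul_of_nonneg_left (Real.exp_le_exp.2 ?_) hδ.le
            exact mul_le_mul_of_nonneg_left (by linarith [hs.2, ht.2]) hΛ0
          exact ⟨by linarith [ha.1], by linarith [ha.2]⟩) (fun y => by
          simp only [mul_zero, Real.exp_zero, mul_one]
          linarith [(abs_le.1 (hw0 y)).1]) t ⟨ht.1, by linarith⟩ x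
      linarith
    have := mul_le_mul_of_nonneg_left (hexpD' t ht.2) hδ.le
    exact abs_le.2 ⟨by linarith, by linarith⟩
  have hun := hnear u hu hu0
  have hwn := hnear w hw hw0
  -- `u - w + a` is a supersolution up to a quadratic error
  have hreg : A.Regular (T + 1) (fun t x => u t x - w t x + a) := by
    have := ((hu.1 _ hT1).add hT1 ((hw.1 _ hT1).const_mul (-1))).add hT1
      (regular_time (p := fun _ => a) hT1 continuous_const)
    have e : (fun t x => u t x + -1 * w t x + a) = fun t x => u t x - w t x + a := by
      funext t x; ring
    rwa [e] at this
  have hsub : A.IsSubsolution (T + 1) (fun t _ => a + 3 / 8 * δ * Real.exp (γ * t)) := by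
    refine isSubsolution_time hS.const hT1 (p := fun t => a + 3 / 8 * δ * Real.exp (γ * t))
      (p' := fun t => 3 / 8 * δ * (Real.exp (γ * t) * γ)) (by fun_prop) (fun t _ => ?_)
      fun t ht => ?_
    · have := ((((hasDerivAt_id t).const_mul γ).exp).const_mul (3 / 8 * δ)).const_add a
      simpa using this
    · have h1 : Real.exp (γ * t) ≤ Real.exp (γ * (T + 1)) :=
        Real.exp_le_exp.2 (mul_le_mul_of_nonneg_left ht.2.le hγ.le)
      have h2 : 3 / 8 * δ * Real.exp (γ * t) ≤ s₁ := by
        have : δ * Real.exp (γ * t) ≤ δ * Real.exp (γ * (T + 1)) := by gcongr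
        have : 0 < δ * Real.exp (γ * t) := by positivity
        linarith
      have := hgrow (3 / 8 * δ * Real.exp (γ * t)) (by positivity) h2
      linarith
  have hκD : 5 * K₃ * (δ * D) ^ 2 * (T + 1) * D ≤ δ := by
    have : 5 * K₃ * (δ * D) ^ 2 * (T + 1) * D = (5 * K₃ * D ^ 3 * (T + 1) * δ) * δ := by ring
    rw [this]
    nlinarith
  have hT1e : 0 ≤ 5 * K₃ * (δ * D) ^ 2 * (T + 1) := by positivity
  have hcmp := hS.comp.le_add (κ := 5 * K₃ * (δ * D) ^ 2) (ε := 0) hΛ hΛ0 (by positivity) le_rfl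
    hT1 hreg (fun t ht y => by
      refine ⟨_, ((hu.2 t ht.1 y).sub (hw.2 t ht.1 y)).add_const a, ?_⟩
      have := hQ.parallelogram hK₃ ha (hu.mem_dom ht.1) (hw.mem_dom ht.1) (s := δ * D)
        (by linarith) (hun t ⟨ht.1.le, ht.2.le⟩) (hwn t ⟨ht.1.le, ht.2.le⟩) y
      rw [hS.const a y, hfa] at this
      linarith)
    (fun t ht y => by
      have h1 := abs_le.1 (hun t ⟨ht.1.le, ht.2.le⟩ y)
      have h2 := abs_le.1 (hwn t ⟨ht.1.le, ht.2.le⟩ y)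
      linarith [ha.1])
    (r := 5 / 4) (by
      have h1 := mul_le_mul_of_nonneg_left (hexpD' (T + 1) le_rfl) hT1e
      linarith)
    (fun t ht y => by
      have h1 := abs_le.1 (hun t ⟨ht.1.le, ht.2.le⟩ y)
      have h2 := abs_le.1 (hwn t ⟨ht.1.le, ht.2.le⟩ y)
      linarith [ha.2]) hsub (fun y => by
        simp only [mul_zero, Real.exp_zero, mul_one]
        linarith [huw y]) T ⟨hT.le, by linarith⟩ x
  simp only [zero_add] at hcmp
  rw [hγT] at hcmp
  have h1 : 5 * K₃ * (δ * D) ^ 2 * T * Real.exp (Λ * T) ≤ 5 * K₃ * (δ * D) ^ 2 * (T + 1) * D := by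
    have := hexpD' T (by linarith)
    gcongr
    linarith
  linarith

end NonlinOp

end

section

variable {X : Phase}

namespace NonlinOp

variable {A : NonlinOp X} {T : ℝ} {u v w V : ℝ → ℝ → ℝ} {f z U p : ℝ → ℝ} {a c Λ γ s₁ k : ℝ}

/-! ### The width of the transition layer around the unstable state -/

theorem hasDerivAt_growth (a k γ t : ℝ) :
    HasDerivAt (fun t => a + k * Real.exp (γ * t)) (k * (Real.exp (γ * t) * γ)) t := by
  have := ((((hasDerivAt_id t).const_mul γ).exp).const_mul k).const_add a
  simpa using this

/-- The state `a` is unstable from above: `a + k e^{γ t}` is a subsolution while it is close to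
`a`. -/
theorem isSubsolution_growth (hconst : A.OnConstants f) (hγ : 0 ≤ γ)
    (hgrow : ∀ s, 0 ≤ s → s ≤ s₁ → γ * s ≤ f (a + s)) (hk : 0 ≤ k) (hT : 0 < T)
    (hks : k * Real.exp (γ * T) ≤ s₁) :
    A.IsSubsolution T (fun t _ => a + k * Real.exp (γ * t)) := by
  refine isSubsolution_time hconst hT (p := fun t => a + k * Real.exp (γ * t)) (by fun_prop)
    (fun t _ => hasDerivAt_growth a k γ t) fun t ht => ?_
  have h1 : k * Real.exp (γ * t) ≤ k * Real.exp (γ * T) :=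
    mul_le_mul_of_nonneg_left (Real.exp_le_exp.2 (mul_le_mul_of_nonneg_left ht.2.le hγ)) hk
  have := hgrow (k * Real.exp (γ * t)) (by positivity) (h1.trans hks)
  linarith

/-- The state `a` is unstable from below. -/
theorem isSupersolution_growth (hconst : A.OnConstants f) (hγ : 0 ≤ γ)
    (hgrow : ∀ s, 0 ≤ s → s ≤ s₁ → f (a - s) ≤ -(γ * s)) (hk : 0 ≤ k) (hT : 0 < T)
    (hks : k * Real.exp (γ * T) ≤ s₁) :
    A.IsSupersolution T (fun t _ => a + -k * Real.exp (γ * t)) := by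
  refine isSupersolution_time hconst hT (p := fun t => a + -k * Real.exp (γ * t)) (by fun_prop)
    (fun t _ => hasDerivAt_growth a (-k) γ t) fun t ht => ?_
  have h1 : k * Real.exp (γ * t) ≤ k * Real.exp (γ * T) :=
    mul_le_mul_of_nonneg_left (Real.exp_le_exp.2 (mul_le_mul_of_nonneg_left ht.2.le hγ)) hk
  have := hgrow (k * Real.exp (γ * t)) (by positivity) (h1.trans hks)
  have e : a + -k * Real.exp (γ * t) = a - k * Real.exp (γ * t) := by ring
  rw [e]
  linarith

theorem LocalComparison.growth_right {ρ R x₀ : ℝ} (h : A.LocalComparison T ρ R 0)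
    (hconst : A.OnConstants f) (hγ : 0 ≤ γ) (ha : 0 ≤ a)
    (hgrow : ∀ s, 0 ≤ s → s ≤ s₁ → γ * s ≤ f (a + s)) (hk : 0 ≤ k) (hT : 0 < T)
    (hks : k * Real.exp (γ * (T + 1)) ≤ s₁) (hs₁ : a + s₁ ≤ 1)
    (hu : A.IsSolution u) (hur : ∀ t ≥ 0, ∀ x, u t x ∈ Icc (0 : ℝ) 1)
    (h0 : ∀ x ≥ x₀, a + k ≤ u 0 x) :
    ∀ x ≥ x₀ + R, a + k * Real.exp (γ * T) ≤ u T x + ρ := by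
  refine h.lower_right (T := T + 1) (p := fun t => a + k * Real.exp (γ * t)) (by linarith)
    (isSubsolution_growth hconst hγ hgrow hk (by linarith) hks) (fun t ht => ?_) hu hur
    (by simpa using h0) T ⟨hT.le, by linarith⟩ le_rfl
  have h1 : k * Real.exp (γ * t) ≤ k * Real.exp (γ * (T + 1)) :=
    mul_le_mul_of_nonneg_left (Real.exp_le_exp.2 (mul_le_mul_of_nonneg_left ht.2.le hγ)) hk
  have h2 : 0 ≤ k * Real.exp (γ * t) := by positivity
  exact ⟨by linarith, by linarith⟩

theorem LocalComparison.growth_left {ρ R x₀ : ℝ} (h : A.LocalComparison T ρ R 0)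
    (hconst : A.OnConstants f) (hγ : 0 ≤ γ) (ha : a ≤ 1)
    (hgrow : ∀ s, 0 ≤ s → s ≤ s₁ → f (a - s) ≤ -(γ * s)) (hk : 0 ≤ k) (hT : 0 < T)
    (hks : k * Real.exp (γ * (T + 1)) ≤ s₁) (hs₁ : s₁ ≤ a)
    (hu : A.IsSolution u) (hur : ∀ t ≥ 0, ∀ x, u t x ∈ Icc (0 : ℝ) 1)
    (h0 : ∀ x ≤ x₀, u 0 x ≤ a - k) :
    ∀ x ≤ x₀ - R, u T x ≤ a - k * Real.exp (γ * T) + ρ := by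
  intro x hx
  have := h.upper_left (T := T + 1) (p := fun t => a + -k * Real.exp (γ * t)) (by linarith)
    (isSupersolution_growth hconst hγ hgrow hk (by linarith) hks) (fun t ht => by
      have h1 : k * Real.exp (γ * t) ≤ k * Real.exp (γ * (T + 1)) :=
        mul_le_mul_of_nonneg_left (Real.exp_le_exp.2 (mul_le_mul_of_nonneg_left ht.2.le hγ)) hk
      have h2 : 0 ≤ k * Real.exp (γ * t) := by positivity
      exact ⟨by linarith, by linarith⟩) hu hur
    (by simpa [← sub_eq_add_neg] using h0) T ⟨hT.le, by linarith⟩ le_rfl x hx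
  linarith

/-- After a suitable time `T`, the layer in which a monotone solution is `δ`-close to the unstable
state has not become wider, unless its width is bounded by a constant `C`. If a level slightly
above `a` is exceeded soon after the left end of the layer, both ends of the new layer are near
that end, because `a` is unstable; similarly at the right end. Otherwise the solution remains
below `a + δ / 8` for some distance beyond the left end, and it is above `a - δ / 8` already at
some distance before the right end. Translates of two fixed solutions `w⁺ ≥ w⁻ + 3 δ / 8` then lie
below it near the right end and above it near the left end. At the time `T` their distance has
grown to `4 δ`, so that at some point `b` they are at least `2 δ` above and below `a`. Hence both
ends move by essentially `b`, and the layer does not widen. -/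
theorem exists_layer_step (hS : A.Standing f) (hΛ : A.ShiftLipschitz Λ) (hΛ0 : 0 ≤ Λ)
    (hG : A.GloballyBounded) {K₃ : ℝ} (hQ : A.QuadraticBound K₃) (hK₃ : 0 ≤ K₃)
    (hC2 : A.UniformC2) (hsemi : A.GeneratesSemigroup)
    (ha : a ∈ Ioo (0 : ℝ) 1) (hfa : f a = 0) (hd : 0 < _root_.deriv f a) {M : ℝ} (hM : 0 < M) :
    ∃ T > 0, ∃ δ > 0, δ < a ∧ a + δ < 1 ∧ ∃ C, ∀ u, A.IsSolution u →
      (∀ t ≥ 0, ∀ x, u t x ∈ Icc (0 : ℝ) 1) → Monotone (u 0) →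
      (∀ x y, |u 0 x - u 0 y| ≤ M * |x - y|) →
      ∀ p q, (∀ x ≤ p, u 0 x ≤ a - δ) → (∀ x ≥ q, a + δ ≤ u 0 x) →
      ∃ p' q', (∀ x ≤ p', u T x ≤ a - δ) ∧ (∀ x ≥ q', a + δ ≤ u T x) ∧ q' - p' ≤ max C (q - p) := by
  obtain ⟨s₀, hs₀, hgrow₀⟩ := exists_linear_growth
    (hS.bistable.1.differentiable (by norm_num) a) hfa hd
  set γ := _root_.deriv f a / 2 with hγ
  have hγ0 : 0 < γ := half_pos hd
  set s₁ := min s₀ (min a (1 - a)) with hs₁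
  have hs₁0 : 0 < s₁ := lt_min hs₀ (lt_min ha.1 (by linarith [ha.2]))
  have hs₁a : s₁ ≤ a := (min_le_right _ _).trans (min_le_left _ _)
  have hs₁1 : a + s₁ ≤ 1 := by
    have : s₁ ≤ 1 - a := (min_le_right _ _).trans (min_le_right _ _)
    linarith
  have hgrow : ∀ s, 0 ≤ s → s ≤ s₁ → γ * s ≤ f (a + s) := fun s h h' =>
    (hgrow₀ s h (h'.trans (min_le_left _ _))).1
  have hgrow' : ∀ s, 0 ≤ s → s ≤ s₁ → f (a - s) ≤ -(γ * s) := fun s h h' =>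
    (hgrow₀ s h (h'.trans (min_le_left _ _))).2
  set T := Real.log 16 / γ with hT
  have hT0 : 0 < T := div_pos (Real.log_pos (by norm_num)) hγ0
  have hγT : Real.exp (γ * T) = 16 := by
    rw [hT, mul_div_cancel₀ _ hγ0.ne', Real.exp_log (by norm_num)]
  obtain ⟨δ₁, hδ₁, hsep⟩ := exists_separation hS hΛ hΛ0 hQ hK₃ ha hfa hγ0 hs₁0 hgrow hT0 hγT
  set δ := min δ₁ (s₁ / (2 * Real.exp (γ * (T + 1)))) with hδ
  have hδ0 : 0 < δ := by positivity
  have hδe : δ * Real.exp (γ * (T + 1)) ≤ s₁ / 2 := by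
    have : δ ≤ s₁ / (2 * Real.exp (γ * (T + 1))) := min_le_right _ _
    rw [le_div_iff₀ (by positivity)] at this
    linarith
  have hδs : δ < s₁ := by
    have : 1 ≤ Real.exp (γ * (T + 1)) := Real.one_le_exp (by positivity)
    nlinarith
  have hks : ∀ k, 0 ≤ k → k ≤ δ → k * Real.exp (γ * (T + 1)) ≤ s₁ := fun k hk hkδ => by
    have : k * Real.exp (γ * (T + 1)) ≤ δ * Real.exp (γ * (T + 1)) := by gcongr
    linarith
  -- over the length `l` the solution changes by at most `δ / 2`
  set l := δ / (2 * M) with hl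
  have hl0 : 0 < l := by positivity
  have hMl : M * l = δ / 2 := by rw [hl]; field_simp
  obtain ⟨R₁, hR₁, hLC⟩ := exists_localComparison hS hG T hδ0
  have hright : ∀ {k x₀ : ℝ}, 0 ≤ k → k ≤ δ → ∀ {u}, A.IsSolution u →
      (∀ t ≥ 0, ∀ x, u t x ∈ Icc (0 : ℝ) 1) → (∀ x ≥ x₀, a + k ≤ u 0 x) →
      ∀ x ≥ x₀ + R₁, a + k * 16 ≤ u T x + δ := by
    intro k x₀ hk hkδ u hu hur h0
    have := hLC.growth_right hS.const hγ0.le ha.1.le hgrow hk hT0 (hks k hk hkδ) hs₁1 hu hur h0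
    rwa [hγT] at this
  have hleft : ∀ {k x₀ : ℝ}, 0 ≤ k → k ≤ δ → ∀ {u}, A.IsSolution u →
      (∀ t ≥ 0, ∀ x, u t x ∈ Icc (0 : ℝ) 1) → (∀ x ≤ x₀, u 0 x ≤ a - k) →
      ∀ x ≤ x₀ - R₁, u T x ≤ a - k * 16 + δ := by
    intro k x₀ hk hkδ u hu hur h0
    have := hLC.growth_left hS.const hγ0.le ha.2.le hgrow' hk hT0 (hks k hk hkδ) hs₁a hu hur h0
    rwa [hγT] at this
  -- the two auxiliary solutions
  have hθ : ∀ x, Real.smoothTransition (x / l) ∈ Icc (0 : ℝ) 1 := fun x =>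
    ⟨Real.smoothTransition.nonneg _, Real.smoothTransition.le_one _⟩
  have hθ0 : ∀ x ≤ 0, Real.smoothTransition (x / l) = 0 := fun x hx =>
    Real.smoothTransition.zero_of_nonpos (div_nonpos_of_nonpos_of_nonneg hx hl0.le)
  have hθ1 : ∀ x ≥ l, Real.smoothTransition (x / l) = 1 := fun x hx =>
    Real.smoothTransition.one_of_one_le ((one_le_div hl0).2 hx)
  have hw : ∀ p, a - δ / 2 ≤ p → p ≤ a - δ / 8 → ∃ w, A.IsSolution w ∧
      (∀ x, w 0 x = p + 5 / 8 * δ * Real.smoothTransition (x / l)) ∧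
      (∀ t ≥ 0, ∀ x, w t x ∈ Icc (0 : ℝ) 1) ∧ Continuous (w T) ∧ ∀ x, |w 0 x - a| ≤ δ := by
    intro p hp1 hp2
    have hg := isCkb_smoothStep p (5 / 8 * δ) hl0 3
    obtain ⟨w, hw, hw0⟩ := hsemi.exists_solution (hg.mem_space (X := X))
    have hr : ∀ x, w 0 x - a ∈ Icc (-(δ / 2)) (δ / 2) := fun x => by
      have h1 := mul_nonneg hδ0.le (hθ x).1
      have h2 := mul_le_mul_of_nonneg_left (hθ x).2 hδ0.le
      rw [hw0]
      constructor <;> dsimp only <;> linarith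
    have hw01 : ∀ x, w 0 x ∈ Icc (0 : ℝ) 1 := fun x =>
      ⟨by linarith [(hr x).1], by linarith [(hr x).2]⟩
    obtain ⟨K, hK⟩ := hC2 w hw hw01 (by rw [hw0]; exact hg)
    exact ⟨w, hw, fun x => by rw [hw0],
      hw.mem_Icc hS.comp hΛ hΛ0 hS.const hS.bistable.2.1 hS.bistable.2.2.1 hw01,
      (hK T hT0.le).1.continuous,
      fun x => abs_le.2 ⟨by linarith [(hr x).1], by linarith [(hr x).2]⟩⟩
  obtain ⟨wp, hwp, hwp0, hwpr, hwpc, hwpa⟩ := hw (a - δ / 8) (by linarith) le_rfl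
  obtain ⟨wm, hwm, hwm0, hwmr, -, hwma⟩ := hw (a - δ / 2) le_rfl (by linarith)
  -- the point at which the two solutions are separated from `a` at the time `T`
  obtain ⟨b, hb⟩ : ∃ b, wp T b = a + 2 * δ := by
    have h1 := hleft (k := δ / 8) (x₀ := 0) (by positivity) (by linarith) hwp hwpr (fun x hx => by
      rw [hwp0, hθ0 x hx]; linarith) (0 - R₁) le_rfl
    have h2 := hright (k := δ / 2) (x₀ := l) (by positivity) (by linarith) hwp hwpr (fun x hx => by
      rw [hwp0, hθ1 x hx]; linarith) (l + R₁) le_rfl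
    exact mem_range_of_exists_le_of_exists_ge hwpc ⟨0 - R₁, by linarith⟩ ⟨l + R₁, by linarith⟩
  have hbm : wm T b ≤ a - 2 * δ := by
    have := hsep δ hδ0 (min_le_left _ _) wp wm hwp hwm hwpa hwma (fun x => by
      rw [hwp0, hwm0]; linarith) b
    linarith
  set R := R₁ + |b| with hR
  have hbb := abs_le.1 (le_refl |b|)
  have hT1 : 0 < T + 1 := by linarith
  refine ⟨T, hT0, δ, hδ0, by linarith, by linarith, R + 2 * R₁,
    fun u hu hur hmono hlip p q hp hq => ?_⟩
  have hp1 : ∀ x ≤ p + l, u 0 x ≤ a - δ / 2 := fun x hx => by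
    have h1 := hmono hx
    have h2 := hlip (p + l) p
    rw [add_sub_cancel_left, abs_of_pos hl0] at h2
    linarith [(abs_le.1 h2).2, hp p le_rfl]
  have hq1 : ∀ x ≥ q - l, a + δ / 2 ≤ u 0 x := fun x hx => by
    have h1 := hmono hx
    have h2 := hlip (q - l) q
    rw [sub_sub_cancel_left, abs_neg, abs_of_pos hl0] at h2
    linarith [(abs_le.1 h2).1, hq q le_rfl]
  by_cases c1 : ∃ x ≤ p + l + R, a + δ / 8 ≤ u 0 x
  · obtain ⟨x, hx, hux⟩ := c1
    have h1 := hright (k := δ / 8) (x₀ := p + l + R) (by positivity) (by linarith) hu hur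
      (fun y hy => hux.trans (hmono (by linarith)))
    have h2 := hleft (k := δ / 2) (x₀ := p + l) (by positivity) (by linarith) hu hur hp1
    refine ⟨p + l - R₁, p + l + R + R₁, fun y hy => ?_, fun y hy => ?_, ?_⟩
    · linarith [h2 y hy]
    · linarith [h1 y hy]
    · exact le_max_of_le_left (by linarith)
  by_cases c2 : ∃ x ≥ q - l - R, u 0 x ≤ a - δ / 8
  · obtain ⟨x, hx, hux⟩ := c2
    have h1 := hright (k := δ / 2) (x₀ := q - l) (by positivity) (by linarith) hu hur hq1
    have h2 := hleft (k := δ / 8) (x₀ := q - l - R) (by positivity) (by linarith) hu hur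
      (fun y hy => (hmono (by linarith)).trans hux)
    refine ⟨q - l - R - R₁, q - l + R₁, fun y hy => ?_, fun y hy => ?_, ?_⟩
    · linarith [h2 y hy]
    · linarith [h1 y hy]
    · exact le_max_of_le_left (by linarith)
  -- neither level is crossed near the ends: comparison with `w⁺` at the right end `q`, with `w⁻` at
  -- the left end `p`
  push Not at c1 c2
  have hTmono := hu.monotone hS hΛ hΛ0 hur hmono hT0.le
  have h1 : wp T b ≤ u T (b + (q - l)) + δ :=
    hLC (T + 1) hT1 (fun t x => u t (x + (q - l))) wp
      ((hu.translate hS.trans _).isSupersolution hT1) (hwp.isSubsolution hT1)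
      (fun t ht x => hur t ht.1 _) (fun t ht x => hwpr t ht.1 x) b (fun y hy => by
        have hy' := abs_le.1 hy
        rw [hwp0, add_zero]
        rcases le_total y 0 with h | h
        · rw [hθ0 y h]
          linarith [c2 (y + (q - l)) (by linarith)]
        · have := mul_le_mul_of_nonneg_left (hθ y).2 hδ0.le
          linarith [hq1 (y + (q - l)) (by linarith)]) T ⟨hT0.le, by linarith⟩ le_rfl
  have h2 : u T (b + (p + l - l)) ≤ wm T b + δ :=
    hLC (T + 1) hT1 wm (fun t x => u t (x + (p + l - l)))
      (hwm.isSupersolution hT1) ((hu.translate hS.trans _).isSubsolution hT1)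
      (fun t ht x => hwmr t ht.1 x) (fun t ht x => hur t ht.1 _) b (fun y hy => by
        have hy' := abs_le.1 hy
        rw [hwm0, add_zero]
        rcases le_total l y with h | h
        · rw [hθ1 y h]
          linarith [c1 (y + (p + l - l)) (by linarith)]
        · have := mul_nonneg hδ0.le (hθ y).1
          linarith [hp1 (y + (p + l - l)) (by linarith)]) T ⟨hT0.le, by linarith⟩ le_rfl
  refine ⟨b + (p + l - l), b + (q - l), fun y hy => ?_, fun y hy => ?_, ?_⟩
  · linarith [hTmono hy]
  · linarith [hTmono hy]
  · exact le_max_of_le_right (by linarith)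

end NonlinOp

end

section

variable {X : Phase}

/-! ### A solution with a transition layer of bounded width -/

theorem SignPattern.eq_zero {f : ℝ → ℝ} {a : ℝ} (h : SignPattern f a a) (hf : Continuous f)
    (ha : a ∈ Ioo (0 : ℝ) 1) : f a = 0 := by
  apply le_antisymm
  · refine le_of_tendsto (hf.continuousAt.tendsto.mono_left (nhdsWithin_le_nhds (s := Iio a))) ?_
    filter_upwards [Ioo_mem_nhdsLT ha.1] with s hs using (h.2 s (Or.inl hs)).le
  · refine ge_of_tendsto (hf.continuousAt.tendsto.mono_left (nhdsWithin_le_nhds (s := Ioi a))) ?_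
    filter_upwards [Ioo_mem_nhdsGT ha.2] with s hs using (h.1 s (Or.inr hs)).le

namespace BoundedCk

variable {M : ℝ} {g : ℝ → ℝ}

theorem differentiable (h : BoundedCk 2 M g) : Differentiable ℝ g :=
  h.1.differentiable (by norm_num)

theorem abs_deriv_le (h : BoundedCk 2 M g) (x : ℝ) : |deriv g x| ≤ M := by
  simpa [iteratedDeriv_one] using h.2 1 (by norm_num) x

theorem nonneg (h : BoundedCk 2 M g) : 0 ≤ M := (abs_nonneg _).trans (h.abs_deriv_le 0)

theorem abs_sub_le (h : BoundedCk 2 M g) (x y : ℝ) : |g x - g y| ≤ M * |x - y| := by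
  have := Convex.norm_image_sub_le_of_norm_deriv_le (f := g) (s := univ) (C := M)
    (fun z _ => h.differentiable z) (fun z _ => h.abs_deriv_le z) convex_univ (mem_univ y)
    (mem_univ x)
  simpa using this

theorem abs_deriv_sub_le (h : BoundedCk 2 M g) (x y : ℝ) :
    |deriv g x - deriv g y| ≤ M * |x - y| := by
  have hd : ContDiff ℝ 1 (deriv g) := h.1.deriv'
  have := Convex.norm_image_sub_le_of_norm_deriv_le (f := deriv g) (s := univ) (C := M)
    (fun z _ => hd.differentiable (by norm_num) z) (fun z _ => by
      have := h.2 2 le_rfl z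
      rw [iteratedDeriv_succ, iteratedDeriv_one] at this
      exact this) convex_univ (mem_univ y) (mem_univ x)
  simpa using this

/-- Difference quotients approximate the derivative. -/
theorem abs_sub_sub_deriv_le (h : BoundedCk 2 M g) (x : ℝ) {s : ℝ} (hs : 0 ≤ s) :
    |g (x + s) - g x - deriv g x * s| ≤ M * s * s := by
  have := Convex.norm_image_sub_le_of_norm_deriv_le (f := fun y => g y - deriv g x * y)
    (s := Icc x (x + s)) (C := M * s)
    (fun z _ => (h.differentiable z).sub (by fun_prop)) (fun z hz => by
      have h1 : HasDerivAt (fun y => g y - deriv g x * y) (deriv g z - deriv g x * 1) z :=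
        (h.differentiable z).hasDerivAt.sub ((hasDerivAt_id z).const_mul _)
      rw [h1.deriv, mul_one, Real.norm_eq_abs]
      refine (h.abs_deriv_sub_le z x).trans (mul_le_mul_of_nonneg_left ?_ h.nonneg)
      rw [abs_of_nonneg (by linarith [hz.1])]
      linarith [hz.2]) (convex_Icc _ _) (left_mem_Icc.2 (by linarith))
    (right_mem_Icc.2 (by linarith) : x + s ∈ Icc x (x + s))
  simp only [Real.norm_eq_abs, add_sub_cancel_left, abs_of_nonneg hs] at this
  have e : g (x + s) - deriv g x * (x + s) - (g x - deriv g x * x)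
    = g (x + s) - g x - deriv g x * s := by ring
  rwa [e] at this

end BoundedCk

namespace NonlinOp

variable {A : NonlinOp X} {T : ℝ} {u v w V : ℝ → ℝ → ℝ} {f z U p : ℝ → ℝ} {a c Λ γ s₁ k : ℝ}

/-- There is a monotone solution which at all times runs from `0` to `1` within an interval of
bounded length, namely the one starting from a smooth step: the layer around the unstable state
remains bounded at the multiples of `T` by `exists_layer_step`, and outside of the layer the
solution converges to the stable states by `exists_sink` and `exists_raise`. -/
theorem exists_localized (hS : A.Standing f) (hΛ : A.ShiftLipschitz Λ) (hΛ0 : 0 ≤ Λ)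
    (hG : A.GloballyBounded) {K₃ : ℝ} (hQ : A.QuadraticBound K₃) (hK₃ : 0 ≤ K₃)
    (hC2 : A.UniformC2) (hsemi : A.GeneratesSemigroup)
    (ha : a ∈ Ioo (0 : ℝ) 1) (hsign : SignPattern f a a) (hd : 0 < _root_.deriv f a) :
    ∃ v, A.IsSolution v ∧ (∀ t ≥ 0, ∀ x, v t x ∈ Icc (0 : ℝ) 1) ∧ (∀ t ≥ 0, Monotone (v t)) ∧
      (∃ M, ∀ t ≥ 0, BoundedCk 2 M (v t)) ∧
      ∀ ρ > 0, ∃ C, ∀ t ≥ 0, ∃ y, (∀ x ≤ y - C, v t x ≤ ρ) ∧ ∀ x ≥ y + C, 1 - ρ ≤ v t x := by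
  have hfa := hsign.eq_zero hS.bistable.1.continuous ha
  have hg := isCkb_smoothStep 0 1 one_pos 3
  obtain ⟨v, hv, hv0⟩ := hsemi.exists_solution (hg.mem_space (X := X))
  simp only [div_one, zero_add, one_mul] at hv0 hg
  have hv01 : ∀ x, v 0 x ∈ Icc (0 : ℝ) 1 := fun x => by
    rw [hv0]; exact ⟨Real.smoothTransition.nonneg _, Real.smoothTransition.le_one _⟩
  have hvr := hv.mem_Icc hS.comp hΛ hΛ0 hS.const hS.bistable.2.1 hS.bistable.2.2.1 hv01
  have hvm : ∀ t ≥ 0, Monotone (v t) := fun t ht => hv.monotone hS hΛ hΛ0 hvr (by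
    rw [hv0]; exact Real.smoothTransition.monotone) ht
  obtain ⟨M, hM⟩ := hC2 v hv hv01 (by rw [hv0]; exact hg)
  have hv00 : ∀ x ≤ 0, v 0 x = 0 := fun x hx => by
    rw [hv0]; exact Real.smoothTransition.zero_of_nonpos hx
  have hv10 : ∀ x ≥ 1, v 0 x = 1 := fun x hx => by
    rw [hv0]; exact Real.smoothTransition.one_of_one_le hx
  refine ⟨v, hv, hvr, hvm, ⟨M, hM⟩, fun ρ hρ => ?_⟩
  have hM0 : 0 ≤ M := (hM 0 le_rfl).nonneg
  obtain ⟨T, hT, δ, hδ, hδa, hδ1, C, hC⟩ := exists_layer_step hS hΛ hΛ0 hG hQ hK₃ hC2 hsemi ha hfa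
    hd (M := M + 1) (by linarith)
  have hshift : ∀ s ≥ 0, A.IsSolution (fun t => v (s + t)) ∧
      ∀ t ≥ (0 : ℝ), ∀ x, v (s + t) x ∈ Icc (0 : ℝ) 1 := fun s hs =>
    ⟨hv.shift hs, fun t ht x => hvr _ (add_nonneg hs ht) x⟩
  have key : ∀ n : ℕ, ∃ p q, (∀ x ≤ p, v (n * T) x ≤ a - δ) ∧ (∀ x ≥ q, a + δ ≤ v (n * T) x) ∧
      q - p ≤ max C 1 := by
    intro n
    induction n with
    | zero =>
      refine ⟨0, 1, fun x hx => ?_, fun x hx => ?_, by simp⟩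
      · rw [Nat.cast_zero, zero_mul, hv00 x hx]; linarith
      · rw [Nat.cast_zero, zero_mul, hv10 x hx]; linarith
    | succ n ih =>
      obtain ⟨p, q, hp, hq, hpq⟩ := ih
      have hn : (0 : ℝ) ≤ n * T := by positivity
      obtain ⟨p', q', hp', hq', hpq'⟩ := hC (fun t => v (n * T + t)) (hshift _ hn).1 (hshift _ hn).2
        (by simpa using hvm _ hn) (fun x y => by
          simp only [add_zero]
          exact ((hM _ hn).abs_sub_le x y).trans
            (mul_le_mul_of_nonneg_right (by linarith) (abs_nonneg _)))
        p q (by simpa using hp) (by simpa using hq)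
      have e : ((n + 1 : ℕ) : ℝ) * T = n * T + T := by push_cast; ring
      rw [e]
      exact ⟨p', q', hp', hq', hpq'.trans (max_le (le_max_left _ _) hpq)⟩
  obtain ⟨S₁, hS₁, hsink⟩ := exists_sink hS hG ha.2.le (fun s hs => hsign.2 s (Or.inl hs))
    (b := a - δ) ⟨by linarith, by linarith⟩ hρ
  obtain ⟨S₂, hS₂, hraise⟩ := exists_raise hS hG ha.1.le (fun s hs => hsign.1 s (Or.inr hs))
    (b := a + δ) ⟨by linarith, by linarith⟩ hρ
  set S := S₁ + S₂ with hSS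
  obtain ⟨R₁, hR₁⟩ := hsink (S₂ + T) (by linarith)
  obtain ⟨R₂, hR₂⟩ := hraise (S₁ + T) (by linarith)
  obtain ⟨R₃, hR₃, hLC⟩ := exists_localComparison hS hG S hρ
  refine ⟨max C 1 + |R₁| + |R₂| + R₃ + 1, fun t ht => ?_⟩
  have hC1 : 1 ≤ max C 1 := le_max_right _ _
  have a1 := le_abs_self R₁
  have a2 := le_abs_self R₂
  have a3 := abs_nonneg R₁
  have a4 := abs_nonneg R₂
  rcases le_or_gt S t with h | h
  · -- start from the last multiple of `T` before `t - S`
    set n := ⌊(t - S) / T⌋₊ with hn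
    have h1 : n * T ≤ t - S := by
      rw [← le_div_iff₀ hT]; exact Nat.floor_le (div_nonneg (by linarith) hT.le)
    have h2 : t - S < (n + 1) * T := by
      rw [← div_lt_iff₀ hT]; exact Nat.lt_floor_add_one _
    have hn0 : (0 : ℝ) ≤ n * T := by positivity
    obtain ⟨p, q, hp, hq, hpq⟩ := key n
    refine ⟨p, fun x hx => ?_, fun x hx => ?_⟩
    · have := hR₁ _ (hshift _ hn0).1 (hshift _ hn0).2 p (by simpa using hp) (t - n * T)
        ⟨by linarith, by linarith⟩ x (by linarith)
      simpa using this
    · have := hR₂ _ (hshift _ hn0).1 (hshift _ hn0).2 q (by simpa using hq) (t - n * T)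
        ⟨by linarith, by linarith⟩ x (by linarith)
      simpa using this
  · have ht1 : 0 < t + 1 := by linarith
    refine ⟨0, fun x hx => ?_, fun x hx => ?_⟩
    · have := hLC.upper_left (p := fun _ => 0) (x₀ := 0) ht1
        (isSupersolution_of_const hS.const ht1 hS.bistable.2.1.le) (fun _ _ => by simp) hv hvr
        (fun x hx => (hv00 x hx).le) t ⟨ht, by linarith⟩ h.le x (by linarith)
      linarith
    · have := hLC.lower_right (p := fun _ => 1) (x₀ := 1) ht1
        (isSubsolution_of_const hS.const ht1 hS.bistable.2.2.1.ge) (fun _ _ => by simp) hv hvr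
        (fun x hx => (hv10 x hx).ge) t ⟨ht, by linarith⟩ h.le x (by linarith)
      linarith

end NonlinOp

end

section

variable {X : Phase}

/-! ### Steepness of solutions with a transition layer of bounded width -/

/-- Interpolation: the difference of the derivatives is controlled by differences of the
functions. -/
theorem BoundedCk.abs_deriv_sub_deriv_le {M : ℝ} {g h : ℝ → ℝ} (hg : BoundedCk 2 M g)
    (hh : BoundedCk 2 M h) (x : ℝ) {s : ℝ} (hs : 0 ≤ s) :
    |deriv g x - deriv h x| * s ≤ 2 * M * s * s + |g (x + s) - h (x + s)| + |g x - h x| := by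
  have h1 := abs_le.1 (hg.abs_sub_sub_deriv_le x hs)
  have h2 := abs_le.1 (hh.abs_sub_sub_deriv_le x hs)
  have h3 := abs_le.1 (le_refl |g (x + s) - h (x + s)|)
  have h4 := abs_le.1 (le_refl |g x - h x|)
  have : |(deriv g x - deriv h x) * s|
      ≤ 2 * M * s * s + |g (x + s) - h (x + s)| + |g x - h x| :=
    abs_le.2 ⟨by linarith [h1.1, h1.2, h2.1, h2.2, h3.1, h3.2, h4.1, h4.2],
      by linarith [h1.1, h1.2, h2.1, h2.2, h3.1, h3.2, h4.1, h4.2]⟩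
  rwa [abs_mul, abs_of_nonneg hs] at this

theorem tendsto_deriv_of_boundedCk {ι : Type*} {l : Filter ι} {M : ℝ} {g : ι → ℝ → ℝ} {h : ℝ → ℝ}
    (hg : ∀ᶠ i in l, BoundedCk 2 M (g i)) (hh : BoundedCk 2 M h)
    (hlim : ∀ x, Tendsto (fun i => g i x) l (𝓝 (h x))) (x : ℝ) :
    Tendsto (fun i => deriv (g i) x) l (𝓝 (deriv h x)) := by
  have hM := hh.nonneg
  rw [Metric.tendsto_nhds]
  intro ε hε
  set s := ε / (4 * (M + 1)) with hs
  have hs0 : 0 < s := by positivity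
  have hMs : 2 * M * s ≤ ε / 2 := by
    have : 4 * (M + 1) * s = ε := by rw [hs]; field_simp
    nlinarith
  have h1 := Metric.tendsto_nhds.1 (hlim (x + s)) (ε * s / 4) (by positivity)
  have h2 := Metric.tendsto_nhds.1 (hlim x) (ε * s / 4) (by positivity)
  filter_upwards [hg, h1, h2] with i hi h1 h2
  rw [Real.dist_eq] at *
  have h3 := hi.abs_deriv_sub_deriv_le hh x hs0.le
  have h4 := mul_le_mul_of_nonneg_right hMs hs0.le
  by_contra! hcon
  have := mul_le_mul_of_nonneg_right hcon hs0.le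
  linarith

namespace NonlinOp

variable {A : NonlinOp X} {T : ℝ} {u v w V : ℝ → ℝ → ℝ} {f z U p : ℝ → ℝ} {a c Λ γ s₁ k M : ℝ}

theorem ComparisonAtAllTimes.atOne (h : A.ComparisonAtAllTimes) : A.ComparisonAtOne := by
  obtain ⟨η, hpos, hc, h⟩ := h
  have hc1 : ContinuousOn (fun r => η r 1) (Ici 0) :=
    hc.comp (f := fun r : ℝ => (r, (1 : ℝ))) (by fun_prop) fun r hr => ⟨hr, mem_Ioi.2 one_pos⟩
  have hcI : ∀ m, IsCompact ((fun r => η r 1) '' Icc 0 m) := fun m =>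
    isCompact_Icc.image_of_continuousOn (hc1.mono fun r hr => hr.1)
  have hne : ∀ m ≥ (0 : ℝ), ((fun r => η r 1) '' Icc 0 m).Nonempty := fun m hm =>
    ⟨_, 0, ⟨le_rfl, hm⟩, rfl⟩
  refine ⟨fun m => sInf ((fun r => η r 1) '' Icc 0 m), fun m hm => ?_, fun m hm n hn hmn => ?_,
    fun T hT u v huv m hm x hx => ?_⟩
  · obtain ⟨r, hr, he⟩ := (hcI m).sInf_mem (hne m (by linarith))
    dsimp only at he ⊢
    rw [← he]
    exact hpos r hr.1 1 one_pos
  · exact csInf_le_csInf (hcI n).bddBelow (hne m (by linarith [mem_Ici.1 hm]))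
      (image_mono (Icc_subset_Icc le_rfl hmn))
  · refine le_trans ?_ (h T (by linarith) u v huv 1 ⟨one_pos, hT⟩ x)
    refine mul_le_mul_of_nonneg_right ?_ ?_
    · exact csInf_le (hcI m).bddBelow ⟨|x|, ⟨abs_nonneg x, abs_le.2 hx⟩, rfl⟩
    · exact intervalIntegral.integral_nonneg zero_le_one fun y _ => sub_nonneg.2 (huv.2.2.2 y)

/-- The strong comparison applied to two translates of a monotone solution, in the limit of a
small translation: an increase over an interval of length one becomes a positive slope everywhere
one unit of time later. -/
theorem mul_le_deriv (htrans : A.TranslationInvariant) {η : ℝ → ℝ → ℝ}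
    (hη0 : ∀ r ≥ 0, ∀ t > 0, 0 < η r t)
    (hη : ∀ T > 0, ∀ u v : ℝ → ℝ → ℝ, A.OrderedPair T u v → ∀ t ∈ Ioo 0 T, ∀ x,
        η |x| t * ∫ y in (0 : ℝ)..1, (u 0 y - v 0 y) ≤ u t x - v t x)
    (hv : A.IsSolution v) (hvr : ∀ t ≥ 0, ∀ x, v t x ∈ Icc (0 : ℝ) 1)
    (hvm : ∀ t ≥ 0, Monotone (v t)) (hM : ∀ t ≥ 0, BoundedCk 2 M (v t)) {t : ℝ} (ht : 1 ≤ t)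
    (x Y : ℝ) :
    η |x - Y| 1 * (v (t - 1) (Y + 1) - v (t - 1) Y) ≤ _root_.deriv (v t) x := by
  have ht1 : 0 ≤ t - 1 := by linarith
  have hM0 : 0 ≤ M := (hM 0 le_rfl).nonneg
  set e := η |x - Y| 1 with he
  have he0 : 0 < e := hη0 _ (abs_nonneg _) 1 one_pos
  set J := v (t - 1) (Y + 1) - v (t - 1) Y with hJ
  have hb := hM _ ht1
  have key : ∀ h > 0, e * J * h ≤ _root_.deriv (v t) x * h + (M + e * M) * h * h := by
    intro h hh
    have hsh := (hv.shift ht1).translate htrans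
    have hr : ∀ s : ℝ, 0 ≤ s → ∀ y, v (t - 1 + s) y ∈ Icc (-1 : ℝ) 2 := fun s hs y => by
      have := hvr (t - 1 + s) (by linarith) y
      exact ⟨by linarith [this.1], by linarith [this.2]⟩
    have h1 := hη 2 two_pos (fun s y => v (t - 1 + s) (y + (Y + h)))
      (fun s y => v (t - 1 + s) (y + Y))
      ⟨(hsh (Y + h)).isSupersolution two_pos, (hsh Y).isSubsolution two_pos,
        fun s hs y => ⟨hr s hs.1 _, hr s hs.1 _⟩, fun y => hvm _ (by simpa using ht1) (by linarith)⟩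
      1 ⟨one_pos, one_lt_two⟩ (x - Y)
    simp only [add_zero, sub_add_cancel] at h1
    rw [show x - Y + (Y + h) = x + h by ring] at h1
    have h2 : h * J - M * h * h
        ≤ ∫ y in (0 : ℝ)..1, (v (t - 1) (y + (Y + h)) - v (t - 1) (y + Y)) := by
      have hd : ∀ y, HasDerivAt (fun y => v (t - 1) (y + Y)) (_root_.deriv (v (t - 1)) (y + Y)) y :=
        fun y => (hb.differentiable (y + Y)).hasDerivAt.comp_add_const y Y
      have hdc : Continuous (_root_.deriv (v (t - 1))) :=
        (hb.1.continuous_deriv (by norm_num))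
      have hvc := hb.1.continuous
      have hint : ∫ y in (0 : ℝ)..1, (_root_.deriv (v (t - 1)) (y + Y) * h - M * h * h)
          = h * J - M * h * h := by
        rw [intervalIntegral.integral_sub
          (by apply Continuous.intervalIntegrable; fun_prop) (by simp),
          intervalIntegral.integral_mul_const,
          intervalIntegral.integral_eq_sub_of_hasDerivAt (fun y _ => hd y)
            (by apply Continuous.intervalIntegrable; fun_prop)]
        simp [hJ, add_comm, mul_comm]
      rw [← hint]
      refine intervalIntegral.integral_mono_on zero_le_one
        (by apply Continuous.intervalIntegrable; fun_prop)
        (by apply Continuous.intervalIntegrable; fun_prop) fun y _ => ?_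
      have := (abs_le.1 (hb.abs_sub_sub_deriv_le (y + Y) hh.le)).1
      rw [show y + (Y + h) = y + Y + h by ring]
      linarith
    have h3 := (abs_le.1 ((hM t (by linarith)).abs_sub_sub_deriv_le x hh.le)).2
    have h4 := mul_le_mul_of_nonneg_left h2 he0.le
    linarith
  refine le_of_forall_pos_le_add fun ε hε => ?_
  set h := ε / (M + e * M + 1) with hh
  have hq : 0 < M + e * M + 1 := by positivity
  have hh0 : 0 < h := by positivity
  have h1 : (M + e * M) * h ≤ ε := by
    have : (M + e * M + 1) * h = ε := by rw [hh]; field_simp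
    linarith
  have h2 := key h hh0
  have h3 := mul_le_mul_of_nonneg_right h1 hh0.le
  by_contra! hcon
  have := mul_lt_mul_of_pos_right hcon hh0
  linarith

/-- A monotone solution with a layer of bounded length is a front around its level set `1 / 2`. The
level set moves at bounded speed because the comparison is local, and the solution is steep near it
by `mul_le_deriv`, because one unit of time earlier it increases by `1 / 2` over a bounded
length. -/
theorem exists_isFront (hS : A.Standing f) (hG : A.GloballyBounded) (hη : A.ComparisonAtAllTimes)
    (ha : a ∈ Ioo (0 : ℝ) 1) (hsign : SignPattern f a a)
    (hv : A.IsSolution v) (hvr : ∀ t ≥ 0, ∀ x, v t x ∈ Icc (0 : ℝ) 1)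
    (hvm : ∀ t ≥ 0, Monotone (v t)) (hM : ∀ t ≥ 0, BoundedCk 2 M (v t))
    (htails : ∀ ρ > 0, ∃ C, ∀ t ≥ 0, ∃ y, (∀ x ≤ y - C, v t x ≤ ρ) ∧ ∀ x ≥ y + C, 1 - ρ ≤ v t x) :
    ∃ z, A.IsFront v z := by
  have hM0 : 0 ≤ M := (hM 0 le_rfl).nonneg
  have hz : ∀ t : ℝ, ∃ z, 0 ≤ t → v t z = 1 / 2 := by
    intro t
    rcases lt_or_ge t 0 with h | h
    · exact ⟨0, fun h' => absurd h' (not_le.2 h)⟩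
    obtain ⟨C, hC⟩ := htails (1 / 4) (by norm_num)
    obtain ⟨y, h1, h2⟩ := hC t h
    obtain ⟨z, hz⟩ := mem_range_of_exists_le_of_exists_ge (hM t h).1.continuous (c := 1 / 2)
      ⟨y - C, by linarith [h1 _ le_rfl]⟩ ⟨y + C, by linarith [h2 _ le_rfl]⟩
    exact ⟨z, fun _ => hz⟩
  choose z hz using hz
  have tails : ∀ ρ > 0, ∃ R, ∀ t ≥ 0, ∀ x,
      (z t + R ≤ x → 1 - ρ ≤ v t x) ∧ (x ≤ z t - R → v t x ≤ ρ) := by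
    intro ρ hρ
    obtain ⟨C, hC⟩ := htails (min ρ (1 / 4)) (by positivity)
    refine ⟨2 * C, fun t ht x => ?_⟩
    obtain ⟨y, h1, h2⟩ := hC t ht
    have m1 := min_le_left ρ (1 / 4)
    have m2 := min_le_right ρ (1 / 4)
    have h3 : y - C ≤ z t := by
      by_contra! h
      linarith [h1 _ h.le, hz t ht]
    have h4 : z t ≤ y + C := by
      by_contra! h
      linarith [h2 _ h.le, hz t ht]
    exact ⟨fun hx => by linarith [h2 x (by linarith)], fun hx => by linarith [h1 x (by linarith)]⟩
  have drift : ∃ C, ∀ t ≥ 0, |z (t + 1) - z t| ≤ C := by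
    obtain ⟨R₁, hR₁, hLC⟩ := exists_localComparison hS hG 1 (ρ := 1 / 8) (by norm_num)
    set b := max (7 / 8) ((1 + a) / 2) with hb
    have hb1 : b < 1 := max_lt (by norm_num) (by linarith [ha.2])
    have hba : a < b := lt_of_lt_of_le (by linarith [ha.2]) (le_max_right _ _)
    have hb7 : 7 / 8 ≤ b := le_max_left _ _
    set d := min (1 / 8) (a / 2) with hd
    have hd0 : 0 < d := lt_min (by norm_num) (by linarith [ha.1])
    have hda : d < a := lt_of_le_of_lt (min_le_right _ _) (by linarith [ha.1])
    have hd8 : d ≤ 1 / 8 := min_le_left _ _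
    obtain ⟨R₂, hR₂⟩ := tails (1 - b) (by linarith)
    obtain ⟨R₃, hR₃⟩ := tails d hd0
    refine ⟨|R₁| + |R₂| + |R₃|, fun t ht => ?_⟩
    have hs := hv.shift ht
    have hsr : ∀ s ≥ (0 : ℝ), ∀ x, v (t + s) x ∈ Icc (0 : ℝ) 1 :=
      fun s hs x => hvr _ (by linarith) x
    have h1 := hLC.lower_right (p := fun _ => b) (x₀ := z t + R₂) two_pos
      (isSubsolution_of_const hS.const two_pos (hsign.1 b (Or.inr ⟨hba, hb1⟩)).le)
      (fun _ _ => ⟨by linarith, hb1.le⟩) hs hsr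
      (fun x hx => by
        rw [add_zero]
        linarith [(hR₂ t ht x).1 hx]) 1 ⟨zero_le_one, one_lt_two⟩ le_rfl
    have h2 := hLC.upper_left (p := fun _ => d) (x₀ := z t - R₃) two_pos
      (isSupersolution_of_const hS.const two_pos (hsign.2 d (Or.inl ⟨hd0, hda⟩)).le)
      (fun _ _ => ⟨hd0.le, by linarith⟩) hs hsr
      (fun x hx => by
        rw [add_zero]
        exact (hR₃ t ht x).2 hx) 1 ⟨zero_le_one, one_lt_two⟩ le_rfl
    have h3 : z (t + 1) ≤ z t + R₂ + R₁ := by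
      by_contra! h
      linarith [h1 _ h.le, hz (t + 1) (by linarith)]
    have h4 : z t - R₃ - R₁ ≤ z (t + 1) := by
      by_contra! h
      linarith [h2 _ h.le, hz (t + 1) (by linarith)]
    have a1 := le_abs_self R₁
    have a2 := le_abs_self R₂
    have a3 := le_abs_self R₃
    have b2 := abs_nonneg R₂
    have b3 := abs_nonneg R₃
    exact abs_le.2 ⟨by linarith, by linarith⟩
  obtain ⟨η, hη0, hηc, hη⟩ := hη
  refine ⟨z, hv, fun t ht => hvr t ht.le, fun t ht => (hM t ht.le).differentiable,
    fun t ht x => ?_, fun t ht x => ?_, fun ρ hρ => ?_, fun R => ?_,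
    ⟨M, fun t ht x => (le_abs_self _).trans ((hM t (by linarith)).abs_deriv_le x)⟩,
    fun ρ hρ => ?_, ?_⟩
  · have hlim : Tendsto (fun p : ℝ × ℝ => M * |p.2 - x| + |v p.1 x - v t x|) (𝓝 (t, x)) (𝓝 0) := by
      have h1 : Tendsto (fun p : ℝ × ℝ => v p.1 x) (𝓝 (t, x)) (𝓝 (v t x)) :=
        (hv.2 t ht x).continuousAt.tendsto.comp continuous_fst.continuousAt
      have h2 : Tendsto (fun p : ℝ × ℝ => p.2) (𝓝 (t, x)) (𝓝 x) := continuous_snd.continuousAt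
      have := ((h2.sub_const x).abs.const_mul M).add (h1.sub_const (v t x)).abs
      simpa using this
    refine tendsto_iff_dist_tendsto_zero.2 (squeeze_zero' (.of_forall fun _ => dist_nonneg) ?_ hlim)
    filter_upwards [continuous_fst.continuousAt.eventually (lt_mem_nhds ht :
      ∀ᶠ s in 𝓝 ((t, x) : ℝ × ℝ).1, 0 < s)] with p hp
    rw [Real.dist_eq]
    exact (abs_sub_le _ (v p.1 x) _).trans
      (add_le_add_left ((hM p.1 hp.le).abs_sub_le p.2 x) _)
  · have hlim : Tendsto (fun p : ℝ × ℝ => M * |p.2 - x|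
        + |_root_.deriv (v p.1) x - _root_.deriv (v t) x|) (𝓝 (t, x)) (𝓝 0) := by
      have h0 : Tendsto (fun s => _root_.deriv (v s) x) (𝓝 t) (𝓝 (_root_.deriv (v t) x)) :=
        tendsto_deriv_of_boundedCk ((lt_mem_nhds ht).mono fun s hs => hM s hs.le) (hM t ht.le)
          (fun y => (hv.2 t ht y).continuousAt.tendsto) x
      have h1 : Tendsto (fun p : ℝ × ℝ => _root_.deriv (v p.1) x) (𝓝 (t, x))
          (𝓝 (_root_.deriv (v t) x)) := h0.comp continuous_fst.continuousAt
      have h2 : Tendsto (fun p : ℝ × ℝ => p.2) (𝓝 (t, x)) (𝓝 x) := continuous_snd.continuousAt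
      have := ((h2.sub_const x).abs.const_mul M).add (h1.sub_const (_root_.deriv (v t) x)).abs
      simpa using this
    refine tendsto_iff_dist_tendsto_zero.2 (squeeze_zero' (.of_forall fun _ => dist_nonneg) ?_ hlim)
    filter_upwards [continuous_fst.continuousAt.eventually (lt_mem_nhds ht :
      ∀ᶠ s in 𝓝 ((t, x) : ℝ × ℝ).1, 0 < s)] with p hp
    rw [Real.dist_eq]
    exact (abs_sub_le _ (_root_.deriv (v p.1) x) _).trans
      (add_le_add_left ((hM p.1 hp.le).abs_deriv_sub_le p.2 x) _)
  · obtain ⟨R, hR⟩ := tails ρ hρ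
    exact ⟨R, fun t ht => hR t (by linarith)⟩
  · obtain ⟨R₀, hR₀⟩ := tails (1 / 4) (by norm_num)
    obtain ⟨C, hC⟩ := drift
    obtain ⟨N, hN⟩ := exists_nat_gt (2 * |R₀|)
    have hN0 : (0 : ℝ) < N := by linarith [abs_nonneg R₀]
    set B := |R| + C + |R₀| + N with hB
    have hC0 : 0 ≤ C := (abs_nonneg _).trans (hC 0 le_rfl)
    have hc1 : ContinuousOn (fun r => η r 1) (Icc 0 B) :=
      hηc.comp (f := fun r : ℝ => (r, (1 : ℝ))) (by fun_prop) fun r hr => ⟨hr.1, mem_Ioi.2 one_pos⟩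
    obtain ⟨r, hr, hmin⟩ := isCompact_Icc.exists_isMinOn ⟨0, le_rfl, by positivity⟩ hc1
    refine ⟨η r 1 * (1 / (2 * N)), mul_pos (hη0 r hr.1 1 one_pos) (by positivity),
      fun t ht x hx => ?_⟩
    have ht1 : 0 ≤ t - 1 := by linarith
    set Z := z (t - 1) - |R₀| with hZ
    -- the increase by `1 / 2` over `N` unit intervals is at least `1 / (2 N)` on one of them
    obtain ⟨k, hk, hjump⟩ : ∃ k ∈ Finset.range N,
        1 / (2 * N) ≤ v (t - 1) (Z + (k + 1 : ℕ)) - v (t - 1) (Z + (k : ℕ)) := by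
      by_contra! hcon
      have hsum := Finset.sum_range_sub (fun k : ℕ => v (t - 1) (Z + k)) N
      have hle := Finset.sum_lt_sum_of_nonempty (s := Finset.range N)
        (by simpa using Nat.pos_iff_ne_zero.1 (by exact_mod_cast hN0)) hcon
      rw [hsum, Finset.sum_const, Finset.card_range, nsmul_eq_mul] at hle
      have e : (N : ℝ) * (1 / (2 * N)) = 1 / 2 := by field_simp
      rw [e] at hle
      have h1 := (hR₀ (t - 1) ht1 (Z + N)).1 (by linarith [le_abs_self R₀])
      have h2 := (hR₀ (t - 1) ht1 (Z + (0 : ℕ))).2 (by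
        rw [Nat.cast_zero]; linarith [le_abs_self R₀])
      linarith
    have hkN : (k : ℝ) ≤ N := by exact_mod_cast (Finset.mem_range.1 hk).le
    have hk0 : (0 : ℝ) ≤ k := k.cast_nonneg
    have h1 := mul_le_deriv hS.trans hη0 hη hv hvr hvm hM ht x (Z + k)
    have e : Z + k + 1 = Z + (k + 1 : ℕ) := by push_cast; ring
    rw [e] at h1
    refine le_trans ?_ h1
    have hd := hC (t - 1) ht1
    rw [sub_add_cancel] at hd
    have hd := abs_le.1 hd
    have hx := abs_le.1 hx
    have hB' : |x - (Z + k)| ≤ B := abs_le.2 ⟨by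
      linarith [le_abs_self R, abs_nonneg R₀], by linarith [le_abs_self R, abs_nonneg R₀]⟩
    have hη1 : η r 1 ≤ η |x - (Z + k)| 1 := hmin ⟨abs_nonneg _, hB'⟩
    have : 0 < η r 1 := hη0 r hr.1 1 one_pos
    exact mul_le_mul hη1 hjump (by positivity) (by linarith)
  · set s := ρ / (2 * (M + 1)) with hs
    have hs0 : 0 < s := by positivity
    have hMs : M * s ≤ ρ / 2 := by
      have : 2 * (M + 1) * s = ρ := by rw [hs]; field_simp
      linarith
    obtain ⟨R, hR⟩ := tails (ρ * s / 2) (by positivity)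
    refine ⟨R + s, fun t ht x hx => ?_⟩
    have ht0 : 0 ≤ t := by linarith
    have h1 := (abs_le.1 ((hM t ht0).abs_sub_sub_deriv_le x hs0.le)).1
    have h2 : v t (x + s) - v t x ≤ ρ * s / 2 := by
      rcases le_abs.1 hx with h | h
      · linarith [(hR t ht0 x).1 (by linarith), (hvr t ht0 (x + s)).2]
      · linarith [(hR t ht0 (x + s)).2 (by linarith), (hvr t ht0 x).1]
    have h3 := mul_le_mul_of_nonneg_right hMs hs0.le
    by_contra! hcon
    have := mul_lt_mul_of_pos_right hcon hs0
    linarith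
  · obtain ⟨C, hC⟩ := drift
    exact ⟨C, fun t ht => hC t (by linarith)⟩

end NonlinOp

end

section

variable {X : Phase}

/-! ### The front converges to a traveling wave -/

theorem BoundedCk.comp_sub_const {M : ℝ} {n : ℕ} {g : ℝ → ℝ} (h : BoundedCk n M g) (s : ℝ) :
    BoundedCk n M (fun x => g (x - s)) :=
  ⟨h.1.comp (contDiff_id.sub contDiff_const), fun k hk x => by
    rw [iteratedDeriv_comp_sub_const]; exact h.2 k hk (x - s)⟩

/-- Uniform limits of functions with bounded second derivatives are `C^1`, and the derivatives
converge uniformly. -/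
theorem tendstoUniformly_deriv_of_boundedCk {M : ℝ} {g : ℕ → ℝ → ℝ} {U : ℝ → ℝ}
    (hg : ∀ n, BoundedCk 2 M (g n)) (hU : TendstoUniformly g U atTop) :
    ContDiff ℝ 1 U ∧ TendstoUniformly (fun n => deriv (g n)) (deriv U) atTop := by
  have hM := (hg 0).nonneg
  have hcau : UniformCauchySeqOn (fun n => deriv (g n)) atTop univ := by
    rw [Metric.uniformCauchySeqOn_iff]
    intro ε hε
    set s := ε / (4 * (M + 1)) with hs
    have hs0 : 0 < s := by positivity
    have hMs : 2 * M * s ≤ ε / 2 := by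
      have : 4 * (M + 1) * s = ε := by rw [hs]; field_simp
      nlinarith
    obtain ⟨N, hN⟩ := eventually_atTop.1 (Metric.tendstoUniformly_iff.1 hU (ε * s / 8)
      (by positivity))
    refine ⟨N, fun m hm n hn x _ => ?_⟩
    have hmn : ∀ x, |g m x - g n x| < ε * s / 4 := fun x => by
      have h1 := hN m hm x
      have h2 := hN n hn x
      have h3 := dist_triangle_left (g m x) (g n x) (U x)
      rw [← Real.dist_eq]
      linarith
    rw [Real.dist_eq]
    have h3 := (hg m).abs_deriv_sub_deriv_le (hg n) x hs0.le
    have h4 := mul_le_mul_of_nonneg_right hMs hs0.le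
    by_contra! hcon
    have := mul_le_mul_of_nonneg_right hcon hs0.le
    linarith [hmn x, hmn (x + s)]
  have hlim : ∀ x, ∃ y, Tendsto (fun n => deriv (g n) x) atTop (𝓝 y) := fun x =>
    cauchySeq_tendsto_of_complete (hcau.cauchySeq (mem_univ x))
  choose G hG using hlim
  have hunif : TendstoUniformly (fun n => deriv (g n)) G atTop :=
    tendstoUniformlyOn_univ.1 (hcau.tendstoUniformlyOn_of_tendsto fun x _ => hG x)
  have hd : ∀ x, HasDerivAt U (G x) x := hasDerivAt_of_tendstoUniformly hunif
    (.of_forall fun n x => ((hg n).differentiable x).hasDerivAt) fun x => hU.tendsto_at x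
  have hdU : deriv U = G := funext fun x => (hd x).deriv
  rw [hdU]
  refine ⟨contDiff_one_iff_deriv.2 ⟨fun x => (hd x).differentiableAt, ?_⟩, hunif⟩
  rw [hdU]
  exact hunif.continuous (.of_forall fun n => (hg n).1.continuous_deriv (by norm_num))

/-- Additive functions on `[0,∞)` which are bounded on `[1,2]` are linear. -/
theorem eq_mul_of_additive {g : ℝ → ℝ} (hadd : ∀ s ≥ 0, ∀ t ≥ 0, g (s + t) = g s + g t) {B : ℝ}
    (hB : ∀ t ∈ Icc (1 : ℝ) 2, |g t| ≤ B) {t : ℝ} (ht : 0 ≤ t) : g t = t * g 1 := by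
  have h0 : g 0 = 0 := by simpa using hadd 0 le_rfl 0 le_rfl
  have hmul : ∀ n : ℕ, ∀ t ≥ 0, g (n * t) = n * g t := by
    intro n t ht
    induction n with
    | zero => simpa using h0
    | succ n ih =>
      push_cast
      rw [add_mul, one_mul, hadd _ (by positivity) _ ht, ih]
      ring
  -- the difference to the linear function is periodic, hence bounded
  have hbd : ∀ t ≥ 1, |g t - t * g 1| ≤ 3 * B := by
    intro t ht
    set n := ⌊t - 1⌋₊ with hn
    have h1 : (n : ℝ) ≤ t - 1 := Nat.floor_le (by linarith)
    have h2 : t - 1 < n + 1 := Nat.lt_floor_add_one _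
    have h3 := hadd (t - n) (by linarith) n n.cast_nonneg
    have h4 := hmul n 1 zero_le_one
    rw [mul_one] at h4
    rw [sub_add_cancel, h4] at h3
    have e : g t - t * g 1 = g (t - n) - (t - n) * g 1 := by rw [h3]; ring
    have h5 := hB (t - n) ⟨by linarith, by linarith⟩
    have h6 := hB 1 ⟨le_rfl, one_le_two⟩
    have h7 : |(t - n) * g 1| ≤ 2 * B := by
      rw [abs_mul, abs_of_nonneg (by linarith : (0 : ℝ) ≤ t - n)]
      exact mul_le_mul (by linarith) h6 (abs_nonneg _) zero_le_two
    rw [e]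
    linarith [abs_sub (g (t - n)) ((t - n) * g 1)]
  rcases ht.eq_or_lt with h | h
  · rw [← h, h0, zero_mul]
  by_contra hne
  have hpos : 0 < |g t - t * g 1| := abs_pos.2 (sub_ne_zero.2 hne)
  obtain ⟨n, hn⟩ := exists_nat_gt (max (1 / t) (3 * B / |g t - t * g 1|))
  have h1 : 1 ≤ n * t := by
    rw [← div_le_iff₀ h]
    exact (le_max_left _ _).trans hn.le
  have h2 : 3 * B < n * |g t - t * g 1| := by
    rw [← div_lt_iff₀ hpos]
    exact (le_max_right _ _).trans_lt hn
  have h3 := hbd _ h1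
  rw [hmul n t ht] at h3
  have e : n * g t - n * t * g 1 = n * (g t - t * g 1) := by ring
  rw [e, abs_mul, Nat.abs_cast] at h3
  linarith

namespace NonlinOp

variable {A : NonlinOp X} {T : ℝ} {u v w V : ℝ → ℝ → ℝ} {f z U p : ℝ → ℝ} {a c Λ γ s₁ k M q : ℝ}

/-- The limit of a front in a moving frame is a monotone profile. -/
theorem IsFront.limit_profile (hV : A.IsFront V z) (hM : ∀ t ≥ 0, BoundedCk 2 M (V t))
    (hU : TendstoUniformly (fun (n : ℕ) x => V (n + 1) (x - (n + 1) * q)) U atTop) :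
    ContDiff ℝ 1 U ∧ Tendsto U atBot (𝓝 0) ∧ Tendsto U atTop (𝓝 1) ∧
      Tendsto (_root_.deriv U) (cocompact ℝ) (𝓝 0) ∧ ∀ x, 0 < _root_.deriv U x := by
  obtain ⟨hC1, hdU⟩ := tendstoUniformly_deriv_of_boundedCk
    (fun n : ℕ => (hM (n + 1) (by positivity)).comp_sub_const ((n + 1) * q)) hU
  have e : (fun n : ℕ => _root_.deriv fun x => V (n + 1) (x - (n + 1) * q))
      = fun (n : ℕ) x => _root_.deriv (V (n + 1)) (x - (n + 1) * q) := by
    funext n x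
    exact deriv_comp_sub_const (f := V (n + 1)) _ x
  rw [e] at hdU
  have hn1 : ∀ n : ℕ, (1 : ℝ) ≤ n + 1 := fun n => by linarith [n.cast_nonneg (α := ℝ)]
  have hbot : Tendsto U atBot (𝓝 0) := by
    refine hU.tendsto_of_eventually_tendsto (L := fun _ => 0) (.of_forall fun n => ?_)
      tendsto_const_nhds
    rw [Metric.tendsto_nhds]
    intro ε hε
    obtain ⟨R, hR⟩ := hV.tails (ε / 2) (by positivity)
    filter_upwards [eventually_le_atBot (z (n + 1) - R + (n + 1) * q)] with x hx
    have h1 := (hR (n + 1) (hn1 n) (x - (n + 1) * q)).2 (by linarith)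
    have h2 := hV.mem (n + 1) (by linarith [hn1 n]) (x - (n + 1) * q)
    rw [Real.dist_eq, sub_zero, abs_of_nonneg h2.1]
    linarith
  have htop : Tendsto U atTop (𝓝 1) := by
    refine hU.tendsto_of_eventually_tendsto (L := fun _ => 1) (.of_forall fun n => ?_)
      tendsto_const_nhds
    rw [Metric.tendsto_nhds]
    intro ε hε
    obtain ⟨R, hR⟩ := hV.tails (ε / 2) (by positivity)
    filter_upwards [eventually_ge_atTop (z (n + 1) + R + (n + 1) * q)] with x hx
    have h1 := (hR (n + 1) (hn1 n) (x - (n + 1) * q)).1 (by linarith)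
    have h2 := hV.mem (n + 1) (by linarith [hn1 n]) (x - (n + 1) * q)
    rw [Real.dist_eq, abs_sub_comm, abs_of_nonneg (by linarith [h2.2])]
    linarith
  refine ⟨hC1, hbot, htop, ?_, fun x => ?_⟩
  · refine hdU.tendsto_of_eventually_tendsto (L := fun _ => 0) (.of_forall fun n => ?_)
      tendsto_const_nhds
    rw [Metric.tendsto_nhds]
    intro ε hε
    obtain ⟨R, hR⟩ := hV.flat (ε / 2) (by positivity)
    have hco : Tendsto (fun x : ℝ => |x|) (cocompact ℝ) atTop := tendsto_norm_cocompact_atTop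
    filter_upwards [hco.eventually_ge_atTop (R + |(n + 1) * q + z (n + 1)|)] with x hx
    have h1 := hR (n + 1) (hn1 n) (x - (n + 1) * q) (by
      have := abs_sub_abs_le_abs_sub x ((n + 1) * q + z (n + 1))
      rw [sub_sub]
      linarith)
    have h2 := hV.deriv_pos (hn1 n) (x - (n + 1) * q)
    rw [Real.dist_eq, sub_zero, abs_of_pos h2]
    linarith
  · -- the interface stays bounded in the moving frame
    obtain ⟨R, hR⟩ := hV.tails (1 / 4) (by norm_num)
    obtain ⟨x₁, h₁⟩ := eventually_atBot.1 (hbot.eventually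
      (gt_mem_nhds (by norm_num : (0 : ℝ) < 1 / 4)))
    obtain ⟨x₂, h₂⟩ := eventually_atTop.1 (htop.eventually
      (lt_mem_nhds (by norm_num : (3 / 4 : ℝ) < 1)))
    obtain ⟨m, hm, hsteep⟩ := hV.steep (|x| + |x₁| + |x₂| + 2 * |R|)
    refine hm.trans_le (ge_of_tendsto (hdU.tendsto_at x) ?_)
    have hx₁ : U (x₁ - |R|) < 3 / 4 := by
      linarith [h₁ (x₁ - |R|) (by linarith [abs_nonneg R])]
    have hx₂ : 1 / 4 < U (x₂ + |R|) := by
      linarith [h₂ (x₂ + |R|) (by linarith [abs_nonneg R])]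
    filter_upwards [(hU.tendsto_at (x₁ - |R|)).eventually (gt_mem_nhds hx₁),
      (hU.tendsto_at (x₂ + |R|)).eventually (lt_mem_nhds hx₂)] with n h3 h4
    refine hsteep _ (hn1 n) _ ?_
    have h5 : x₁ - |R| - (n + 1) * q < z (n + 1) + R := by
      by_contra! h
      linarith [(hR _ (hn1 n) _).1 h]
    have h6 : z (n + 1) - R < x₂ + |R| - (n + 1) * q := by
      by_contra! h
      linarith [(hR _ (hn1 n) _).2 h]
    rw [abs_le]
    constructor <;> linarith [le_abs_self x, neg_abs_le x, le_abs_self x₁, neg_abs_le x₁,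
      le_abs_self x₂, neg_abs_le x₂, le_abs_self R]

/-- A front converges, at an exponential rate, to each of its own shifts in time, after a
translation. -/
theorem IsFront.exists_self_rate (hV : A.IsFront V z) (hS : A.Standing f) (hE : A.DerivBounded)
    (hη : A.ComparisonAtOne) (hVr : ∀ t ≥ 0, ∀ x, V t x ∈ Icc (0 : ℝ) 1) :
    ∃ κ > 0, ∃ ξ K : ℝ → ℝ, ∀ τ ≥ 0, ∀ t ≥ 1, ∀ x,
      |V (τ + t) x - V t (x + ξ τ)| ≤ K τ * Real.exp (-κ * t) := by
  obtain ⟨δ₁, hδ₁, κ, hκ, hrate⟩ := hV.exists_rate hS hE hη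
  have h : ∀ τ, ∃ ξ K, 0 ≤ τ → ∀ t ≥ 1, ∀ x,
      |V (τ + t) x - V t (x + ξ)| ≤ K * Real.exp (-κ * t) := by
    intro τ
    rcases lt_or_ge τ 0 with h | h
    · exact ⟨0, 0, fun h' => absurd h' (not_le.2 h)⟩
    obtain ⟨R, hR⟩ := hV.tails δ₁ hδ₁
    obtain ⟨ξ, K, hK⟩ := hrate (fun t => V (τ + t)) (hV.sol.shift h)
      (fun t ht => hVr _ (by linarith)) ⟨1, le_rfl, hV.exists_sandwiched
        (u := fun t => V (τ + t)) (Y := |z (τ + 1)| + R) le_rfl hδ₁ (hVr _ (by linarith))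
        (fun x hx => (hR (τ + 1) (by linarith) x).1 (by linarith [le_abs_self (z (τ + 1))]))
        (fun x hx => (hR (τ + 1) (by linarith) x).2 (by linarith [neg_abs_le (z (τ + 1))]))⟩
    exact ⟨ξ, K, fun _ => hK⟩
  choose ξ K hK using h
  exact ⟨κ, hκ, ξ, K, hK⟩

/-- A front gives rise to a wave. Comparing the front with its shift by one unit of time shows that
it converges geometrically to a profile `U` in a moving frame. Comparing it with the shift by `τ`
shows that the solution starting at `U` is the translate `U (· + ξ τ)` at time `τ`. Then `ξ` is
additive and locally bounded, thus linear. -/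
theorem IsFront.exists_monotoneWave (hV : A.IsFront V z) (hS : A.Standing f)
    (hE : A.DerivBounded) (hη : A.ComparisonAtOne) (hsemi : A.GeneratesSemigroup)
    (hVr : ∀ t ≥ 0, ∀ x, V t x ∈ Icc (0 : ℝ) 1) (hM : ∀ t ≥ 0, BoundedCk 2 M (V t)) :
    ∃ U c, A.IsMonotoneWave U c := by
  obtain ⟨Λ, hΛ0, hΛ⟩ := hS.exists_shiftLipschitz hE
  obtain ⟨κ, hκ, ξ, K, hrate⟩ := hV.exists_self_rate hS hE hη hVr
  have hn1 : ∀ n : ℕ, (1 : ℝ) ≤ n + 1 := fun n => by linarith [n.cast_nonneg (α := ℝ)]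
  set q := ξ 1 with hq
  set r := Real.exp (-κ) with hr
  have hr1 : r < 1 := by
    rw [hr, ← Real.exp_zero]; exact Real.exp_lt_exp.2 (by linarith)
  have hr0 : 0 < r := Real.exp_pos _
  have hexp : ∀ n : ℕ, Real.exp (-κ * (n + 1)) = r * r ^ n := fun n => by
    rw [hr, ← Real.exp_nat_mul, ← Real.exp_add]; congr 1; ring
  set W : ℕ → ℝ → ℝ := fun n x => V (n + 1) (x - (n + 1) * q) with hW
  -- in the frame moving by `-q` per unit of time the front converges geometrically
  have hstep : ∀ x n, dist (W n x) (W (n + 1) x) ≤ K 1 * r * r ^ n := by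
    intro x n
    have := hrate 1 zero_le_one (n + 1) (hn1 n) (x - (n + 1 + 1) * q)
    rw [hexp, ← mul_assoc] at this
    rw [dist_comm, Real.dist_eq]
    convert! this using 3
    · simp only [hW]
      push_cast
      rw [add_comm (1 : ℝ)]
    · simp only [hW]
      congr 1
      rw [hq]; ring
  have hlim : ∀ x, ∃ y, Tendsto (fun n => W n x) atTop (𝓝 y) := fun x =>
    cauchySeq_tendsto_of_complete (cauchySeq_of_le_geometric r _ hr1 (hstep x))
  choose U hU using hlim
  set ε : ℕ → ℝ := fun n => K 1 * r * r ^ n / (1 - r) with hε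
  have hWU : ∀ n x, |W n x - U x| ≤ ε n := fun n x => by
    have := dist_le_of_le_geometric_of_tendsto r _ hr1 (hstep x) (hU x) n
    rwa [Real.dist_eq] at this
  have hε0 : ∀ n, 0 ≤ ε n := fun n => (abs_nonneg _).trans (hWU n 0)
  have hεlim : Tendsto ε atTop (𝓝 0) := by
    have := ((tendsto_pow_atTop_nhds_zero_of_lt_one hr0.le hr1).const_mul (K 1 * r)).div_const
      (1 - r)
    simpa using this
  have hunif : TendstoUniformly W U atTop := by
    rw [Metric.tendstoUniformly_iff]
    intro δ hδ
    filter_upwards [hεlim.eventually (gt_mem_nhds hδ)] with n hn x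
    rw [dist_comm, Real.dist_eq]
    exact (hWU n x).trans_lt hn
  obtain ⟨hC1, hbot, htop, hflat, hpos⟩ := hV.limit_profile hM hunif
  have hUmono : StrictMono U := strictMono_of_deriv_pos hpos
  -- the limit at a time shifted by `τ`
  have hshift : ∀ τ ≥ 0, ∀ x, Tendsto (fun n : ℕ => V (τ + (n + 1)) (x - (n + 1) * q)) atTop
      (𝓝 (U (x + ξ τ))) := by
    intro τ hτ x
    refine (hU (x + ξ τ)).congr_dist ?_
    refine squeeze_zero (fun _ => dist_nonneg) (g := fun n : ℕ => K τ * (r * r ^ n))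
      (fun n => ?_) ?_
    · have := hrate τ hτ (n + 1) (hn1 n) (x - (n + 1) * q)
      rw [hexp] at this
      rw [dist_comm, Real.dist_eq]
      convert! this using 3
      simp only [hW]
      congr 1
      ring
    · have := ((tendsto_pow_atTop_nhds_zero_of_lt_one hr0.le hr1).const_mul r).const_mul (K τ)
      simpa using this
  have hUr : ∀ x, U x ∈ Icc (0 : ℝ) 1 := fun x =>
    isClosed_Icc.mem_of_tendsto (hU x) (.of_forall fun n => hVr _ (by positivity) _)
  obtain ⟨w, hw, hw0⟩ := hsemi.exists_solution (g := U) (Phase.mem_of_continuous hC1.continuous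
    ⟨1, fun x => abs_le.2 ⟨by linarith [(hUr x).1], (hUr x).2⟩⟩)
  have hwr := hw.mem_Icc hS.comp hΛ hΛ0 hS.const hS.bistable.2.1 hS.bistable.2.2.1 (by
    rw [hw0]; exact hUr)
  -- by continuous dependence on the initial value, the solution starting at `U` is a translate
  -- of `U` at each time
  have hwU : ∀ τ ≥ 0, ∀ x, w τ x = U (x + ξ τ) := by
    intro τ hτ x
    refine tendsto_nhds_unique ?_ (hshift τ hτ x)
    have h1 : Tendsto (fun n => ε n * Real.exp (Λ * τ)) atTop (𝓝 0) := by
      simpa using hεlim.mul_const (Real.exp (Λ * τ))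
    have h2 : Tendsto (fun n => ε n * Real.exp (Λ * (τ + 1))) atTop (𝓝 0) := by
      simpa using hεlim.mul_const (Real.exp (Λ * (τ + 1)))
    refine tendsto_iff_dist_tendsto_zero.2 (squeeze_zero' (.of_forall fun _ => dist_nonneg) ?_ h1)
    filter_upwards [h2.eventually (gt_mem_nhds one_pos)] with n hn
    have hs := (hV.sol.shift (s := n + 1) (by positivity)).translate hS.trans (-((n + 1) * q))
    have hsr : ∀ t ≥ (0 : ℝ), ∀ x, V (n + 1 + t) (x + -((n + 1) * q)) ∈ Icc (0 : ℝ) 1 :=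
      fun t ht x => hVr _ (by positivity) _
    have e : ∀ x, V (n + 1 + 0) (x + -((n + 1) * q)) = W n x := fun x => by
      rw [add_zero, ← sub_eq_add_neg]
    have h3 := hs.le_add_of_le_add hS.comp hΛ hΛ0 hw hsr (hε0 n) hτ hn (fun y => by
      rw [e, hw0]; linarith [(abs_le.1 (hWU n y)).1]) x
    have h4 := hw.le_add_of_le_add hS.comp hΛ hΛ0 hs hwr (hε0 n) hτ hn (fun y => by
      rw [e, hw0]; linarith [(abs_le.1 (hWU n y)).2]) x
    rw [← sub_eq_add_neg, add_comm (n + 1 : ℝ)] at h3 h4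
    rw [Real.dist_eq]
    exact abs_le.2 ⟨by linarith, by linarith⟩
  have hadd : ∀ s ≥ 0, ∀ t ≥ 0, ξ (s + t) = ξ s + ξ t := by
    intro s hs t ht
    have h1 := hw.shift hs
    have h2 := hw.translate hS.trans (ξ s)
    have h3 : ∀ y, w (s + 0) y = w 0 (y + ξ s) := fun y => by rw [add_zero, hwU s hs, hw0]
    have h4 : w (s + t) 0 = w t (0 + ξ s) := by
      have e1 := h1.le_add_of_le_add hS.comp hΛ hΛ0 h2 (fun t ht => hwr _ (by positivity))
        (le_refl (0 : ℝ)) ht (by simp) (fun y => by rw [h3, add_zero]) 0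
      have e2 := h2.le_add_of_le_add hS.comp hΛ hΛ0 h1 (fun t ht _ => hwr _ ht _)
        (le_refl (0 : ℝ)) ht (by simp) (fun y => by rw [h3, add_zero]) 0
      rw [zero_mul, add_zero] at e1 e2
      exact le_antisymm e2 e1
    rw [hwU _ (add_nonneg hs ht), hwU t ht] at h4
    have := hUmono.injective h4
    linarith
  have hcont : ContinuousOn (fun t => w t 0) (Icc 1 2) := fun t ht =>
    (hw.2 t (by linarith [ht.1]) 0).continuousAt.continuousWithinAt
  obtain ⟨t₁, ht₁, hmin⟩ := isCompact_Icc.exists_isMinOn ⟨1, le_rfl, one_le_two⟩ hcont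
  obtain ⟨t₂, ht₂, hmax⟩ := isCompact_Icc.exists_isMaxOn ⟨1, le_rfl, one_le_two⟩ hcont
  have hle : ∀ s ∈ Icc (1 : ℝ) 2, ∀ t ∈ Icc (1 : ℝ) 2, w s 0 ≤ w t 0 → ξ s ≤ ξ t := by
    intro s hs t ht h
    rw [hwU s (by linarith [hs.1]), hwU t (by linarith [ht.1]), hUmono.le_iff_le] at h
    linarith
  have hlin : ∀ t ≥ 0, ξ t = t * q := fun t ht =>
    eq_mul_of_additive hadd (B := |ξ t₁| + |ξ t₂|) (fun s hs => by
      have h1 := hle t₁ ht₁ s hs (hmin hs)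
      have h2 := hle s hs t₂ ht₂ (hmax hs)
      exact abs_le.2 ⟨by linarith [neg_abs_le (ξ t₁), abs_nonneg (ξ t₂)],
        by linarith [le_abs_self (ξ t₂), abs_nonneg (ξ t₁)]⟩) ht
  refine ⟨U, -q, ⟨hw.congr fun t ht => ?_, hbot, htop⟩, hC1, hflat, hpos⟩
  funext x
  rw [hwU t ht, hlin t ht]
  congr 1
  ring

end NonlinOp

end

end ChenWaves

end

theorem mainTheorem5 (X : ChenWaves.Phase) (A : ChenWaves.NonlinOp X) (f : ℝ → ℝ)
    (hsemi : A.GeneratesSemigroup) (htrans : A.TranslationInvariant)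
    (hconst : A.OnConstants f) (hf : ChenWaves.Bistable f)
    (hcomp : A.ComparisonPrinciple) (hderiv : A.HasDerivatives) :
    -- uniqueness
    (∀ (K₁ K₂ : ℝ) (ν : Measure ℝ), 0 < K₁ → 0 < K₂ → IsProbabilityMeasure ν →
      A.DerivBound K₁ K₂ ν →
      ∀ (U : ℝ → ℝ) (c : ℝ), A.IsMonotoneWave U c →
        ∀ (V : ℝ → ℝ) (d : ℝ), A.IsTravelingWave V d → Continuous V →
          (∀ ξ, V ξ ∈ Icc (0 : ℝ) 1) →
          c = d ∧ ∃ ξ₀ : ℝ, ∀ ξ, V ξ = U (ξ + ξ₀)) ∧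
    -- stability
    (∀ (K₁ K₂ Kt₂ : ℝ) (ν : Measure ℝ) (aminus aplus : ℝ),
      0 < K₁ → 0 < K₂ → 0 < Kt₂ → IsProbabilityMeasure ν →
      A.DerivBound K₁ K₂ ν →
      0 < aminus → aminus ≤ aplus → aplus < 1 → ChenWaves.SignPattern f aminus aplus →
      A.ComparisonAtOne →
      A.GlobalBound K₁ Kt₂ K₂ ν →
      ∀ (U : ℝ → ℝ) (c : ℝ), A.IsMonotoneWave U c →
        ∃ κ > 0, ∀ u₀ ∈ X.space, (∀ x, u₀ x ∈ Icc (0 : ℝ) 1) →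
          aplus < liminf u₀ atTop → limsup u₀ atBot < aminus →
          ∀ u : ℝ → ℝ → ℝ, A.IsSolution u → u 0 = u₀ →
            ∃ ξ K : ℝ, ∀ t ≥ 0, ∀ x,
              |u t x - U (x - c * t + ξ)| ≤ K * Real.exp (-κ * t)) ∧
    -- existence
    (∀ (K₁ K₂ Kt₂ K₃ : ℝ) (ν : Measure ℝ) (a : ℝ),
      a ∈ Ioo (0 : ℝ) 1 → ChenWaves.SignPattern f a a → 0 < deriv f a →
      A.ComparisonAtAllTimes →
      0 < K₁ → 0 < K₂ → 0 < Kt₂ → 0 < K₃ → IsProbabilityMeasure ν →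
      A.GlobalBound K₁ Kt₂ K₂ ν → A.QuadraticBound K₃ → A.DerivBound K₁ K₂ ν →
      A.UniformC2 →
      ∃ (U : ℝ → ℝ) (c : ℝ), A.IsMonotoneWave U c) := by
  have hS : A.Standing f := ⟨htrans, hconst, hf, hcomp, hderiv⟩
  refine ⟨?_, ?_, ?_⟩
  · intro K₁ K₂ ν hK₁ hK₂ hν hE U c hU V d hV hVc hVr
    exact hU.unique hS ⟨K₁, K₂, ν, hK₁, hK₂, hν, hE⟩ hV hVc hVr
  · intro K₁ K₂ Kt₂ ν am ap hK₁ hK₂ hKt₂ hν hE ham hle hap hsign hη hG U c hU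
    obtain ⟨κ, hκ, h⟩ := hU.stable hS ⟨K₁, K₂, ν, hK₁, hK₂, hν, hE⟩
      ⟨K₁, Kt₂, K₂, ν, hK₁, hKt₂, hK₂, hν, hG⟩ ham hap hle hsign hη
    refine ⟨κ, hκ, fun u₀ _ hr hinf hsup u hu hu0 => ?_⟩
    subst hu0
    exact h u hu hr hinf hsup
  · intro K₁ K₂ Kt₂ K₃ ν a ha hsign hd hη hK₁ hK₂ hKt₂ hK₃ hν hG hQ hE hC2
    have hE : A.DerivBounded := ⟨K₁, K₂, ν, hK₁, hK₂, hν, hE⟩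
    have hG : A.GloballyBounded := ⟨K₁, Kt₂, K₂, ν, hK₁, hKt₂, hK₂, hν, hG⟩
    obtain ⟨Λ, hΛ0, hΛ⟩ := hS.exists_shiftLipschitz hE
    obtain ⟨v, hv, hvr, hvm, ⟨M, hM⟩, htails⟩ :=
      ChenWaves.NonlinOp.exists_localized hS hΛ hΛ0 hG hQ hK₃.le hC2 hsemi ha hsign hd
    obtain ⟨z, hz⟩ := ChenWaves.NonlinOp.exists_isFront hS hG hη ha hsign hv hvr hvm hM htails
    exact hz.exists_monotoneWave hS hE hη.atOne hsemi hvr hM
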